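/- Let $n\ge 2$ and let $M$ be a smooth $n$-dimensional manifold diffeomorphic to the Euclidean sphere $S^n$. Let $(g,\nabla)$ be a statistical structure on $M$, that is, $g$ is a smooth Riemannian metric and $\nabla$ a smooth torsion-free affine connection on $M$ such that the cubic form $(\nabla g)(X,Y,Z)=(\nabla_X g)(Y,Z)$ is symmetric in all its arguments. Let $R(X,Y)Z=\nabla_X\nabla_YZ-\nabla_Y\nabla_XZ-\nabla_{[X,Y]}Z$ be the curvature tensor of $\nabla$, $\mathrm{Ric}(Y,Z)=\operatorname{tr}\{X\mapsto R(X,Y)Z\}$ its Ricci tensor, and let $\overline\nabla$ be the dual connection of $\nabla$ relative to $g$, defined by $X\,g(Y,Z)=g(\nabla_XY,Z)+g(Y,\overline\nabla_XZ)$, with curvature tensor $\overline R$. The structure is called conjugate symmetric if $R=\overline R$. The connection $\nabla$ is called projectively flat if every point of $M$ has an open neighbourhood $U$ with a smooth one-form $\varphi$ on $U$ such that the connection $\nabla'_XY=\nabla_XY+\varphi(X)Y+\varphi(Y)X$ on $U$ is flat. A connection is called complete if for every $p\in M$ and $v\in T_pM$ there is a geodesic $\gamma:\mathbb R\to M$ of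 the connection, defined on the whole real line, with $\gamma(0)=p$ and $\dot\gamma(0)=v$. 1. If $\mathrm{Ric}$ is symmetric and non-degenerate at every point and $\nabla$ is projectively flat, then $\nabla$ is complete. 2. If $(g,\nabla)$ is conjugate symmetric and $\nabla$ is projectively flat, then both $\nabla$ and $\overline\nabla$ are complete. -/

import Mathlib

open scoped Manifold ContDiff Topology Bundle

noncomputable section

namespace StatGeom

variable {E : Type*} [NormedAddCommGroup E] [NormedSpace ℝ E] [FiniteDimensional ℝ E]
  {H : Type*} [TopologicalSpace H] {I : ModelWithCorners ℝ E H}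
  {M : Type*} [TopologicalSpace M] [ChartedSpace H M] [IsManifold I ∞ M]

/-- Affine connections on `M`: covariant derivatives on the tangent bundle. The value of
`∇_X Y` at `x` is written `cov Y x (X x)`. -/
abbrev AffineConnection (I : ModelWithCorners ℝ E H) (M : Type*) [TopologicalSpace M]
    [ChartedSpace H M] [IsManifold I ∞ M] : Type _ :=
  CovariantDerivative I E (fun x : M ↦ TangentSpace I x)

/-! ### Curvature and Ricci tensor -/

/-- `∇_X ∇_Y Z - ∇_Y ∇_X Z - ∇_{[X, Y]} Z` for vector fields `X`, `Y`, `Z`. -/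
def curvatureField (cov : AffineConnection I M) (X Y Z : Π x : M, TangentSpace I x) (x : M) :
    TangentSpace I x :=
  cov (fun y ↦ cov Z y (Y y)) x (X x) - cov (fun y ↦ cov Z y (X y)) x (Y x)
    - cov Z x (VectorField.mlieBracket I X Y x)

/-- The curvature tensor `R(u, v) w` at `x`, computed on the extensions of `u`, `v`, `w` to
vector fields that are constant (hence smooth) in the preferred chart around `x`. -/
def curvature (cov : AffineConnection I M) (x : M) (u v w : TangentSpace I x) :
    TangentSpace I x :=
  curvatureField cov (FiberBundle.extend E u) (FiberBundle.extend E v) (FiberBundle.extend E w) x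

/-- If `∇` is smooth then `∇ Z` is differentiable at `x`, for `Z` the local constant extension
of a tangent vector at `x`. -/
theorem mdifferentiableAt_cov_extend [T2Space M] (cov : AffineConnection I M)
    [hcov : CovariantDerivative.ContMDiffCovariantDerivative cov ∞]
    {x : M} (w : TangentSpace I x) :
    MDifferentiableAt I (I.prod 𝓘(ℝ, E →L[ℝ] E))
      (fun y ↦ Bundle.TotalSpace.mk' (E →L[ℝ] E)
        (E := fun y : M ↦ TangentSpace I y →L[ℝ] TangentSpace I y) y
        (cov (FiberBundle.extend E w) y)) x := by
  obtain ⟨s, hs, hsw⟩ := FiberBundle.exists_contMDiffOn_extend (k := ∞) I E w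
  obtain ⟨u, hus, hu, hxu⟩ := mem_nhds_iff.1 hs
  obtain ⟨f, -, hf⟩ := (SmoothBumpFunction.nhds_basis_tsupport (I := I) x).mem_iff.1
    (hu.mem_nhds hxu)
  have h1 : ContMDiff I (I.prod 𝓘(ℝ, E)) ∞
      (fun y ↦ Bundle.TotalSpace.mk' E (E := fun y : M ↦ TangentSpace I y) y
        (((f : M → ℝ) • FiberBundle.extend E w : Π y : M, TangentSpace I y) y)) :=
    ContMDiffOn.smul_section_of_tsupport (f.contMDiff.contMDiffOn) hu hf (hsw.mono hus)
  have h2 := (hcov.contMDiff.contMDiff (σ := ((f : M → ℝ) • FiberBundle.extend E w))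
    (by simpa using h1.contMDiffOn))
  have h3 := (h2.contMDiffAt (by simp)).mdifferentiableAt (x := x) (by simp)
  refine h3.congr_of_eventuallyEq ?_
  have hev : ∀ᶠ y in 𝓝 x, ∀ᶠ z in 𝓝 y, f z = 1 := f.eventuallyEq_one.eventually_nhds
  filter_upwards [hev, hu.mem_nhds hxu] with y hy hyu
  congr 1
  refine cov.isCovariantDerivativeOnUniv.congr_of_eventuallyEq
    ((hsw.mono hus).contMDiffAt (hu.mem_nhds hyu) |>.mdifferentiableAt (by simp))
    (h1.contMDiffAt.mdifferentiableAt (by simp)) Filter.univ_mem ?_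
  filter_upwards [hy] with z hz
  simp [hz]

/-- For a smooth connection, `X ↦ R(X, v) w` is tensorial. -/
theorem tensorialAt_curvatureField [T2Space M] (cov : AffineConnection I M)
    [CovariantDerivative.ContMDiffCovariantDerivative cov ∞] (x : M) (v w : TangentSpace I x) :
    TensorialAt I E (fun X : Π x : M, TangentSpace I x ↦
      curvatureField cov X (FiberBundle.extend E v) (FiberBundle.extend E w) x) x where
  smul {f X} hf hX := by
    have hZ := (mdifferentiableAt_cov_extend cov w).clm_bundle_apply
      (E₁ := fun y : M ↦ TangentSpace I y) (E₂ := fun y : M ↦ TangentSpace I y) hX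
    have h := cov.isCovariantDerivativeOnUniv.leibniz hZ hf
    have e : (fun y ↦ cov (FiberBundle.extend E w) y ((f • X) y)) =
        f • fun y ↦ cov (FiberBundle.extend E w) y (X y) := by
      ext y; simp
    simp only [curvatureField, e]
    rw [h, VectorField.mlieBracket_smul_left hf hX]
    simp
    module
  add {X X'} hX hX' := by
    have hZ := (mdifferentiableAt_cov_extend cov w).clm_bundle_apply
      (E₁ := fun y : M ↦ TangentSpace I y) (E₂ := fun y : M ↦ TangentSpace I y) hX
    have hZ' := (mdifferentiableAt_cov_extend cov w).clm_bundle_apply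
      (E₁ := fun y : M ↦ TangentSpace I y) (E₂ := fun y : M ↦ TangentSpace I y) hX'
    have h := cov.isCovariantDerivativeOnUniv.add hZ hZ'
    have e : (fun y ↦ cov (FiberBundle.extend E w) y ((X + X') y)) =
        (fun y ↦ cov (FiberBundle.extend E w) y (X y)) +
          fun y ↦ cov (FiberBundle.extend E w) y (X' y) := by
      ext y; simp
    simp only [curvatureField, e]
    rw [h, VectorField.mlieBracket_add_left hX hX']
    simp
    abel

/-- The endomorphism `u ↦ R(u, v) w` of the tangent space at `x`. -/
def curvatureEnd [T2Space M] (cov : AffineConnection I M)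
    [CovariantDerivative.ContMDiffCovariantDerivative cov ∞] (x : M) (v w : TangentSpace I x) :
    TangentSpace I x →L[ℝ] TangentSpace I x :=
  TensorialAt.mkHom _ x (tensorialAt_curvatureField cov x v w)

theorem curvatureEnd_apply [T2Space M] (cov : AffineConnection I M)
    [CovariantDerivative.ContMDiffCovariantDerivative cov ∞] (x : M) (u v w : TangentSpace I x) :
    curvatureEnd cov x v w u = curvature cov x u v w := rfl

/-- The Ricci tensor `Ric(v, w) = tr (u ↦ R(u, v) w)`. -/
def ricci [T2Space M] (cov : AffineConnection I M)
    [CovariantDerivative.ContMDiffCovariantDerivative cov ∞] (x : M) (v w : TangentSpace I x) : ℝ :=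
  LinearMap.trace ℝ (TangentSpace I x) (curvatureEnd cov x v w).toLinearMap

/-- The Ricci tensor is symmetric. -/
def RicciSymmetric [T2Space M] (cov : AffineConnection I M)
    [CovariantDerivative.ContMDiffCovariantDerivative cov ∞] : Prop :=
  ∀ (x : M) (v w : TangentSpace I x), ricci cov x v w = ricci cov x w v

/-- The (symmetric) Ricci tensor is non-degenerate at every point. -/
def RicciNondegenerate [T2Space M] (cov : AffineConnection I M)
    [CovariantDerivative.ContMDiffCovariantDerivative cov ∞] : Prop :=
  ∀ (x : M) (v : TangentSpace I x), (∀ w : TangentSpace I x, ricci cov x v w = 0) → v = 0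

/-! ### Projective flatness -/

/-- The bilinear map `(w, v) ↦ φ(v) w + φ(w) v`. -/
def projectiveTerm {x : M} (φ : TangentSpace I x →L[ℝ] ℝ) :
    TangentSpace I x →L[ℝ] TangentSpace I x →L[ℝ] TangentSpace I x :=
  have : FiniteDimensional ℝ (TangentSpace I x) := inferInstanceAs (FiniteDimensional ℝ E)
  have : T2Space (TangentSpace I x) := inferInstanceAs (T2Space E)
  have h : IsBilinearMap ℝ (fun w v : TangentSpace I x ↦ φ v • w + φ w • v) :=
    { add_left := fun w w' v ↦ by simp only [map_add]; module
      smul_left := fun c w v ↦ by simp only [map_smul, smul_eq_mul]; module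
      add_right := fun w v v' ↦ by simp only [map_add]; module
      smul_right := fun c w v ↦ by simp only [map_smul, smul_eq_mul]; module }
  h.toContinuousBilinearMap

/-- The connection `∇'_X Y = ∇_X Y + φ(X) Y + φ(Y) X`, for a one-form `φ`. It has the same
torsion as `∇`. -/
def projectiveChange (cov : AffineConnection I M) (φ : Π x : M, TangentSpace I x →L[ℝ] ℝ) :
    AffineConnection I M :=
  cov.addOneForm fun x ↦ projectiveTerm (φ x)

theorem projectiveChange_apply (cov : AffineConnection I M)
    (φ : Π x : M, TangentSpace I x →L[ℝ] ℝ) (Y : Π x : M, TangentSpace I x) (x : M)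
    (v : TangentSpace I x) :
    projectiveChange cov φ Y x v = cov Y x v + (φ x v • Y x + φ x (Y x) • v) := rfl

/-- A (torsion-free) connection is projectively flat if around every point it is projectively
equivalent to a flat connection. -/
def ProjectivelyFlat (cov : AffineConnection I M) : Prop :=
  ∀ p : M, ∃ U : Set M, IsOpen U ∧ p ∈ U ∧ ∃ φ : Π x : M, TangentSpace I x →L[ℝ] ℝ,
    ContMDiffOn I (I.prod 𝓘(ℝ, E →L[ℝ] ℝ)) ∞
      (fun x ↦ Bundle.TotalSpace.mk' (E →L[ℝ] ℝ)
        (E := fun x : M ↦ TangentSpace I x →L[ℝ] Bundle.Trivial M ℝ x) x (φ x)) U ∧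
    ∀ x ∈ U, ∀ u v w : TangentSpace I x, curvature (projectiveChange cov φ) x u v w = 0

/-! ### Geodesics and completeness -/

/-- The velocity vector of a curve. -/
def velocity (I : ModelWithCorners ℝ E H) (γ : ℝ → M) (t : ℝ) : TangentSpace I (γ t) :=
  mfderiv 𝓘(ℝ, ℝ) I γ t (1 : ℝ)

/-- The covariant derivative at time `t` of a vector field `V = ∑ Vⁱ ∂ᵢ` along a curve `γ`, namely
`∑ (dVⁱ/dt) ∂ᵢ + ∑ Vⁱ ∇_{γ'} ∂ᵢ`, in the preferred chart around `γ t`. -/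
def covAlong (cov : AffineConnection I M) (γ : ℝ → M) (V : Π t : ℝ, TangentSpace I (γ t)) (t : ℝ) :
    TangentSpace I (γ t) :=
  (trivializationAt E (fun x : M ↦ TangentSpace I x) (γ t)).symm (γ t)
      (deriv (fun s ↦ (trivializationAt E (fun x : M ↦ TangentSpace I x) (γ t) ⟨γ s, V s⟩).2) t)
    + cov (FiberBundle.extend E (V t)) (γ t) (velocity I γ t)

/-- Geodesics, in their affine parameter, defined on the whole real line:
`∇_{γ'} γ' = 0`. -/
structure IsGeodesic (cov : AffineConnection I M) (γ : ℝ → M) : Prop where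
  contMDiff : ContMDiff 𝓘(ℝ, ℝ) I ∞ γ
  covAlong_velocity (t : ℝ) : covAlong cov γ (velocity I γ) t = 0

/-- A connection is complete if every initial velocity is that of a geodesic defined on the whole
real line. -/
def GeodesicallyComplete (cov : AffineConnection I M) : Prop :=
  ∀ v : TangentBundle I M, ∃ γ : ℝ → M, IsGeodesic cov γ ∧
    (⟨γ 0, velocity I γ 0⟩ : TangentBundle I M) = v

/-! ### Statistical structures -/

section Statistical

variable [Bundle.RiemannianBundle (fun x : M ↦ TangentSpace I x)]
  [IsContMDiffRiemannianBundle I ∞ E (fun x : M ↦ TangentSpace I x)]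

/-- The cubic form `(∇ g)(u, v, w) = (∇_u g)(v, w)` at `x`, `g` being the Riemannian metric. -/
def cubicForm (cov : AffineConnection I M) (x : M) (u v w : TangentSpace I x) : ℝ :=
  cov.derivMetricTensor x v w u

/-- `(g, ∇)` is a statistical structure, `g` being the Riemannian metric: `∇` is torsion-free and
`∇ g` is symmetric in all arguments. -/
structure IsStatistical (cov : AffineConnection I M) : Prop where
  torsion_eq_zero : cov.torsion = 0
  symm_left (x : M) (u v w : TangentSpace I x) : cubicForm cov x u v w = cubicForm cov x v u w
  symm_right (x : M) (u v w : TangentSpace I x) : cubicForm cov x u v w = cubicForm cov x u w v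

/-- The linear form `w ↦ (∇_v g)(z, w)`. -/
def nablaMetric (cov : AffineConnection I M) (x : M) (z v : TangentSpace I x) :
    TangentSpace I x →ₗ[ℝ] ℝ where
  toFun w := cov.derivMetricTensor x z w v
  map_add' w w' := by simp
  map_smul' c w := by simp

theorem nablaMetric_add_left (cov : AffineConnection I M) (x : M) (z z' v : TangentSpace I x) :
    nablaMetric cov x (z + z') v = nablaMetric cov x z v + nablaMetric cov x z' v := by
  ext w
  exact congrArg (fun T ↦ T w v) ((cov.derivMetricTensor x).map_add z z')

theorem nablaMetric_smul_left (cov : AffineConnection I M) (x : M) (c : ℝ)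
    (z v : TangentSpace I x) : nablaMetric cov x (c • z) v = c • nablaMetric cov x z v := by
  ext w
  exact congrArg (fun T ↦ T w v) ((cov.derivMetricTensor x).map_smul c z)

theorem nablaMetric_add_right (cov : AffineConnection I M) (x : M) (z v v' : TangentSpace I x) :
    nablaMetric cov x z (v + v') = nablaMetric cov x z v + nablaMetric cov x z v' := by
  ext w
  exact (cov.derivMetricTensor x z w).map_add v v'

theorem nablaMetric_smul_right (cov : AffineConnection I M) (x : M) (c : ℝ)
    (z v : TangentSpace I x) : nablaMetric cov x z (c • v) = c • nablaMetric cov x z v := by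
  ext w
  exact (cov.derivMetricTensor x z w).map_smul c v

/-- The bilinear map `(z, v) ↦ a`, where `a` is the vector with `g(w, a) = (∇_v g)(w, z)` for
all `w`. -/
def dualTerm (cov : AffineConnection I M) (x : M) :
    TangentSpace I x →L[ℝ] TangentSpace I x →L[ℝ] TangentSpace I x :=
  have : FiniteDimensional ℝ (TangentSpace I x) := inferInstanceAs (FiniteDimensional ℝ E)
  have : CompleteSpace (TangentSpace I x) := FiniteDimensional.complete ℝ _
  have h : IsBilinearMap ℝ (fun z v : TangentSpace I x ↦
      (InnerProductSpace.toDual ℝ (TangentSpace I x)).symm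
        (LinearMap.toContinuousLinearMap (nablaMetric cov x z v))) :=
    { add_left := fun z z' v ↦ by rw [nablaMetric_add_left, map_add, map_add]
      smul_left := fun c z v ↦ by
        rw [nablaMetric_smul_left, map_smul, LinearIsometryEquiv.map_smulₛₗ, conj_trivial]
      add_right := fun z v v' ↦ by rw [nablaMetric_add_right, map_add, map_add]
      smul_right := fun c z v ↦ by
        rw [nablaMetric_smul_right, map_smul, LinearIsometryEquiv.map_smulₛₗ, conj_trivial] }
  h.toContinuousBilinearMap

theorem inner_dualTerm (cov : AffineConnection I M) (x : M) (z v w : TangentSpace I x) :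
    inner ℝ (dualTerm cov x z v) w = cov.derivMetricTensor x z w v := by
  have : FiniteDimensional ℝ (TangentSpace I x) := inferInstanceAs (FiniteDimensional ℝ E)
  have : CompleteSpace (TangentSpace I x) := FiniteDimensional.complete ℝ _
  exact InnerProductSpace.toDual_symm_apply (𝕜 := ℝ) (E := TangentSpace I x) (x := w)
    (y := LinearMap.toContinuousLinearMap (nablaMetric cov x z v))

/-- The dual connection of `∇` relative to the metric `g`. See `dual_spec` for the formula that
characterizes it. -/
def dual (cov : AffineConnection I M) : AffineConnection I M :=
  cov.addOneForm (dualTerm cov)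

/-- `X g(Y, Z) = g(∇_X Y, Z) + g(Y, ∇̄_X Z)` for the dual connection `∇̄` of `∇`. -/
theorem dual_spec (cov : AffineConnection I M) {x : M} (v : TangentSpace I x)
    {Y Z : Π x : M, TangentSpace I x} (hY : MDiffAt (T% Y) x) (hZ : MDiffAt (T% Z) x) :
    mvfderiv I (fun y ↦ inner ℝ (Y y) (Z y)) x v =
      inner ℝ (cov Y x v) (Z x) + inner ℝ (Y x) (dual cov Z x v) := by
  have h1 := inner_dualTerm cov x (Z x) v (Y x)
  have h2 := CovariantDerivative.derivMetricTensor_apply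
    (V := fun x : M ↦ TangentSpace I x) cov x hZ hY (X := FiberBundle.extend E v)
  simp only [FiberBundle.extend_apply_self] at h2
  have h3 : dual cov Z x v = cov Z x v + dualTerm cov x (Z x) v := rfl
  rw [h3, inner_add_right, real_inner_comm (dualTerm cov x (Z x) v), h1, h2,
    real_inner_comm (cov Y x v), real_inner_comm (cov Z x v)]
  simp only [real_inner_comm]
  ring

/-- `(g, ∇)` is conjugate symmetric: `∇` and its dual connection have the same curvature tensor. -/
def ConjugateSymmetric (cov : AffineConnection I M) : Prop :=
  ∀ (x : M) (u v w : TangentSpace I x), curvature cov x u v w = curvature (dual cov) x u v w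

end Statistical

end StatGeom

end

/-! The argument is affine-geometric. A torsion-free connection that is projectively flat and has
symmetric Ricci tensor is, locally, the connection induced on a centroaffine hypersurface, that is,
on a hypersurface of a vector space whose transversal is its own position vector. With `h = Ric / (n
- 1)` it satisfies `R(a, b)c = h(b, c)a - h(a, c)b`, and `∇h` is totally symmetric
(`isCentroaffineAt_of_projective`). These two identities say exactly that a certain connection on
`TM ⊕ ℝ` is flat (`frameForm_flat`). A parallel frame yields a map `f` into a vector space of
dimension `n + 1` with `D_X(df Y) = df(∇_X Y) - h(X, Y) f`. On a sphere `f` exists globally: the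
linear system is solved on each of two stereographic charts, and since their overlap is connected
for `n ≥ 2`, one linear isomorphism matches the two solutions (`exists_isCentroaffineMapAt`).

By the Gauss formula, `γ` is a geodesic as soon as `(f ∘ γ)''` is proportional to `f ∘ γ`. This
holds when `c = f ∘ γ` stays in a plane through the origin with `det(c, c') = 1`: differentiating
gives `det(c, c'') = 0`. For initial data `(p, v)` with `v ≠ 0` take the plane spanned by `f(p)` and
`df(v)`, rotate it by a linear map `J`, and let `W` be the vector field on `M` that is the
tangential part of `J / N` along `f`, where `N` is a positive definite quadratic form. Adding a
multiple of the position vector does not change the determinant, so the integral curve of `W`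
through `p` is the geodesic sought. As `M` is compact, `W` is complete, and so is `∇`
(`geodesicallyComplete_of_isCentroaffineMapAt`).

In the conjugate symmetric case `R` is skew with respect to `g`. Then `R(b, c)` has trace zero, and
the Bianchi identity makes `Ric` symmetric, so the above applies to `∇`. Skewness together with the
form of `R` also forces `h` to be a pointwise multiple of `g`. Since `∇g` is totally symmetric, the
Codazzi equation for `h` passes from `∇` to its dual (`IsCentroaffineAt.dual`). The dual is
therefore centroaffine with the same `h`, hence complete. -/

noncomputable section

namespace StatGeom

/-! ### Total differential equations -/

section TotalDifferential

open Set Metric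

variable {A : Type*} [NormedRing A] [NormedAlgebra ℝ A]

/-- Existence of solutions of `y' = y b` on an interval that is short in terms of a bound of `b`. -/
theorem exists_hasDerivWithinAt_mul_of_short [CompleteSpace A] {b : ℝ → A} (hb : Continuous b) {s τ K : ℝ}
    (hτ : 0 ≤ τ) (hK : 0 ≤ K) (hKτ : K * τ ≤ 1 / 2) (hbK : ∀ t ∈ Icc s (s + τ), ‖b t‖ ≤ K)
    (y₀ : A) :
    ∃ y : ℝ → A, y s = y₀ ∧
      ∀ t ∈ Icc s (s + τ), HasDerivWithinAt y (y t * b t) (Icc s (s + τ)) t := by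
  have hs : s ∈ Icc s (s + τ) := ⟨le_rfl, by linarith⟩
  -- On the ball of radius `‖y₀‖ + 1` about `y₀` the field is bounded by `(2‖y₀‖ + 1) K`, and `K τ ≤
  -- 1/2` keeps a solution within distance `‖y₀‖ + 1/2`. The admissible `τ` does not depend on `y₀`,
  -- so steps of equal length can be chained.
  have key : IsPicardLindelof (fun t y ↦ y * b t) (⟨s, hs⟩ : Icc s (s + τ)) y₀
      (‖y₀‖₊ + 1) 0 ((2 * ‖y₀‖₊ + 1) * ⟨K, hK⟩) ⟨K, hK⟩ := by
    refine ⟨fun t ht ↦ ?_, fun x _ ↦ (continuous_const.mul hb).continuousOn, fun t ht x hx ↦ ?_, ?_⟩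
    · refine LipschitzOnWith.of_dist_le_mul fun x _ y _ ↦ ?_
      rw [dist_eq_norm, dist_eq_norm, ← sub_mul, mul_comm]
      exact (norm_mul_le _ _).trans (mul_le_mul_of_nonneg_left (hbK t ht) (norm_nonneg _))
    · have h1 : ‖x‖ ≤ 2 * ‖y₀‖ + 1 := by
        have h2 : ‖x - y₀‖ ≤ ‖y₀‖ + 1 := by simpa [dist_eq_norm] using hx
        have h3 := norm_add_le (x - y₀) y₀
        simp only [sub_add_cancel] at h3
        linarith
      refine (norm_mul_le _ _).trans ?_
      exact mul_le_mul h1 (hbK t ht) (norm_nonneg _) ((norm_nonneg x).trans h1)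
    · have h4 : max (s + τ - s) (s - s) = τ := by simp [hτ]
      simp only [h4]
      push_cast
      have h5 : (0 : ℝ) ≤ ‖y₀‖ := norm_nonneg _
      change (2 * ‖y₀‖ + 1) * K * τ ≤ ‖y₀‖ + 1 - 0
      nlinarith
  exact key.exists_eq_forall_mem_Icc_hasDerivWithinAt₀

/-- Global existence for the linear equation `y' = y b` on the unit interval. -/
theorem exists_hasDerivWithinAt_mul [CompleteSpace A] {b : ℝ → A} (hb : Continuous b) (y₀ : A) :
    ∃ y : ℝ → A, y 0 = y₀ ∧
      ∀ t ∈ Icc (0 : ℝ) 1, HasDerivWithinAt y (y t * b t) (Icc 0 1) t := by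
  obtain ⟨K, hK⟩ := (isCompact_Icc (a := (0 : ℝ)) (b := 1)).exists_bound_of_continuousOn
    hb.continuousOn
  have hK0 : 0 ≤ K := (norm_nonneg _).trans (hK 0 (by simp))
  -- Pieces of length `1 / N` satisfy `K / N ≤ 1/2`, as the short-time result requires.
  obtain ⟨N, hN⟩ := exists_nat_gt (2 * K)
  have hN0 : (0 : ℝ) < N := by linarith
  have step : ∀ k : ℕ, k ≤ N → ∃ y : ℝ → A, y 0 = y₀ ∧ ∀ t ∈ Icc (0 : ℝ) (k * (1 / N)),
      HasDerivWithinAt y (y t * b t) (Icc 0 (k * (1 / N))) t := by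
    intro k
    induction k with
    | zero =>
      intro _
      refine ⟨fun _ ↦ y₀, rfl, fun t ht ↦ ?_⟩
      simp only [Nat.cast_zero, zero_mul, Icc_self]
      exact hasDerivWithinAt_iff_hasFDerivWithinAt.2
        (HasFDerivWithinAt.of_subsingleton subsingleton_singleton)
    | succ k ih =>
      intro hk
      obtain ⟨y, hy0, hy⟩ := ih (by lia)
      have e : ((k + 1 : ℕ) : ℝ) * (1 / N) = k * (1 / N) + 1 / N := by push_cast; ring
      have hkN : (k : ℝ) * (1 / N) + 1 / N ≤ 1 := by
        rw [← e, mul_one_div, div_le_one hN0]; exact_mod_cast hk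
      have hk0 : (0 : ℝ) ≤ k * (1 / N) := by positivity
      obtain ⟨z, hz0, hz⟩ := exists_hasDerivWithinAt_mul_of_short (b := b) hb
        (s := k * (1 / N)) (τ := 1 / N) (K := K) (by positivity) hK0
        (by rw [mul_one_div, div_le_iff₀ hN0]; linarith)
        (fun t ht ↦ hK t ⟨hk0.trans ht.1, ht.2.trans hkN⟩) (y (k * (1 / N)))
      set c : ℝ := k * (1 / N)
      have hτ : (0 : ℝ) < 1 / N := by positivity
      rw [e]
      let w : ℝ → A := fun t ↦ if t ≤ c then y t else z t
      have wl : ∀ t ∈ Icc 0 c, w t = y t := fun t ht ↦ if_pos ht.2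
      have wr : ∀ t ∈ Icc c (c + 1 / N), w t = z t := by
        intro t ht
        rcases ht.1.eq_or_lt with h | h
        · subst h; simp [w, hz0]
        · exact if_neg (not_le.2 h)
      have hun : Icc 0 (c + 1 / N) = Icc 0 c ∪ Icc c (c + 1 / N) :=
        (Icc_union_Icc_eq_Icc hk0 (by linarith)).symm
      refine ⟨w, (wl 0 ⟨le_rfl, hk0⟩).trans hy0, fun t ht ↦ ?_⟩
      have L : t ∈ Icc 0 c → HasDerivWithinAt w (w t * b t) (Icc 0 c) t := fun h ↦ by
        rw [wl t h]; exact (hy t h).congr wl (wl t h)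
      have R : t ∈ Icc c (c + 1 / N) → HasDerivWithinAt w (w t * b t) (Icc c (c + 1 / N)) t :=
        fun h ↦ by rw [wr t h]; exact (hz t h).congr wr (wr t h)
      rw [hun]
      -- Away from `c` the point is outside the closure of one of the two intervals, where any
      -- derivative is admissible; at `c` both one-sided derivatives agree because `w` is continued
      -- from the same value.
      rcases lt_trichotomy t c with h | h | h
      · refine (L ⟨ht.1, h.le⟩).union ?_
        refine HasFDerivWithinAt.of_notMem_closure ?_
        rw [closure_Icc]; exact fun h' ↦ absurd h'.1 (not_le.2 h)
      · exact (L ⟨ht.1, h.le⟩).union (R ⟨h.ge, ht.2⟩)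
      · refine HasDerivWithinAt.union ?_ (R ⟨h.le, ht.2⟩)
        refine HasFDerivWithinAt.of_notMem_closure ?_
        rw [closure_Icc]; exact fun h' ↦ absurd h'.2 (not_le.2 h)
  have := step N le_rfl
  rwa [mul_one_div_cancel hN0.ne'] at this

variable {E : Type*} [NormedAddCommGroup E] [NormedSpace ℝ E]

theorem exists_norm_le_two_jet {G : Type*} [NormedAddCommGroup G] [NormedSpace ℝ G]
    [ProperSpace E] {B : E → G} (hB : ContDiff ℝ 2 B) (r : ℝ) :
    ∃ C : ℝ, 0 < C ∧ ∀ z ∈ closedBall (0 : E) r,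
      ‖B z‖ ≤ C ∧ ‖fderiv ℝ B z‖ ≤ C ∧ ‖fderiv ℝ (fderiv ℝ B) z‖ ≤ C := by
  have h1 : ContDiff ℝ 1 (fderiv ℝ B) := hB.fderiv_right (by norm_num)
  obtain ⟨C₀, h₀⟩ := (isCompact_closedBall (0 : E) r).exists_bound_of_continuousOn
    hB.continuous.continuousOn
  obtain ⟨C₁, h₁⟩ := (isCompact_closedBall (0 : E) r).exists_bound_of_continuousOn
    h1.continuous.continuousOn
  obtain ⟨C₂, h₂⟩ := (isCompact_closedBall (0 : E) r).exists_bound_of_continuousOn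
    (h1.continuous_fderiv (by norm_num)).continuousOn
  -- The `1` makes the constant positive, since Grönwall's bound is used later in its form for a
  -- nonzero Lipschitz constant.
  refine ⟨max 1 (max C₀ (max C₁ C₂)), by positivity, fun z hz ↦ ⟨?_, ?_, ?_⟩⟩
  · exact (h₀ z hz).trans (by simp)
  · exact (h₁ z hz).trans (by simp)
  · exact (h₂ z hz).trans (by simp)

/-- Taylor's formula of order one, with a bound of the second derivative on a ball. -/
theorem norm_sub_sub_fderiv_le {G : Type*} [NormedAddCommGroup G] [NormedSpace ℝ G]
    {B : E → G} (hB : ContDiff ℝ 2 B) {r C : ℝ}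
    (hC : ∀ z ∈ closedBall (0 : E) r, ‖fderiv ℝ (fderiv ℝ B) z‖ ≤ C) {z a : E}
    (hz : z ∈ closedBall (0 : E) r) (hza : z + a ∈ closedBall (0 : E) r) :
    ‖B (z + a) - B z - fderiv ℝ B z a‖ ≤ C * ‖a‖ * ‖a‖ := by
  have h1 : ContDiff ℝ 1 (fderiv ℝ B) := hB.fderiv_right (by norm_num)
  have hC0 : 0 ≤ C := (norm_nonneg (fderiv ℝ (fderiv ℝ B) z)).trans (hC z hz)
  -- On this convex set the derivative of `B` differs from its value at `z` by at most `C ‖a‖`; the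
  -- mean value inequality for `B` minus its linear part then gives the quadratic bound.
  have hconv : Convex ℝ (closedBall (0 : E) r ∩ closedBall z ‖a‖) :=
    (convex_closedBall _ _).inter (convex_closedBall _ _)
  have := hconv.norm_image_sub_le_of_norm_fderiv_le' (f := B) (φ := fderiv ℝ B z)
    (C := C * ‖a‖) (x := z) (y := z + a)
    (fun w _ ↦ (hB.differentiable (by norm_num)).differentiableAt) ?_
    ⟨hz, by simp⟩ ⟨hza, by simp⟩
  · simpa using this
  · intro w hw
    refine ((convex_closedBall (0 : E) r).norm_image_sub_le_of_norm_fderiv_le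
      (fun v _ ↦ (h1.differentiable (by norm_num)).differentiableAt) hC hz hw.1).trans ?_
    gcongr
    simpa [dist_eq_norm] using hw.2

/-- First-order dependence on `x` of the solutions of `Y' = Y B(tx)x`, if the total differential
equation `dL = L B` is integrable. -/
theorem exists_norm_sub_sub_mul_le [ProperSpace E] {B : E → E →L[ℝ] A} (hB : ContDiff ℝ 2 B)
    (flat : ∀ x a b, fderiv ℝ B x a b + B x a * B x b = fderiv ℝ B x b a + B x b * B x a)
    {y : E → ℝ → A} (hy0 : ∀ x, y x 0 = 1)
    (hy : ∀ x, ∀ t ∈ Icc (0 : ℝ) 1, HasDerivWithinAt (y x) (y x t * B (t • x) x) (Icc 0 1) t)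
    (x : E) : ∃ D : ℝ, ∀ a : E, ‖a‖ ≤ 1 →
      ‖y (x + a) 1 - y x 1 - y x 1 * B x a‖ ≤ D * ‖a‖ ^ 2 := by
  obtain ⟨C, hC0, hC⟩ := exists_norm_le_two_jet hB (‖x‖ + 1)
  have hycont : ∀ x, ContinuousOn (y x) (Icc 0 1) := fun x t ht ↦ (hy x t ht).continuousWithinAt
  obtain ⟨Cy, hCy⟩ := (isCompact_Icc (a := (0 : ℝ)) (b := 1)).exists_bound_of_continuousOn (hycont x)
  have hCy0 : 0 ≤ Cy := (norm_nonneg _).trans (hCy 0 (by simp))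
  set R : ℝ := ‖x‖ + 1 with hR
  have hR0 : 0 < R := by positivity
  -- The four summands bound the four quadratic terms of `e1`, in the same order.
  set D₀ : ℝ := Cy * (C + C * R + C * C + C * (C * R)) with hD₀
  have hK0 : 0 < C * R := by positivity
  refine ⟨D₀ / (C * R) * (Real.exp (C * R) - 1), fun a ha ↦ ?_⟩
  have hxa : ‖x + a‖ ≤ R := (norm_add_le _ _).trans (by linarith)
  have hmem : ∀ t ∈ Icc (0 : ℝ) 1, t • x ∈ closedBall (0 : E) R := fun t ht ↦ by
    rw [mem_closedBall_zero_iff, norm_smul, Real.norm_of_nonneg ht.1]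
    nlinarith [ht.2, norm_nonneg x]
  have hmem' : ∀ t ∈ Icc (0 : ℝ) 1, t • (x + a) ∈ closedBall (0 : E) R := fun t ht ↦ by
    rw [mem_closedBall_zero_iff, norm_smul, Real.norm_of_nonneg ht.1]
    nlinarith [ht.2, ht.1, norm_nonneg (x + a)]
  -- If `y x t = L(tx)` with `dL = L B`, then `L(t(x + a))` is `Z t` to first order in `a`. So `Z`
  -- is tested as an approximate solution of the equation along the ray through `x + a`.
  let Z : ℝ → A := fun t ↦ y x t + t • (y x t * B (t • x) a)
  let Z' : ℝ → A := fun t ↦ y x t * B (t • x) x + (t • (y x t * B (t • x) x * B (t • x) a +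
    y x t * fderiv ℝ B (t • x) x a) + (1 : ℝ) • (y x t * B (t • x) a))
  have hZ : ∀ t ∈ Icc (0 : ℝ) 1, HasDerivWithinAt Z (Z' t) (Icc 0 1) t := by
    intro t ht
    have h1 : HasDerivWithinAt (fun t : ℝ ↦ B (t • x) a) (fderiv ℝ B (t • x) x a) (Icc 0 1) t := by
      have h2 : HasDerivAt (fun t : ℝ ↦ t • x) x t := by
        simpa using (hasDerivAt_id t).smul_const x
      have h3 := ((hB.differentiable (by norm_num)).differentiableAt
        (x := t • x)).hasFDerivAt.comp_hasDerivAt t h2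
      have h4 := h3.clm_apply (hasDerivAt_const t a)
      simpa using h4.hasDerivWithinAt
    exact (hy x t ht).add ((hasDerivWithinAt_id t _).smul ((hy x t ht).mul h1))
  have herr : ∀ t ∈ Icc (0 : ℝ) 1,
      ‖Z' t - Z t * B (t • (x + a)) (x + a)‖ ≤ D₀ * ‖a‖ ^ 2 := by
    intro t ht
    have e1 : Z' t - Z t * B (t • (x + a)) (x + a) =
        y x t * (-(t • fderiv ℝ B (t • x) a a)
          - (B (t • (x + a)) - B (t • x) - fderiv ℝ B (t • x) (t • a)) (x + a)
          - t • (B (t • x) a * B (t • x) a)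
          - t • (B (t • x) a * (B (t • (x + a)) - B (t • x)) (x + a))) := by
      -- This is the only use of integrability: it trades the derivative of `B` along `x` for the
      -- one along `a`, after which all terms of first order in `a` cancel.
      have f1 : fderiv ℝ B (t • x) x a = fderiv ℝ B (t • x) a x + B (t • x) a * B (t • x) x
          - B (t • x) x * B (t • x) a := by
        rw [← flat]; abel
      simp only [Z, Z', f1, sub_apply, map_add, map_smul,
        smul_apply, mul_add, mul_sub, add_mul,
        smul_add, smul_sub, mul_smul_comm, smul_mul_assoc, mul_assoc, mul_neg, one_smul]
      abel
    have tle : |t| ≤ 1 := by rw [abs_of_nonneg ht.1]; exact ht.2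
    have b1 : ‖B (t • x) a‖ ≤ C * ‖a‖ :=
      (ContinuousLinearMap.le_opNorm _ _).trans
        (mul_le_mul_of_nonneg_right (hC _ (hmem t ht)).1 (norm_nonneg _))
    have b2 : ‖fderiv ℝ B (t • x) a a‖ ≤ C * ‖a‖ * ‖a‖ :=
      (ContinuousLinearMap.le_opNorm₂ _ _ _).trans (by
        gcongr; exact (hC _ (hmem t ht)).2.1)
    have hta : ‖t • a‖ ≤ ‖a‖ := by
      rw [norm_smul, Real.norm_eq_abs]; nlinarith [norm_nonneg a]
    have b3 : ‖B (t • (x + a)) - B (t • x)‖ ≤ C * ‖a‖ := by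
      refine ((convex_closedBall (0 : E) R).norm_image_sub_le_of_norm_fderiv_le
        (fun v _ ↦ (hB.differentiable (by norm_num)).differentiableAt) (fun z hz ↦ (hC z hz).2.1)
        (hmem t ht) (hmem' t ht)).trans ?_
      rw [← smul_sub, add_sub_cancel_left]
      gcongr
    have b4 : ‖B (t • (x + a)) - B (t • x) - fderiv ℝ B (t • x) (t • a)‖ ≤ C * ‖a‖ * ‖a‖ := by
      have := norm_sub_sub_fderiv_le hB (fun z hz ↦ (hC z hz).2.2) (hmem t ht) (a := t • a)
        (by rw [← smul_add]; exact hmem' t ht)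
      rw [← smul_add] at this
      refine this.trans ?_
      gcongr
    have c1 : ‖t • fderiv ℝ B (t • x) a a‖ ≤ C * ‖a‖ * ‖a‖ := by
      rw [norm_smul, Real.norm_eq_abs]
      nlinarith [norm_nonneg (fderiv ℝ B (t • x) a a)]
    have c2 : ‖(B (t • (x + a)) - B (t • x) - fderiv ℝ B (t • x) (t • a)) (x + a)‖
        ≤ C * ‖a‖ * ‖a‖ * R :=
      (ContinuousLinearMap.le_opNorm _ _).trans
        (mul_le_mul b4 hxa (norm_nonneg _) (by positivity))
    have c3 : ‖t • (B (t • x) a * B (t • x) a)‖ ≤ (C * ‖a‖) * (C * ‖a‖) := by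
      rw [norm_smul, Real.norm_eq_abs]
      refine (mul_le_of_le_one_left (norm_nonneg _) tle).trans ((norm_mul_le _ _).trans ?_)
      gcongr
    have c4 : ‖t • (B (t • x) a * (B (t • (x + a)) - B (t • x)) (x + a))‖
        ≤ (C * ‖a‖) * (C * ‖a‖ * R) := by
      rw [norm_smul, Real.norm_eq_abs]
      refine (mul_le_of_le_one_left (norm_nonneg _) tle).trans ((norm_mul_le _ _).trans ?_)
      refine mul_le_mul b1 ?_ (norm_nonneg _) (by positivity)
      exact (ContinuousLinearMap.le_opNorm _ _).trans
        (mul_le_mul b3 hxa (norm_nonneg _) (by positivity))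
    rw [e1]
    refine (norm_mul_le _ _).trans ?_
    have h5 : D₀ * ‖a‖ ^ 2 = Cy * (C * ‖a‖ * ‖a‖ + C * ‖a‖ * ‖a‖ * R + (C * ‖a‖) * (C * ‖a‖)
        + (C * ‖a‖) * (C * ‖a‖ * R)) := by rw [hD₀]; ring
    rw [h5]
    refine mul_le_mul (hCy t ht) ?_ (norm_nonneg _) hCy0
    refine (norm_sub_le _ _).trans (add_le_add ((norm_sub_le _ _).trans (add_le_add
      ((norm_sub_le _ _).trans (add_le_add ?_ c2)) c3)) c4)
    rwa [norm_neg]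
  have ici : ∀ {f : ℝ → A} {f' : A} {t : ℝ}, t ∈ Ico (0 : ℝ) 1 →
      HasDerivWithinAt f f' (Icc 0 1) t → HasDerivWithinAt f f' (Ici t) t := fun ht h ↦
    h.mono_of_mem_nhdsWithin (Icc_mem_nhdsGE_of_mem ht)
  -- Both curves start at `1`, the first is an exact solution, and the second has error `D₀ ‖a‖²`;
  -- Grönwall's inequality carries the quadratic error to time `1`.
  have gron := dist_le_of_approx_trajectories_ODE_of_mem (a := (0 : ℝ)) (b := 1)
    (v := fun t w ↦ w * B (t • (x + a)) (x + a)) (K := ⟨C * R, hK0.le⟩) (s := fun _ ↦ univ)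
    (f := y (x + a)) (f' := fun t ↦ y (x + a) t * B (t • (x + a)) (x + a)) (g := Z) (g' := Z')
    (εf := 0) (εg := D₀ * ‖a‖ ^ 2) (δ := 0)
    (fun t ht ↦ LipschitzOnWith.of_dist_le_mul fun u _ w _ ↦ by
      rw [dist_eq_norm, dist_eq_norm, ← sub_mul, mul_comm]
      refine (norm_mul_le _ _).trans (mul_le_mul_of_nonneg_left ?_ (norm_nonneg _))
      refine (ContinuousLinearMap.le_opNorm _ _).trans ?_
      exact mul_le_mul (hC _ (hmem' t (Ico_subset_Icc_self ht))).1 hxa (norm_nonneg _) hC0.le)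
    (hycont _) (fun t ht ↦ ici ht (hy _ t (Ico_subset_Icc_self ht))) (fun t _ ↦ by simp)
    (fun _ _ ↦ mem_univ _) (fun t ht ↦ (hZ t ht).continuousWithinAt)
    (fun t ht ↦ ici ht (hZ t (Ico_subset_Icc_self ht)))
    (fun t ht ↦ by rw [dist_eq_norm]; exact herr t (Ico_subset_Icc_self ht))
    (fun _ _ ↦ mem_univ _) (by simp [Z, hy0]) 1 (by simp)
  rw [gronwallBound_of_K_ne_0 (by exact hK0.ne'), dist_eq_norm] at gron
  have e2 : y (x + a) 1 - y x 1 - y x 1 * B x a = y (x + a) 1 - Z 1 := by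
    simp only [Z, one_smul]; abel
  rw [e2]
  refine gron.trans (le_of_eq ?_)
  change 0 * Real.exp (C * R * (1 - 0)) +
    (0 + D₀ * ‖a‖ ^ 2) / (C * R) * (Real.exp (C * R * (1 - 0)) - 1) = _
  rw [sub_zero, mul_one]
  ring

/-- An integrable linear total differential equation `dL = L B` has a global solution. -/
theorem exists_hasFDerivAt_mul [CompleteSpace A] [ProperSpace E] {B : E → E →L[ℝ] A} (hB : ContDiff ℝ 2 B)
    (flat : ∀ x a b, fderiv ℝ B x a b + B x a * B x b = fderiv ℝ B x b a + B x b * B x a)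
    (x₀ : E) : ∃ L : E → A, L x₀ = 1 ∧
      ∀ x, HasFDerivAt L ((ContinuousLinearMap.mul ℝ A (L x)).comp (B x)) x := by
  wlog hx₀ : x₀ = 0 generalizing B x₀
  · have hB' : ContDiff ℝ 2 fun z ↦ B (x₀ + z) := hB.comp (contDiff_const.add contDiff_id)
    obtain ⟨L, hL0, hL⟩ := this hB' (fun x a b ↦ by
      simpa only [fderiv_comp_add_left] using flat (x₀ + x) a b) 0 rfl
    refine ⟨fun x ↦ L (x - x₀), by simpa using hL0, fun x ↦ ?_⟩
    have := (hL (x - x₀)).comp x ((hasFDerivAt_id x).sub_const x₀)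
    simp only [add_sub_cancel] at this
    exact this
  subst hx₀
  have hc : ∀ x : E, Continuous fun t : ℝ ↦ B (t • x) x := fun x ↦
    (hB.continuous.comp (continuous_id.smul continuous_const)).clm_apply continuous_const
  -- The solution is built by integrating along rays from the base point: `L x` is the value at time
  -- `1` of the solution along `t ↦ tx`.
  choose y hy0 hy using fun x ↦ exists_hasDerivWithinAt_mul (hc x) 1
  refine ⟨fun x ↦ y x 1, ?_, fun x ↦ ?_⟩
  · have := constant_of_has_deriv_right_zero (f := y 0) (a := 0) (b := 1)
      (fun t ht ↦ (hy 0 t ht).continuousWithinAt) (fun t ht ↦ by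
        have := (hy 0 t (Ico_subset_Icc_self ht)).mono_of_mem_nhdsWithin (Icc_mem_nhdsGE_of_mem ht)
        simpa using this) 1 (by simp)
    simpa [hy0] using this
  · obtain ⟨D, hD⟩ := exists_norm_sub_sub_mul_le hB flat hy0 hy x
    rw [hasFDerivAt_iff_isLittleO_nhds_zero]
    refine Asymptotics.IsBigO.trans_isLittleO (g := fun a : E ↦ ‖a‖ ^ 2) ?_
      (Asymptotics.isLittleO_norm_pow_id one_lt_two)
    refine Asymptotics.IsBigO.of_bound D ?_
    filter_upwards [closedBall_mem_nhds (0 : E) one_pos] with a ha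
    simpa using hD a (by simpa using ha)

/-- Uniqueness for linear total differential equations on connected open sets. -/
theorem eqOn_zero_of_norm_fderiv_le {G : Type*} [NormedAddCommGroup G] [NormedSpace ℝ G]
    {N : E → G} {N' : E → E →L[ℝ] G} {k : E → ℝ} {O : Set E} (hO : IsOpen O)
    (hO' : IsPreconnected O) (hN : ∀ x ∈ O, HasFDerivAt N (N' x) x) (hk : ContinuousOn k O)
    (hle : ∀ x ∈ O, ‖N' x‖ ≤ k x * ‖N x‖) {x₀ : E} (hx₀ : x₀ ∈ O) (h₀ : N x₀ = 0) :
    ∀ x ∈ O, N x = 0 := by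
  have hcont : ContinuousOn N O := fun x hx ↦ (hN x hx).continuousAt.continuousWithinAt
  -- The zero set is open: on a small ball `k` stays below `k x + 1`, and Grönwall's inequality
  -- applies along each segment from the centre.
  have hloc : ∀ x ∈ O, N x = 0 → ∀ᶠ z in 𝓝 x, N z = 0 := by
    intro x hx hx0
    have hkx : ∀ᶠ z in 𝓝 x, k z < k x + 1 ∧ z ∈ O :=
      ((hk.continuousAt (hO.mem_nhds hx)).eventually (gt_mem_nhds (by linarith))).and
        (hO.mem_nhds hx)
    obtain ⟨r, hr, hball⟩ := Metric.eventually_nhds_iff_ball.1 hkx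
    filter_upwards [ball_mem_nhds x hr] with z hz
    have hseg : ∀ t ∈ Icc (0 : ℝ) 1, x + t • (z - x) ∈ ball x r := by
      intro t ht
      have : ‖z - x‖ < r := by simpa [dist_eq_norm] using hz
      rw [mem_ball, dist_eq_norm, add_sub_cancel_left, norm_smul, Real.norm_of_nonneg ht.1]
      nlinarith [ht.2, norm_nonneg (z - x)]
    have hd : ∀ t ∈ Icc (0 : ℝ) 1, HasDerivAt (fun t : ℝ ↦ N (x + t • (z - x)))
        (N' (x + t • (z - x)) (z - x)) t := by
      intro t ht
      have h2 : HasDerivAt (fun t : ℝ ↦ x + t • (z - x)) (z - x) t := by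
        simpa using ((hasDerivAt_id t).smul_const (z - x)).const_add x
      exact (hN _ (hball _ (hseg t ht)).2).comp_hasDerivAt t h2
    have := eq_zero_of_abs_deriv_le_mul_abs_self_of_eq_zero_right
      (f := fun t : ℝ ↦ N (x + t • (z - x))) (K := (k x + 1) * ‖z - x‖) (a := 0) (b := 1)
      (fun t ht ↦ (hd t ht).continuousAt.continuousWithinAt)
      (fun t ht ↦ (hd t (Ico_subset_Icc_self ht)).hasDerivWithinAt) (by simpa using hx0)
      (fun t ht ↦ by
        have hm := hball _ (hseg t (Ico_subset_Icc_self ht))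
        refine (ContinuousLinearMap.le_opNorm _ _).trans ?_
        rw [mul_right_comm]
        refine mul_le_mul_of_nonneg_right ((hle _ hm.2).trans ?_) (norm_nonneg _)
        exact mul_le_mul_of_nonneg_right hm.1.le (norm_nonneg _)) 1 (by simp)
    simpa using this
  -- The interior of the zero set is nonempty, open and, by continuity of `N`, relatively closed in
  -- the connected set `O`.
  have hsub : O ⊆ {x | ∀ᶠ z in 𝓝 x, N z = 0} := by
    refine hO'.subset_of_closure_inter_subset isOpen_setOfPred_eventually_nhds
      ⟨x₀, hx₀, hloc x₀ hx₀ h₀⟩ ?_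
    rintro x ⟨hx, hxO⟩
    refine hloc x hxO ?_
    by_contra hne
    have : ∀ᶠ z in 𝓝 x, N z ≠ 0 :=
      (hcont.continuousAt (hO.mem_nhds hxO)).eventually_ne hne
    obtain ⟨z, hz, hz'⟩ := mem_closure_iff_nhds.1 hx _ this
    exact hz hz'.self_of_nhds
  exact fun x hx ↦ (hsub hx).self_of_nhds

/-- Two solutions of `dL = L B` on a connected open set which agree at a point are equal. -/
theorem eqOn_of_hasFDerivAt_mul {B : E → E →L[ℝ] A} {O : Set E} (hO : IsOpen O)
    (hO' : IsPreconnected O) (hB : ContinuousOn B O) {L₁ L₂ : E → A}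
    (h₁ : ∀ x ∈ O, HasFDerivAt L₁ ((ContinuousLinearMap.mul ℝ A (L₁ x)).comp (B x)) x)
    (h₂ : ∀ x ∈ O, HasFDerivAt L₂ ((ContinuousLinearMap.mul ℝ A (L₂ x)).comp (B x)) x)
    {x₀ : E} (hx₀ : x₀ ∈ O) (h₀ : L₁ x₀ = L₂ x₀) : EqOn L₁ L₂ O := by
  intro x hx
  refine sub_eq_zero.1 (eqOn_zero_of_norm_fderiv_le (N := fun x ↦ L₁ x - L₂ x)
    (N' := fun x ↦ (ContinuousLinearMap.mul ℝ A (L₁ x - L₂ x)).comp (B x))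
    (k := fun x ↦ ‖B x‖) hO hO' (fun x hx ↦ ?_) hB.norm (fun x _ ↦ ?_) hx₀ (by simp [h₀]) x hx)
  · convert (h₁ x hx).fun_sub (h₂ x hx) using 1
    ext a; simp
  · refine (ContinuousLinearMap.opNorm_comp_le _ _).trans ?_
    rw [mul_comm]
    gcongr
    exact ContinuousLinearMap.opNorm_mul_apply_le ℝ A _

/-- Uniqueness gives the inverse. If `P` is the solution with `P x = 1`, then `L` and `L x * P` are
solutions that agree at `x`, so `L x * P x₀ = 1`. Exchanging the roles gives `P x₀ * L x = 1`. -/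
theorem isUnit_of_hasFDerivAt_mul [CompleteSpace A] [ProperSpace E] {B : E → E →L[ℝ] A} (hB : ContDiff ℝ 2 B)
    (flat : ∀ x a b, fderiv ℝ B x a b + B x a * B x b = fderiv ℝ B x b a + B x b * B x a)
    {L : E → A} {x₀ : E} (h₀ : L x₀ = 1)
    (hL : ∀ x, HasFDerivAt L ((ContinuousLinearMap.mul ℝ A (L x)).comp (B x)) x) (x : E) :
    IsUnit (L x) := by
  obtain ⟨P, hP0, hP⟩ := exists_hasFDerivAt_mul hB flat x
  have hmul : ∀ (c : A) {Q : E → A} (z : E),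
      HasFDerivAt Q ((ContinuousLinearMap.mul ℝ A (Q z)).comp (B z)) z →
      HasFDerivAt (fun z ↦ c * Q z) ((ContinuousLinearMap.mul ℝ A (c * Q z)).comp (B z)) z := by
    intro c Q z h
    have e : (ContinuousLinearMap.mul ℝ A (c * Q z)).comp (B z) =
        (ContinuousLinearMap.mul ℝ A c).comp ((ContinuousLinearMap.mul ℝ A (Q z)).comp (B z)) := by
      ext a; simp [mul_assoc]
    rw [e]
    exact (ContinuousLinearMap.mul ℝ A c).hasFDerivAt.comp z h
  have e1 := eqOn_of_hasFDerivAt_mul isOpen_univ isPreconnected_univ hB.continuous.continuousOn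
    (fun z _ ↦ hL z) (fun z _ ↦ hmul (L x) z (hP z)) (mem_univ x) (by simp [hP0]) (mem_univ x₀)
  have e2 := eqOn_of_hasFDerivAt_mul isOpen_univ isPreconnected_univ hB.continuous.continuousOn
    (fun z _ ↦ hP z) (fun z _ ↦ hmul (P x₀) z (hL z)) (mem_univ x₀) (by simp [h₀]) (mem_univ x)
  simp only [h₀, hP0] at e1 e2
  exact ⟨⟨L x, P x₀, e1.symm, e2.symm⟩, rfl⟩

/-- Bootstrapping: if `L` is `C^n`, then so is its derivative `L B`, hence `L` is `C^(n+1)`. -/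
theorem contDiff_of_hasFDerivAt_mul {B : E → E →L[ℝ] A} (hB : ContDiff ℝ ∞ B) {L : E → A}
    (hL : ∀ x, HasFDerivAt L ((ContinuousLinearMap.mul ℝ A (L x)).comp (B x)) x) :
    ContDiff ℝ ∞ L := by
  have hf : fderiv ℝ L = fun x ↦ (ContinuousLinearMap.mul ℝ A (L x)).comp (B x) :=
    funext fun x ↦ (hL x).fderiv
  refine contDiff_infty.2 fun n ↦ ?_
  induction n with
  | zero =>
    exact contDiff_zero.2 (continuous_iff_continuousAt.2 fun x ↦ (hL x).continuousAt)
  | succ n ih =>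
    rw [Nat.cast_add, Nat.cast_one, contDiff_succ_iff_fderiv]
    refine ⟨fun x ↦ (hL x).differentiableAt, by simp, ?_⟩
    rw [hf]
    exact ((ContinuousLinearMap.mul ℝ A).contDiff.comp ih).clm_comp
      (hB.of_le (by exact_mod_cast le_top))

end TotalDifferential

/-! ### Vector fields and connections in a chart -/

section Chart

set_option linter.unusedSectionVars false

open Set Filter VectorField

variable {E : Type*} [NormedAddCommGroup E] [NormedSpace ℝ E]
  {M : Type*} [TopologicalSpace M] [ChartedSpace E M]

/-- The derivative of a chart. -/
def chartDeriv (e : OpenPartialHomeomorph M E) (q : M) : TangentSpace 𝓘(ℝ, E) q →L[ℝ] E :=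
  mfderiv 𝓘(ℝ, E) 𝓘(ℝ, E) e q

/-- The inverse of the derivative of a chart. -/
def chartInv (e : OpenPartialHomeomorph M E) (q : M) : E →L[ℝ] TangentSpace 𝓘(ℝ, E) q :=
  (mfderiv 𝓘(ℝ, E) 𝓘(ℝ, E) e q).inverse

/-- The vector field with components `η` in the chart `e`. -/
def chartField (e : OpenPartialHomeomorph M E) (η : E → E) (q : M) : TangentSpace 𝓘(ℝ, E) q :=
  chartInv e q (η (e q))

/-- The components of a vector field in the chart `e`. -/
def chartRep (e : OpenPartialHomeomorph M E) (Y : Π q : M, TangentSpace 𝓘(ℝ, E) q) (x : E) : E :=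
  chartDeriv e (e.symm x) (Y (e.symm x))

theorem chartField_eq_mpullback (e : OpenPartialHomeomorph M E) (η : E → E) :
    chartField e η = mpullback 𝓘(ℝ, E) 𝓘(ℝ, E) e η := rfl

variable [FiniteDimensional ℝ E] [IsManifold 𝓘(ℝ, E) ∞ M] {e : OpenPartialHomeomorph M E}

theorem mdifferentiable_of_mem_maximalAtlas
    (he : e ∈ IsManifold.maximalAtlas 𝓘(ℝ, E) ∞ M) : e.MDifferentiable 𝓘(ℝ, E) 𝓘(ℝ, E) :=
  ⟨(contMDiffOn_of_mem_maximalAtlas he).mdifferentiableOn (by simp),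
    (contMDiffOn_symm_of_mem_maximalAtlas he).mdifferentiableOn (by simp)⟩

theorem isInvertible_mfderiv_of_mem_maximalAtlas
    (he : e ∈ IsManifold.maximalAtlas 𝓘(ℝ, E) ∞ M) {q : M} (hq : q ∈ e.source) :
    (mfderiv 𝓘(ℝ, E) 𝓘(ℝ, E) e q).IsInvertible :=
  ⟨(mdifferentiable_of_mem_maximalAtlas he).mfderiv hq, rfl⟩

theorem chartDeriv_chartInv
    (he : e ∈ IsManifold.maximalAtlas 𝓘(ℝ, E) ∞ M) {q : M} (hq : q ∈ e.source) (a : E) :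
    chartDeriv e q (chartInv e q a) = a :=
  (isInvertible_mfderiv_of_mem_maximalAtlas he hq).self_apply_inverse a

theorem chartInv_chartDeriv
    (he : e ∈ IsManifold.maximalAtlas 𝓘(ℝ, E) ∞ M) {q : M} (hq : q ∈ e.source) (v : TangentSpace 𝓘(ℝ, E) q) :
    chartInv e q (chartDeriv e q v) = v :=
  (isInvertible_mfderiv_of_mem_maximalAtlas he hq).inverse_apply_self v

theorem chartDeriv_injective
    (he : e ∈ IsManifold.maximalAtlas 𝓘(ℝ, E) ∞ M) {q : M} (hq : q ∈ e.source) :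
    Function.Injective (chartDeriv e q) :=
  Function.LeftInverse.injective (chartInv_chartDeriv he hq)

theorem chartDeriv_chartField
    (he : e ∈ IsManifold.maximalAtlas 𝓘(ℝ, E) ∞ M) {q : M} (hq : q ∈ e.source) (η : E → E) :
    chartDeriv e q (chartField e η q) = η (e q) :=
  chartDeriv_chartInv he hq _

theorem chartField_chartRep
    (he : e ∈ IsManifold.maximalAtlas 𝓘(ℝ, E) ∞ M) {q : M} (hq : q ∈ e.source) (Y : Π q : M, TangentSpace 𝓘(ℝ, E) q) :
    chartField e (chartRep e Y) q = Y q := by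
  -- The point `e.symm (e q)` is also the base point of the tangent vectors, so it is generalised to
  -- a variable before it is identified with `q`.
  have : ∀ q', q' = q → chartInv e q (chartDeriv e q' (Y q')) = Y q := by
    rintro _ rfl
    exact chartInv_chartDeriv he hq _
  exact this _ (e.left_inv hq)

theorem chartRep_apply {q : M} (hq : q ∈ e.source) (Y : Π q : M, TangentSpace 𝓘(ℝ, E) q) :
    chartRep e Y (e q) = chartDeriv e q (Y q) := by
  have : ∀ q', q' = q → chartDeriv e q' (Y q') = chartDeriv e q (Y q) := by
    rintro _ rfl
    rfl
  exact this _ (e.left_inv hq)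

theorem contMDiffAt_chartField
    (he : e ∈ IsManifold.maximalAtlas 𝓘(ℝ, E) ∞ M) {η : E → E} {q : M} (hq : q ∈ e.source)
    (hη : ContDiffAt ℝ ∞ η (e q)) :
    CMDiffAt ∞ (T% (chartField e η)) q := by
  rw [chartField_eq_mpullback]
  exact ContMDiffAt.mpullback_vectorField_preimage (n := ∞)
    (contMDiffAt_vectorSpace_iff_contDiffAt.2 hη) (contMDiffAt_of_mem_maximalAtlas he hq)
    (isInvertible_mfderiv_of_mem_maximalAtlas he hq) (by simp)

theorem two_le_infty : (2 : WithTop ℕ∞) ≤ ∞ :=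
  WithTop.coe_le_coe.2 (le_top : (2 : ℕ∞) ≤ ⊤)

theorem mdifferentiableAt_section_vectorSpace {η : Π x : E, TangentSpace 𝓘(ℝ, E) x} {x : E}
    (hη : DifferentiableAt ℝ (F := E) η x) : MDiffAt (T% η) x := by
  refine (mdifferentiableAt_section _ _).2 ?_
  have : (fun b ↦ (trivializationAt E (TangentSpace 𝓘(ℝ, E)) x (T% η b)).2) = η := by
    ext b
    exact congrArg Prod.snd (trivializationAt_model_space_apply (I := 𝓘(ℝ, E)) (T% η b) x)
  rw [this]
  exact hη.mdifferentiableAt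

theorem mdifferentiableAt_chartField
    (he : e ∈ IsManifold.maximalAtlas 𝓘(ℝ, E) ∞ M) {η : E → E} {q : M} (hq : q ∈ e.source)
    (hη : DifferentiableAt ℝ η (e q)) :
    MDiffAt (T% (chartField e η)) q := by
  rw [chartField_eq_mpullback]
  exact MDifferentiableAt.mpullback_vectorField (n := ∞)
    (mdifferentiableAt_section_vectorSpace hη) (contMDiffAt_of_mem_maximalAtlas he hq)
    (isInvertible_mfderiv_of_mem_maximalAtlas he hq) two_le_infty

/-- On the target, the components are the pullback of the field along `e.symm`, because the
derivative of `e` inverts that of `e.symm`; pullback preserves smoothness. -/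
theorem contDiffAt_chartRep
    (he : e ∈ IsManifold.maximalAtlas 𝓘(ℝ, E) ∞ M) {Y : Π q : M, TangentSpace 𝓘(ℝ, E) q} {q : M}
    (hq : q ∈ e.source) (hY : CMDiffAt ∞ (T% Y) q) : ContDiffAt ℝ ∞ (chartRep e Y) (e q) := by
  have hd := mdifferentiable_of_mem_maximalAtlas he
  have h1 : ContDiffAt ℝ ∞ (mpullback 𝓘(ℝ, E) 𝓘(ℝ, E) e.symm Y) (e q) := by
    refine contMDiffAt_vectorSpace_iff_contDiffAt.1
      (ContMDiffAt.mpullback_vectorField_preimage (n := ∞) ?_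
        (contMDiffAt_symm_of_mem_maximalAtlas he (e.map_source hq))
        ⟨hd.symm.mfderiv (e.map_source hq), rfl⟩ (by simp))
    rw [e.left_inv hq]
    exact hY
  refine h1.congr_of_eventuallyEq ?_
  filter_upwards [e.open_target.mem_nhds (e.map_source hq)] with x hx
  exact (congrArg (fun T ↦ T (Y (e.symm x)))
    (ContinuousLinearMap.inverse_equiv (hd.symm.mfderiv hx))).symm

/-- The Lie bracket is natural under pullback by the chart, and in a vector space it is the usual
commutator of derivatives. -/
theorem mlieBracket_chartField
    (he : e ∈ IsManifold.maximalAtlas 𝓘(ℝ, E) ∞ M) {ξ η : E → E} {q : M} (hq : q ∈ e.source)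
    (hξ : DifferentiableAt ℝ ξ (e q)) (hη : DifferentiableAt ℝ η (e q)) :
    chartDeriv e q (mlieBracket 𝓘(ℝ, E) (chartField e ξ) (chartField e η) q) =
      fderiv ℝ η (e q) (ξ (e q)) - fderiv ℝ ξ (e q) (η (e q)) := by
  have : IsManifold 𝓘(ℝ, E) (minSmoothness ℝ 2) M := by
    rw [minSmoothness_of_isRCLikeNormedField]
    exact IsManifold.of_le (n := ∞) two_le_infty
  have h := mpullback_mlieBracket (I := 𝓘(ℝ, E)) (I' := 𝓘(ℝ, E)) (f := e) (V := ξ) (W := η)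
    (x₀ := q) (n := ∞) (mdifferentiableAt_section_vectorSpace hξ)
    (mdifferentiableAt_section_vectorSpace hη)
    (contMDiffAt_of_mem_maximalAtlas he hq) (by simpa using two_le_infty)
  have h' : mlieBracket 𝓘(ℝ, E) (M := E) ξ η = lieBracket ℝ ξ η :=
    (mlieBracketWithin_univ (I := 𝓘(ℝ, E)) (M := E) (V := ξ) (W := η)).symm.trans
      (mlieBracketWithin_eq_lieBracketWithin.trans lieBracketWithin_univ)
  refine (congrArg (chartDeriv e q) h.symm).trans ((chartDeriv_chartInv he hq _).trans ?_)
  exact congrFun h' (e q)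

theorem mvfderiv_comp_chart
    (he : e ∈ IsManifold.maximalAtlas 𝓘(ℝ, E) ∞ M) {G : Type*} [NormedAddCommGroup G] [NormedSpace ℝ G] {F : E → G}
    {q : M} (hq : q ∈ e.source) (hF : DifferentiableAt ℝ F (e q)) (v : TangentSpace 𝓘(ℝ, E) q) :
    mvfderiv 𝓘(ℝ, E) (fun p ↦ F (e p)) q v = fderiv ℝ F (e q) (chartDeriv e q v) := by
  have h := mfderiv_comp q hF.mdifferentiableAt
    ((mdifferentiable_of_mem_maximalAtlas he).mdifferentiableAt hq)
  rw [mfderiv_eq_fderiv] at h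
  exact congrArg (fun T ↦ T v) h

end Chart

/-! ### Christoffel symbols and curvature in a chart -/

section ChartConnection

set_option linter.unusedSectionVars false

open Set Filter VectorField

variable {E : Type*} [NormedAddCommGroup E] [NormedSpace ℝ E] [FiniteDimensional ℝ E]
  {M : Type*} [TopologicalSpace M] [ChartedSpace E M] [IsManifold 𝓘(ℝ, E) ∞ M]
  {e : OpenPartialHomeomorph M E}

/-- The Christoffel symbols of a connection in the chart `e`: `christoffel cov e x c a` has the
components at `x` of the derivative in the direction `a` of the coordinate field `c`. -/
def christoffel (cov : AffineConnection 𝓘(ℝ, E) M) (e : OpenPartialHomeomorph M E) (x : E) :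
    E →L[ℝ] E →L[ℝ] E :=
  ∑ i, (LinearMap.toContinuousLinearMap ((Module.finBasis ℝ E).coord i)).smulRight
    ((chartDeriv e (e.symm x)).comp ((cov (chartField e fun _ ↦ Module.finBasis ℝ E i)
      (e.symm x)).comp (chartInv e (e.symm x))))

theorem christoffel_apply_chart (cov : AffineConnection 𝓘(ℝ, E) M) {q : M} (hq : q ∈ e.source)
    (c a : E) : christoffel cov e (e q) c a = ∑ i, (Module.finBasis ℝ E).coord i c •
      chartDeriv e q (cov (chartField e fun _ ↦ Module.finBasis ℝ E i) q (chartInv e q a)) := by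
  have : ∀ q', q' = q → ∑ i, (Module.finBasis ℝ E).coord i c • chartDeriv e q'
      (cov (chartField e fun _ ↦ Module.finBasis ℝ E i) q' (chartInv e q' a)) =
      ∑ i, (Module.finBasis ℝ E).coord i c • chartDeriv e q
      (cov (chartField e fun _ ↦ Module.finBasis ℝ E i) q (chartInv e q a)) := by
    rintro _ rfl; rfl
  rw [← this _ (e.left_inv hq), christoffel]
  simp only [sum_apply, ContinuousLinearMap.smulRight_apply, smul_apply]
  rfl

theorem cov_sum (cov : AffineConnection 𝓘(ℝ, E) M) {ι : Type*} (s : Finset ι)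
    {σ : ι → Π q : M, TangentSpace 𝓘(ℝ, E) q} {q : M} (hσ : ∀ i ∈ s, MDiffAt (T% (σ i)) q) :
    cov (fun p ↦ ∑ i ∈ s, σ i p) q = ∑ i ∈ s, cov (σ i) q := by
  classical
  induction s using Finset.induction_on with
  | empty =>
    exact cov.isCovariantDerivativeOnUniv.zero (x := q)
  | insert i s hi ih =>
    have h1 : (fun p ↦ ∑ j ∈ insert i s, σ j p) = σ i + fun p ↦ ∑ j ∈ s, σ j p := by
      ext p; simp [Finset.sum_insert hi]
    have h2 : MDiffAt (T% (fun p ↦ ∑ j ∈ s, σ j p)) q :=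
      MDifferentiableAt.sum_section fun j hj ↦ hσ j (Finset.mem_insert_of_mem hj)
    rw [h1, cov.isCovariantDerivativeOnUniv.add (hσ i (Finset.mem_insert_self i s)) h2,
      ih fun j hj ↦ hσ j (Finset.mem_insert_of_mem hj), Finset.sum_insert hi]

/-- Expand `η` in the fixed basis used to define the Christoffel symbols. By additivity and the
Leibniz rule, the derivatives of the coefficients assemble to the derivative of `η`, and the
derivatives of the basis fields to the Christoffel term. -/
theorem chartDeriv_cov_chartField (he : e ∈ IsManifold.maximalAtlas 𝓘(ℝ, E) ∞ M)
    (cov : AffineConnection 𝓘(ℝ, E) M) {q : M} (hq : q ∈ e.source) {η : E → E}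
    (hη : DifferentiableAt ℝ η (e q)) (v : TangentSpace 𝓘(ℝ, E) q) :
    chartDeriv e q (cov (chartField e η) q v) = fderiv ℝ η (e q) (chartDeriv e q v) +
      christoffel cov e (e q) (η (e q)) (chartDeriv e q v) := by
  set b := Module.finBasis ℝ E with hb
  let c : Fin (Module.finrank ℝ E) → E →L[ℝ] ℝ := fun i ↦ LinearMap.toContinuousLinearMap (b.coord i)
  have hc : ∀ a : E, ∑ i, c i a • b i = a := fun a ↦ b.sum_repr a
  have h1 : chartField e η =
      fun p ↦ ∑ i, ((fun p ↦ c i (η (e p))) • chartField e fun _ ↦ b i) p := by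
    ext p
    calc chartField e η p = chartInv e p (∑ i, c i (η (e p)) • b i) := by rw [hc]; rfl
      _ = _ := by rw [map_sum]; simp only [map_smul]; rfl
  have hci : ∀ i, DifferentiableAt ℝ (fun x ↦ c i (η x)) (e q) := fun i ↦
    (c i).differentiableAt.comp _ hη
  have hed := (mdifferentiable_of_mem_maximalAtlas he).mdifferentiableAt hq
  have hm : ∀ i, MDiffAt (fun p ↦ c i (η (e p))) q := fun i ↦
    MDifferentiableAt.comp (g := fun x ↦ c i (η x)) q (hci i).mdifferentiableAt hed
  have hb' : ∀ i, MDiffAt (T% (chartField e fun _ ↦ b i)) q := fun i ↦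
    mdifferentiableAt_chartField he hq (differentiableAt_const _)
  rw [h1, cov_sum cov _ fun i _ ↦ (hm i).smul_section (hb' i)]
  simp only [fun i ↦ cov.isCovariantDerivativeOnUniv.leibniz (hb' i) (hm i)]
  simp only [sum_apply, map_sum, add_apply, smul_apply,
    ContinuousLinearMap.smulRight_apply, map_add, map_smul, Finset.sum_add_distrib]
  rw [add_comm]
  congr 1
  · conv_rhs => rw [← hc (fderiv ℝ η (e q) (chartDeriv e q v))]
    refine Finset.sum_congr rfl fun i _ ↦ ?_
    rw [chartDeriv_chartField he hq, mvfderiv_comp_chart he hq (hci i)]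
    congr 1
    have := ((c i).hasFDerivAt.comp (e q) hη.hasFDerivAt).fderiv
    exact congrArg (fun T ↦ T (chartDeriv e q v)) this
  · rw [christoffel_apply_chart cov hq]
    simp only [chartInv_chartDeriv he hq]
    rfl

/-- For differentiable vector fields, in components. -/
theorem chartDeriv_cov (he : e ∈ IsManifold.maximalAtlas 𝓘(ℝ, E) ∞ M)
    (cov : AffineConnection 𝓘(ℝ, E) M) {q : M} (hq : q ∈ e.source)
    {Y : Π q : M, TangentSpace 𝓘(ℝ, E) q} (hY : DifferentiableAt ℝ (chartRep e Y) (e q))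
    (v : TangentSpace 𝓘(ℝ, E) q) :
    chartDeriv e q (cov Y q v) = fderiv ℝ (chartRep e Y) (e q) (chartDeriv e q v) +
      christoffel cov e (e q) (chartDeriv e q (Y q)) (chartDeriv e q v) := by
  have hm := mdifferentiableAt_chartField he hq hY
  -- Covariant derivatives are local, so `Y` may be replaced by the field rebuilt from its
  -- components.
  have hev : ∀ᶠ p in 𝓝 q, Y p = chartField e (chartRep e Y) p := by
    filter_upwards [e.open_source.mem_nhds hq] with p hp
    exact (chartField_chartRep he hp Y).symm
  have hm' : MDiffAt (T% Y) q := hm.congr_of_eventuallyEq (hev.mono fun p hp ↦ by simp only [hp])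
  rw [cov.isCovariantDerivativeOnUniv.congr_of_eventuallyEq hm' hm univ_mem hev,
    chartDeriv_cov_chartField he cov hq hY, chartRep_apply hq]

/-- The curvature tensor in terms of Christoffel symbols. -/
def riem (Γ : E → E →L[ℝ] E →L[ℝ] E) (x a b c : E) : E :=
  fderiv ℝ Γ x a c b - fderiv ℝ Γ x b c a + Γ x (Γ x c b) a - Γ x (Γ x c a) b

/-- The classical computation: in `∇_X ∇_Y Z - ∇_Y ∇_X Z` the second derivatives of `Z` cancel by
symmetry, and the derivatives of `X` and `Y` cancel against the bracket term. Only the values of the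
three fields at the point remain. -/
theorem chartDeriv_curvatureField (he : e ∈ IsManifold.maximalAtlas 𝓘(ℝ, E) ∞ M)
    (cov : AffineConnection 𝓘(ℝ, E) M) {q : M} (hq : q ∈ e.source)
    (hΓ : DifferentiableAt ℝ (christoffel cov e) (e q))
    {X Y Z : Π q : M, TangentSpace 𝓘(ℝ, E) q} (hX : ContDiffAt ℝ 2 (chartRep e X) (e q))
    (hY : ContDiffAt ℝ 2 (chartRep e Y) (e q)) (hZ : ContDiffAt ℝ 2 (chartRep e Z) (e q)) :
    chartDeriv e q (curvatureField cov X Y Z q) =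
      riem (christoffel cov e) (e q) (chartDeriv e q (X q)) (chartDeriv e q (Y q))
        (chartDeriv e q (Z q)) := by
  set Γ := christoffel cov e
  have hd : ∀ {W : Π q : M, TangentSpace 𝓘(ℝ, E) q}, ContDiffAt ℝ 2 (chartRep e W) (e q) →
      DifferentiableAt ℝ (chartRep e W) (e q) := fun h ↦ h.differentiableAt (by simp)
  have hdZ : DifferentiableAt ℝ (fderiv ℝ (chartRep e Z)) (e q) :=
    (hZ.fderiv_right (m := 1) (by norm_num)).differentiableAt (by simp)
  have hZev : ∀ᶠ x in 𝓝 (e q), DifferentiableAt ℝ (chartRep e Z) x :=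
    (hZ.eventually (by simp)).mono fun x hx ↦ hx.differentiableAt (by simp)
  -- In components `∇_W Z` is `DZ(W) + Γ(Z, W)`; this is its derivative by the product rule, needed
  -- for `W = X` and `W = Y`.
  have key : ∀ {W : Π q : M, TangentSpace 𝓘(ℝ, E) q}, ContDiffAt ℝ 2 (chartRep e W) (e q) →
      HasFDerivAt (chartRep e fun p ↦ cov Z p (W p))
        (((fderiv ℝ (chartRep e Z) (e q)).comp (fderiv ℝ (chartRep e W) (e q)) +
          (fderiv ℝ (fderiv ℝ (chartRep e Z)) (e q)).flip (chartRep e W (e q))) +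
        (((Γ (e q)) (chartRep e Z (e q))).comp (fderiv ℝ (chartRep e W) (e q)) +
          ((Γ (e q)).comp (fderiv ℝ (chartRep e Z) (e q)) +
            (fderiv ℝ Γ (e q)).flip (chartRep e Z (e q))).flip (chartRep e W (e q)))) (e q) := by
    intro W hW
    have h1 : chartRep e (fun p ↦ cov Z p (W p)) =ᶠ[𝓝 (e q)] fun x ↦
        fderiv ℝ (chartRep e Z) x (chartRep e W x) + Γ x (chartRep e Z x) (chartRep e W x) := by
      filter_upwards [hZev, e.open_target.mem_nhds (e.map_source hq)] with x hx hxt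
      have := chartDeriv_cov he cov (e.map_target hxt) (Y := Z)
        (by rwa [e.right_inv hxt]) (W (e.symm x))
      rw [e.right_inv hxt] at this
      exact this
    refine HasFDerivAt.congr_of_eventuallyEq ?_ h1
    exact (hdZ.hasFDerivAt.clm_apply (hd hW).hasFDerivAt).add
      ((hΓ.hasFDerivAt.clm_apply (hd hZ).hasFDerivAt).clm_apply (hd hW).hasFDerivAt)
  have hcong : ∀ W : Π q : M, TangentSpace 𝓘(ℝ, E) q,
      W =ᶠ[𝓝 q] chartField e (chartRep e W) := fun W ↦ by
    filter_upwards [e.open_source.mem_nhds hq] with p hp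
    exact (chartField_chartRep he hp W).symm
  have hsymm : ∀ a b, fderiv ℝ (fderiv ℝ (chartRep e Z)) (e q) a b =
      fderiv ℝ (fderiv ℝ (chartRep e Z)) (e q) b a := by
    intro a b
    exact (hZ.isSymmSndFDerivAt (by simp)).eq a b
  rw [curvatureField, map_sub, map_sub,
    chartDeriv_cov he cov hq (Y := fun p ↦ cov Z p (Y p)) (key hY).differentiableAt,
    chartDeriv_cov he cov hq (Y := fun p ↦ cov Z p (X p)) (key hX).differentiableAt,
    chartDeriv_cov he cov hq (hd hZ) (mlieBracket _ X Y q), (key hY).fderiv, (key hX).fderiv,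
    chartDeriv_cov he cov hq (hd hZ) (Y q), chartDeriv_cov he cov hq (hd hZ) (X q),
    Filter.EventuallyEq.mlieBracket_vectorField_eq (hcong X) (hcong Y),
    mlieBracket_chartField he hq (hd hX) (hd hY)]
  simp only [chartRep_apply hq, riem, add_apply, ContinuousLinearMap.comp_apply,
    ContinuousLinearMap.flip_apply, map_add, map_sub]
  rw [hsymm (chartDeriv e q (Y q)) (chartDeriv e q (X q))]
  abel

theorem contMDiffAt_extend {q : M} (u : TangentSpace 𝓘(ℝ, E) q) :
    CMDiffAt ∞ (T% (FiberBundle.extend E u)) q := by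
  obtain ⟨s, hs, h⟩ := FiberBundle.exists_contMDiffOn_extend (k := ∞) 𝓘(ℝ, E) E u
  exact h.contMDiffAt hs

theorem chartDeriv_curvature (he : e ∈ IsManifold.maximalAtlas 𝓘(ℝ, E) ∞ M)
    (cov : AffineConnection 𝓘(ℝ, E) M) {q : M} (hq : q ∈ e.source)
    (hΓ : DifferentiableAt ℝ (christoffel cov e) (e q)) (u v w : TangentSpace 𝓘(ℝ, E) q) :
    chartDeriv e q (curvature cov q u v w) =
      riem (christoffel cov e) (e q) (chartDeriv e q u) (chartDeriv e q v) (chartDeriv e q w) := by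
  have h : ∀ u : TangentSpace 𝓘(ℝ, E) q,
      ContDiffAt ℝ 2 (chartRep e (FiberBundle.extend E u)) (e q) := fun u ↦
    (contDiffAt_chartRep he hq (contMDiffAt_extend u)).of_le two_le_infty
  rw [curvature, chartDeriv_curvatureField he cov hq hΓ (h u) (h v) (h w)]
  simp only [FiberBundle.extend_apply_self]

/-- `cov Z` is smooth where `Z` is. -/
theorem contMDiffAt_cov [T2Space M] (cov : AffineConnection 𝓘(ℝ, E) M)
    [hcov : CovariantDerivative.ContMDiffCovariantDerivative cov ∞]
    {Z : Π q : M, TangentSpace 𝓘(ℝ, E) q} {u : Set M} (hu : IsOpen u) {x : M} (hxu : x ∈ u)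
    (hZ : CMDiff[u] ∞ (T% Z)) :
    ContMDiffAt 𝓘(ℝ, E) (𝓘(ℝ, E).prod 𝓘(ℝ, E →L[ℝ] E)) ∞
      (fun y ↦ Bundle.TotalSpace.mk' (E →L[ℝ] E)
        (E := fun y : M ↦ TangentSpace 𝓘(ℝ, E) y →L[ℝ] TangentSpace 𝓘(ℝ, E) y) y (cov Z y)) x := by
  -- Smoothness of the connection is a statement about sections over all of `M`. Multiplying by a
  -- bump function makes `Z` such a section without changing it near `x`.
  obtain ⟨f, -, hf⟩ := (SmoothBumpFunction.nhds_basis_tsupport (I := 𝓘(ℝ, E)) x).mem_iff.1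
    (hu.mem_nhds hxu)
  have h1 : CMDiff ∞ (T% ((f : M → ℝ) • Z)) :=
    ContMDiffOn.smul_section_of_tsupport (f.contMDiff.contMDiffOn) hu hf hZ
  have h2 := (hcov.contMDiff.contMDiff (σ := ((f : M → ℝ) • Z)) (by simpa using h1.contMDiffOn))
  refine (h2.contMDiffAt (by simp)).congr_of_eventuallyEq ?_
  have hev : ∀ᶠ y in 𝓝 x, ∀ᶠ z in 𝓝 y, f z = 1 := f.eventuallyEq_one.eventually_nhds
  filter_upwards [hev, hu.mem_nhds hxu] with y hy hyu
  congr 1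
  refine cov.isCovariantDerivativeOnUniv.congr_of_eventuallyEq
    (hZ.contMDiffAt (hu.mem_nhds hyu) |>.mdifferentiableAt (by simp))
    (h1.contMDiffAt.mdifferentiableAt (by simp)) Filter.univ_mem ?_
  filter_upwards [hy] with z hz
  simp [hz]

/-- Fields with constant components have no derivative term, so on the target the Christoffel
symbols have this basis-free description; smoothness and symmetry are read off from it. -/
theorem christoffel_eq_chartRep (he : e ∈ IsManifold.maximalAtlas 𝓘(ℝ, E) ∞ M)
    (cov : AffineConnection 𝓘(ℝ, E) M) {x : E} (hx : x ∈ e.target) (c a : E) :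
    christoffel cov e x c a = chartRep e (fun q ↦ cov (chartField e fun _ ↦ c) q
      (chartField e (fun _ ↦ a) q)) x := by
  have := chartDeriv_cov_chartField he cov (e.map_target hx) (differentiableAt_const c)
    (chartField e (fun _ ↦ a) (e.symm x))
  rw [chartRep, this]
  simp [chartDeriv_chartField he (e.map_target hx), e.right_inv hx]

theorem contDiffOn_christoffel [T2Space M] (he : e ∈ IsManifold.maximalAtlas 𝓘(ℝ, E) ∞ M)
    (cov : AffineConnection 𝓘(ℝ, E) M)
    [hcov : CovariantDerivative.ContMDiffCovariantDerivative cov ∞] :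
    ContDiffOn ℝ ∞ (christoffel cov e) e.target := by
  refine contDiffOn_clm_apply.2 fun c ↦ contDiffOn_clm_apply.2 fun a ↦ ?_
  refine ContDiffOn.congr ?_ fun x hx ↦ christoffel_eq_chartRep he cov hx c a
  intro x hx
  have hxs := e.map_target hx
  have h := contDiffAt_chartRep he hxs (Y := fun q ↦ cov (chartField e fun _ ↦ c) q
      (chartField e (fun _ ↦ a) q)) ?_
  · rw [e.right_inv hx] at h
    exact h.contDiffWithinAt
  · have h1 := contMDiffAt_cov cov e.open_source hxs (Z := chartField e fun _ ↦ c)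
      fun q hq ↦ (contMDiffAt_chartField he hq contDiffAt_const).contMDiffWithinAt
    exact h1.clm_bundle_apply (E₁ := fun y : M ↦ TangentSpace 𝓘(ℝ, E) y)
      (E₂ := fun y : M ↦ TangentSpace 𝓘(ℝ, E) y) (contMDiffAt_chartField he hxs contDiffAt_const)

/-- Coordinate fields commute, so vanishing torsion equates the two covariant derivatives. -/
theorem christoffel_symm_of_torsion_eq_zero (he : e ∈ IsManifold.maximalAtlas 𝓘(ℝ, E) ∞ M)
    {cov : AffineConnection 𝓘(ℝ, E) M} (h : cov.torsion = 0) {x : E} (hx : x ∈ e.target) (a b : E) :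
    christoffel cov e x a b = christoffel cov e x b a := by
  have hxs := e.map_target hx
  have h1 := (CovariantDerivative.torsion_eq_zero_iff (cov := cov)).1 h
    (mdifferentiableAt_chartField he hxs (differentiableAt_const b))
    (mdifferentiableAt_chartField he hxs (differentiableAt_const a))
  have h2 := mlieBracket_chartField he hxs (differentiableAt_const b) (differentiableAt_const a)
  rw [← h1, map_sub] at h2
  simp only [fderiv_fun_const, Pi.zero_apply, zero_apply, sub_zero] at h2
  rw [christoffel_eq_chartRep he cov hx, christoffel_eq_chartRep he cov hx]
  exact sub_eq_zero.1 h2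

end ChartConnection

/-! ### Norms on spaces of continuous bilinear maps -/

section Shortcuts

variable {E F G : Type*} [NormedAddCommGroup E] [NormedSpace ℝ E] [NormedAddCommGroup F]
  [NormedSpace ℝ F] [NormedAddCommGroup G] [NormedSpace ℝ G]

scoped instance instNormedAddCommGroupBilin : NormedAddCommGroup (E →L[ℝ] F →L[ℝ] G) :=
  ContinuousLinearMap.toNormedAddCommGroup

scoped instance instNormedSpaceBilin : NormedSpace ℝ (E →L[ℝ] F →L[ℝ] G) :=
  ContinuousLinearMap.toNormedSpace

end Shortcuts

/-! ### Projective changes in coordinates -/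

section ProjectiveAlgebra

set_option linter.unusedSectionVars false

open Set Filter

variable {E : Type*} [NormedAddCommGroup E] [NormedSpace ℝ E] [FiniteDimensional ℝ E]

/-- The structure equations, at `x`, of a connection that is induced on a hypersurface transversal
to its position vector, with second fundamental form `h`. -/
structure IsCentroaffineAt (Γ : E → E →L[ℝ] E →L[ℝ] E) (h : E → E →L[ℝ] E →L[ℝ] ℝ) (x : E) :
    Prop where
  christoffel_symm (a b : E) : Γ x a b = Γ x b a
  symm (a b : E) : h x a b = h x b a
  riem_eq (a b c : E) : riem Γ x a b c = h x b c • a - h x a c • b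
  codazzi (a b c : E) :
    fderiv ℝ h x a b c - h x b (Γ x c a) = fderiv ℝ h x b a c - h x a (Γ x c b)

theorem riem_add_left (Γ : E → E →L[ℝ] E →L[ℝ] E) (x a a' b c : E) :
    riem Γ x (a + a') b c = riem Γ x a b c + riem Γ x a' b c := by
  simp only [riem, ContinuousLinearMap.map_add, add_apply]; abel

theorem riem_smul_left (Γ : E → E →L[ℝ] E →L[ℝ] E) (x : E) (t : ℝ) (a b c : E) :
    riem Γ x (t • a) b c = t • riem Γ x a b c := by
  simp only [riem, ContinuousLinearMap.map_smul, smul_apply]; module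

theorem riem_add_mid (Γ : E → E →L[ℝ] E →L[ℝ] E) (x a b b' c : E) :
    riem Γ x a (b + b') c = riem Γ x a b c + riem Γ x a b' c := by
  simp only [riem, ContinuousLinearMap.map_add, add_apply]; abel

theorem riem_smul_mid (Γ : E → E →L[ℝ] E →L[ℝ] E) (x : E) (t : ℝ) (a b c : E) :
    riem Γ x a (t • b) c = t • riem Γ x a b c := by
  simp only [riem, ContinuousLinearMap.map_smul, smul_apply]; module

theorem riem_add_right (Γ : E → E →L[ℝ] E →L[ℝ] E) (x a b c c' : E) :
    riem Γ x a b (c + c') = riem Γ x a b c + riem Γ x a b c' := by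
  simp only [riem, ContinuousLinearMap.map_add, add_apply]; abel

theorem riem_smul_right (Γ : E → E →L[ℝ] E →L[ℝ] E) (x : E) (t : ℝ) (a b c : E) :
    riem Γ x a b (t • c) = t • riem Γ x a b c := by
  simp only [riem, ContinuousLinearMap.map_smul, smul_apply]; module

/-- The endomorphism `a ↦ R(a, b) c`. -/
def riemEnd (Γ : E → E →L[ℝ] E →L[ℝ] E) (x b c : E) : E →ₗ[ℝ] E where
  toFun a := riem Γ x a b c
  map_add' a a' := riem_add_left Γ x a a' b c
  map_smul' t a := riem_smul_left Γ x t a b c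

/-- The Ricci tensor in terms of Christoffel symbols. -/
def ricciForm (Γ : E → E →L[ℝ] E →L[ℝ] E) (x : E) : E →L[ℝ] E →L[ℝ] ℝ :=
  IsBilinearMap.toContinuousBilinearMap (f := fun b c ↦ LinearMap.trace ℝ E (riemEnd Γ x b c))
    { add_left := fun b b' c ↦ by
        rw [← map_add]; congr 1; ext a; exact riem_add_mid Γ x a b b' c
      smul_left := fun t b c ↦ by
        rw [← map_smul]; congr 1; ext a; exact riem_smul_mid Γ x t a b c
      add_right := fun b c c' ↦ by
        rw [← map_add]; congr 1; ext a; exact riem_add_right Γ x a b c c'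
      smul_right := fun t b c ↦ by
        rw [← map_smul]; congr 1; ext a; exact riem_smul_right Γ x t a b c }

theorem ricciForm_apply (Γ : E → E →L[ℝ] E →L[ℝ] E) (x b c : E) :
    ricciForm Γ x b c = LinearMap.trace ℝ E (riemEnd Γ x b c) := rfl

theorem trace_eq_sum_coord {ι : Type*} [Fintype ι] (b : Module.Basis ι ℝ E) (T : E →ₗ[ℝ] E) :
    LinearMap.trace ℝ E T = ∑ i, b.coord i (T (b i)) := by
  classical
  rw [LinearMap.trace_eq_matrix_trace ℝ b, Matrix.trace]
  simp [LinearMap.toMatrix_apply]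

theorem hasFDerivAt_apply_const {G₁ G₂ : Type*} [NormedAddCommGroup G₁] [NormedSpace ℝ G₁]
    [NormedAddCommGroup G₂] [NormedSpace ℝ G₂] {T : E → G₁ →L[ℝ] G₂} {T' : E →L[ℝ] G₁ →L[ℝ] G₂}
    {x : E} (hT : HasFDerivAt T T' x) (b : G₁) : HasFDerivAt (fun y ↦ T y b) (T'.flip b) x := by
  simpa using hT.clm_apply (hasFDerivAt_const b x)

theorem fderiv_clm_apply_two {G₁ G₂ G₃ : Type*} [NormedAddCommGroup G₁] [NormedSpace ℝ G₁]
    [NormedAddCommGroup G₂] [NormedSpace ℝ G₂] [NormedAddCommGroup G₃] [NormedSpace ℝ G₃]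
    {T : E → G₁ →L[ℝ] G₂ →L[ℝ] G₃} {x : E} (hT : DifferentiableAt ℝ T x) (a : E) (b : G₁)
    (c : G₂) : fderiv ℝ T x a b c = fderiv ℝ (fun y ↦ T y b c) x a := by
  have h := (hT.hasFDerivAt.clm_apply (hasFDerivAt_const b x)).clm_apply (hasFDerivAt_const c x)
  rw [h.fderiv]
  simp

theorem contDiffOn_riem {Γ : E → E →L[ℝ] E →L[ℝ] E} {s : Set E} (hs : IsOpen s)
    (hΓ : ContDiffOn ℝ ∞ Γ s) (a b c : E) : ContDiffOn ℝ ∞ (fun x ↦ riem Γ x a b c) s := by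
  have h1 : ContDiffOn ℝ ∞ (fderiv ℝ Γ) s := hΓ.fderiv_of_isOpen hs (by simp)
  have h2 : ∀ a b c : E, ContDiffOn ℝ ∞ (fun x ↦ fderiv ℝ Γ x a b c) s := fun a b c ↦
    ((h1.clm_apply contDiffOn_const).clm_apply contDiffOn_const).clm_apply contDiffOn_const
  have h3 : ∀ {u v : E → E}, ContDiffOn ℝ ∞ u s → ContDiffOn ℝ ∞ v s →
      ContDiffOn ℝ ∞ (fun x ↦ Γ x (u x) (v x)) s := fun hu hv ↦
    (hΓ.clm_apply hu).clm_apply hv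
  exact (((h2 a c b).sub (h2 b c a)).add (h3 (h3 contDiffOn_const contDiffOn_const)
    contDiffOn_const)).sub (h3 (h3 contDiffOn_const contDiffOn_const) contDiffOn_const)

theorem contDiffOn_ricciForm {Γ : E → E →L[ℝ] E →L[ℝ] E} {s : Set E} (hs : IsOpen s)
    (hΓ : ContDiffOn ℝ ∞ Γ s) : ContDiffOn ℝ ∞ (ricciForm Γ) s := by
  refine contDiffOn_clm_apply.2 fun b ↦ contDiffOn_clm_apply.2 fun c ↦ ?_
  simp only [ricciForm_apply, trace_eq_sum_coord (Module.finBasis ℝ E)]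
  refine ContDiffOn.sum fun i _ ↦ ?_
  exact (LinearMap.toContinuousLinearMap ((Module.finBasis ℝ E).coord i)).contDiff.comp_contDiffOn
    (contDiffOn_riem hs hΓ _ b c)

/-- The tensor by which a projective change with the one-form `α` changes the curvature. -/
def projectiveSchouten (Γ : E → E →L[ℝ] E →L[ℝ] E) (α : E → E →L[ℝ] ℝ) (x b c : E) : ℝ :=
  fderiv ℝ α x b c - α x (Γ x c b) - α x b * α x c

/-- Weyl's formula. The derivatives of `α` and its products in the curvature of `Γ'` combine to `∇α
- α ⊗ α`, and the symmetry of `Γ` cancels the remaining mixed terms. -/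
theorem riem_projective {Γ Γ' : E → E →L[ℝ] E →L[ℝ] E} {α : E → E →L[ℝ] ℝ} {x : E}
    (hΓ : DifferentiableAt ℝ Γ x) (hα : DifferentiableAt ℝ α x)
    (hΓ' : ∀ᶠ y in 𝓝 x, ∀ c a, Γ' y c a = Γ y c a + (α y a • c + α y c • a))
    (hΓ'd : DifferentiableAt ℝ Γ' x)
    (hsymm : ∀ a b, Γ x a b = Γ x b a) (a b c : E) :
    riem Γ' x a b c = riem Γ x a b c
      + (projectiveSchouten Γ α x a b - projectiveSchouten Γ α x b a) • c
      + projectiveSchouten Γ α x a c • b - projectiveSchouten Γ α x b c • a := by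
  have hd : ∀ a b c, fderiv ℝ Γ' x a c b =
      fderiv ℝ Γ x a c b + (fderiv ℝ α x a b • c + fderiv ℝ α x a c • b) := by
    intro a b c
    have hα' : ∀ b : E, HasFDerivAt (fun y ↦ α y b) ((fderiv ℝ α x).flip b) x := fun b ↦
      hasFDerivAt_apply_const hα.hasFDerivAt b
    have hΓ1 : HasFDerivAt (fun y ↦ Γ y c b) (((fderiv ℝ Γ x).flip c).flip b) x :=
      hasFDerivAt_apply_const (hasFDerivAt_apply_const hΓ.hasFDerivAt c) b
    have h1 := hΓ1.add (((hα' b).smul_const c).add ((hα' c).smul_const b))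
    have h2 : (fun y ↦ Γ' y c b) =ᶠ[𝓝 x] _ := hΓ'.mono fun y hy ↦ hy c b
    rw [fderiv_clm_apply_two hΓ'd, h2.fderiv_eq]
    exact congrArg (fun T ↦ T a) h1.fderiv
  have h0 := hΓ'.self_of_nhds
  simp only [riem, hd, h0, projectiveSchouten, map_add, map_smul, add_apply, smul_apply,
    hsymm b a]
  module

/-- Trace over `a`: the identity term contributes `n P(b, c)`, and the three rank-one terms
contribute `-P(b, c)`, `-P(c, b)` and `P(b, c)`. -/
theorem ricciForm_of_riem_eq {Γ : E → E →L[ℝ] E →L[ℝ] E} {x : E} {P : E →L[ℝ] E →L[ℝ] ℝ}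
    (h : ∀ a b c, riem Γ x a b c = P b c • a - P a c • b - (P a b - P b a) • c) (b c : E) :
    ricciForm Γ x b c = Module.finrank ℝ E * P b c - P c b := by
  have h1 : riemEnd Γ x b c = P b c • LinearMap.id
      - (P.flip c : E →ₗ[ℝ] ℝ).smulRight b
      - ((P.flip b : E →ₗ[ℝ] ℝ).smulRight c - (P b : E →ₗ[ℝ] ℝ).smulRight c) := by
    ext a
    simp [riemEnd, h, sub_smul]
  rw [ricciForm_apply, h1]
  simp only [map_sub, map_smul, LinearMap.trace_smulRight, LinearMap.trace_id]
  simp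
  ring

/-- Flatness of `Γ'` expresses the curvature of `Γ` through `P = ∇α - α ⊗ α`. Symmetry of the Ricci
tensor makes `P` symmetric, so `P = Ric / (n - 1)` and the curvature has the centroaffine form. The
Codazzi equation follows by differentiating `P` and using the Ricci identity for `α`; this works in
dimension two as well, where the second Bianchi identity would not yield it. -/
theorem isCentroaffineAt_of_projective {Γ Γ' : E → E →L[ℝ] E →L[ℝ] E} {α : E → E →L[ℝ] ℝ} {x : E}
    (hn : 2 ≤ Module.finrank ℝ E)
    {s : Set E} (hs : IsOpen s) (hxs : x ∈ s) (hΓs : ContDiffOn ℝ ∞ Γ s)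
    (hα : ContDiffAt ℝ ∞ α x)
    (hΓ' : ∀ᶠ y in 𝓝 x, ∀ c a, Γ' y c a = Γ y c a + (α y a • c + α y c • a))
    (hsymm : ∀ᶠ y in 𝓝 x, ∀ a b, Γ y a b = Γ y b a)
    (hflat : ∀ᶠ y in 𝓝 x, DifferentiableAt ℝ Γ' y → ∀ a b c, riem Γ' y a b c = 0)
    (hric : ∀ᶠ y in 𝓝 x, ∀ b c, ricciForm Γ y b c = ricciForm Γ y c b) :
    IsCentroaffineAt Γ (fun y ↦ (Module.finrank ℝ E - 1 : ℝ)⁻¹ • ricciForm Γ y) x := by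
  obtain ⟨n, hn_def⟩ : ∃ n : ℝ, n = Module.finrank ℝ E := ⟨_, rfl⟩
  have hn' : (2 : ℝ) ≤ n := by rw [hn_def]; exact_mod_cast hn
  rw [← hn_def]
  have hΓ : ContDiffAt ℝ ∞ Γ x := hΓs.contDiffAt (hs.mem_nhds hxs)
  have hαd : ∀ᶠ y in 𝓝 x, ContDiffAt ℝ 2 α y :=
    (hα.of_le two_le_infty).eventually (by simp)
  have hΓd : ∀ᶠ y in 𝓝 x, ContDiffAt ℝ 2 Γ y :=
    (hΓ.of_le two_le_infty).eventually (by simp)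
  -- The changed connection is known only through its formula in terms of `Γ` and `α`, so its
  -- regularity is derived from theirs.
  have hΓ'd : ∀ᶠ y in 𝓝 x, DifferentiableAt ℝ Γ' y := by
    obtain ⟨u, hu, huo, hxu⟩ := mem_nhds_iff.1 (hαd.and (hΓd.and hΓ'))
    have h1 : ContDiffOn ℝ 2 α u := fun y hy ↦ (hu hy).1.contDiffWithinAt
    have h2 : ContDiffOn ℝ 2 Γ u := fun y hy ↦ (hu hy).2.1.contDiffWithinAt
    have h3 : ContDiffOn ℝ 2 Γ' u := by
      refine contDiffOn_clm_apply.2 fun c ↦ contDiffOn_clm_apply.2 fun a ↦ ?_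
      refine ContDiffOn.congr ?_ fun y hy ↦ (hu hy).2.2 c a
      exact ((h2.clm_apply contDiffOn_const).clm_apply contDiffOn_const).add
        (((h1.clm_apply contDiffOn_const).smul contDiffOn_const).add
          ((h1.clm_apply contDiffOn_const).smul contDiffOn_const))
    filter_upwards [huo.mem_nhds hxu] with y hy
    exact (h3.contDiffAt (huo.mem_nhds hy)).differentiableAt (by simp)
  have hP : ∀ᶠ y in 𝓝 x, ∀ a b c, riem Γ y a b c = projectiveSchouten Γ α y b c • a -
      projectiveSchouten Γ α y a c • b -
      (projectiveSchouten Γ α y a b - projectiveSchouten Γ α y b a) • c := by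
    filter_upwards [hαd, hΓd, hΓ'.eventually_nhds, hΓ'd, hsymm, hflat] with y h1 h2 h3 h4 h5 h6 a b c
    have := riem_projective (h2.differentiableAt (by simp)) (h1.differentiableAt (by simp)) h3 h4 h5
      a b c
    rw [h6 h4] at this
    rw [eq_comm, add_sub_assoc, add_assoc] at this
    rw [eq_neg_of_add_eq_zero_left this]
    module
  have hPbil : ∀ y, ∃ P : E →L[ℝ] E →L[ℝ] ℝ, ∀ b c, P b c = projectiveSchouten Γ α y b c := by
    intro y
    refine ⟨fderiv ℝ α y - ((ContinuousLinearMap.compL ℝ E E ℝ (α y)).comp (Γ y).flip)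
      - (α y).smulRight (α y), fun b c ↦ ?_⟩
    simp [projectiveSchouten]
  have hh : ∀ᶠ y in 𝓝 x, (∀ b c, projectiveSchouten Γ α y b c = projectiveSchouten Γ α y c b) ∧
      ∀ b c, ((n - 1)⁻¹ • ricciForm Γ y) b c = projectiveSchouten Γ α y b c := by
    filter_upwards [hP, hric] with y h1 h2
    obtain ⟨P, hPy⟩ := hPbil y
    simp only [← hPy] at h1 ⊢
    have h3 := ricciForm_of_riem_eq h1
    rw [← hn_def] at h3
    have h4 : ∀ b c, P b c = P c b := by
      intro b c
      have := h2 b c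
      rw [h3, h3] at this
      -- Symmetry of the Ricci tensor reads `n P(b, c) - P(c, b) = n P(c, b) - P(b, c)`.
      have h5 : (n + 1) * (P b c - P c b) = 0 := by linear_combination this
      rcases mul_eq_zero.1 h5 with h | h
      · linarith
      · linarith
    refine ⟨h4, fun b c ↦ ?_⟩
    simp only [smul_apply, smul_eq_mul, h3, h4 c b]
    have : n - 1 ≠ 0 := by linarith
    field_simp
  obtain ⟨hPs, hPh⟩ := hh.self_of_nhds
  have hPx := hP.self_of_nhds
  have hsx := hsymm.self_of_nhds
  refine ⟨hsx, fun a b ↦ by rw [hPh, hPh, hPs], fun a b c ↦ ?_, fun a b c ↦ ?_⟩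
  · rw [hPh, hPh, hPx, hPs a b]
    simp
  have hα2 := hαd.self_of_nhds
  have hα1 := hα2.differentiableAt (by simp)
  have hΓ1 := hΓd.self_of_nhds.differentiableAt (by simp)
  have hdα : DifferentiableAt ℝ (fderiv ℝ α) x :=
    (hα2.fderiv_right (m := 1) (by norm_num)).differentiableAt (by simp)
  have hdsymm : ∀ a b, fderiv ℝ (fderiv ℝ α) x a b = fderiv ℝ (fderiv ℝ α) x b a := fun a b ↦
    (hα2.isSymmSndFDerivAt (by simp)).eq a b
  have hricd : DifferentiableAt ℝ (fun y ↦ (n - 1)⁻¹ • ricciForm Γ y) x := by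
    exact (((contDiffOn_ricciForm hs hΓs).contDiffAt (hs.mem_nhds hxs)).differentiableAt
      (by simp)).fun_const_smul _
  have hd : ∀ a b c, fderiv ℝ (fun y ↦ (n - 1)⁻¹ • ricciForm Γ y) x a b c =
      fderiv ℝ (fderiv ℝ α) x a b c - (fderiv ℝ α x a (Γ x c b) + α x (fderiv ℝ Γ x a c b)) -
        (α x b * fderiv ℝ α x a c + fderiv ℝ α x a b * α x c) := by
    intro a b c
    have e1 : (fun y ↦ ((n - 1)⁻¹ • ricciForm Γ y) b c) =ᶠ[𝓝 x]
        fun y ↦ projectiveSchouten Γ α y b c := hh.mono fun y hy ↦ hy.2 b c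
    rw [fderiv_clm_apply_two hricd, e1.fderiv_eq]
    have hα' : ∀ b : E, HasFDerivAt (fun y ↦ α y b) ((fderiv ℝ α x).flip b) x := fun b ↦
      hasFDerivAt_apply_const hα1.hasFDerivAt b
    have hΓ1' : HasFDerivAt (fun y ↦ Γ y c b) (((fderiv ℝ Γ x).flip c).flip b) x :=
      hasFDerivAt_apply_const (hasFDerivAt_apply_const hΓ1.hasFDerivAt c) b
    have h2 := (((hdα.hasFDerivAt.clm_apply (hasFDerivAt_const b x)).clm_apply
      (hasFDerivAt_const c x)).sub (hα1.hasFDerivAt.clm_apply hΓ1')).sub ((hα' b).mul (hα' c))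
    refine (congrArg (fun T ↦ T a) h2.fderiv).trans ?_
    simp
    ring
  -- The skew part of `∇∇α` is `-α ∘ R`. Inserting the centroaffine form of `R` here cancels the
  -- terms `∇α ⊗ α` coming from the derivative of `α ⊗ α`.
  have hR := congrArg (α x) (hPx a b c)
  simp only [hPh, hd, hdsymm b a]
  simp only [riem, projectiveSchouten, map_sub, map_add, map_smul, smul_eq_mul] at hR ⊢
  simp only [hsx b a] at hR
  linear_combination -hR

end ProjectiveAlgebra

/-! ### Centroaffine connections on a manifold -/

section Centroaffine

set_option linter.unusedSectionVars false

open Set Filter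

variable {E : Type*} [NormedAddCommGroup E] [NormedSpace ℝ E] [FiniteDimensional ℝ E]
  {M : Type*} [TopologicalSpace M] [ChartedSpace E M] [IsManifold 𝓘(ℝ, E) ∞ M]
  {e : OpenPartialHomeomorph M E}

/-- The smooth connection `cov` satisfies, in each chart, the structure equations of a connection
induced on a hypersurface transversal to its position vector, with second fundamental form `H`. -/
def IsCentroaffine (cov : AffineConnection 𝓘(ℝ, E) M)
    (H : Π q : M, TangentSpace 𝓘(ℝ, E) q → TangentSpace 𝓘(ℝ, E) q → ℝ) : Prop :=
  ∀ e ∈ IsManifold.maximalAtlas 𝓘(ℝ, E) ∞ M, ∃ h : E → E →L[ℝ] E →L[ℝ] ℝ,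
    ContDiffOn ℝ ∞ (christoffel cov e) e.target ∧ ContDiffOn ℝ ∞ h e.target ∧
    (∀ q ∈ e.source, ∀ v w, h (e q) (chartDeriv e q v) (chartDeriv e q w) = H q v w) ∧
    ∀ x ∈ e.target, IsCentroaffineAt (christoffel cov e) h x

/-- The derivative of a chart as an isomorphism. -/
def chartDerivEquiv (he : e ∈ IsManifold.maximalAtlas 𝓘(ℝ, E) ∞ M) {q : M} (hq : q ∈ e.source) :
    TangentSpace 𝓘(ℝ, E) q ≃ₗ[ℝ] E :=
  { (chartDeriv e q).toLinearMap with
    invFun := chartInv e q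
    left_inv := chartInv_chartDeriv he hq
    right_inv := chartDeriv_chartInv he hq }

/-- The trace is invariant under conjugation by the derivative of the chart. -/
theorem ricci_eq_ricciForm [T2Space M] (he : e ∈ IsManifold.maximalAtlas 𝓘(ℝ, E) ∞ M)
    (cov : AffineConnection 𝓘(ℝ, E) M)
    [hcov : CovariantDerivative.ContMDiffCovariantDerivative cov ∞] {q : M} (hq : q ∈ e.source)
    (v w : TangentSpace 𝓘(ℝ, E) q) :
    ricci cov q v w =
      ricciForm (christoffel cov e) (e q) (chartDeriv e q v) (chartDeriv e q w) := by
  rw [ricciForm_apply, ricci, ← LinearMap.trace_conj' _ (chartDerivEquiv he hq)]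
  congr 1
  ext a
  have hΓ : DifferentiableAt ℝ (christoffel cov e) (e q) :=
    ((contDiffOn_christoffel he cov).contDiffAt
      (e.open_target.mem_nhds (e.map_source hq))).differentiableAt (by simp)
  have h := chartDeriv_curvature he cov hq hΓ (chartInv e q a) v w
  rw [chartDeriv_chartInv he hq] at h
  exact h

/-- The components of a one-form in the chart `e`. -/
def chartForm (e : OpenPartialHomeomorph M E) (φ : Π q : M, TangentSpace 𝓘(ℝ, E) q →L[ℝ] ℝ)
    (x : E) : E →L[ℝ] ℝ :=
  (φ (e.symm x)).comp (chartInv e (e.symm x))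

theorem contDiffOn_chartForm (he : e ∈ IsManifold.maximalAtlas 𝓘(ℝ, E) ∞ M)
    {φ : Π q : M, TangentSpace 𝓘(ℝ, E) q →L[ℝ] ℝ} {U : Set M} (hU : IsOpen U)
    (hφ : ContMDiffOn 𝓘(ℝ, E) (𝓘(ℝ, E).prod 𝓘(ℝ, E →L[ℝ] ℝ)) ∞
      (fun x ↦ Bundle.TotalSpace.mk' (E →L[ℝ] ℝ)
        (E := fun x : M ↦ TangentSpace 𝓘(ℝ, E) x →L[ℝ] Bundle.Trivial M ℝ x) x (φ x)) U) :
    ContDiffOn ℝ ∞ (chartForm e φ) (e.target ∩ e.symm ⁻¹' U) := by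
  refine contDiffOn_clm_apply.2 fun a x hx ↦ ContDiffAt.contDiffWithinAt ?_
  have hxs := e.map_target hx.1
  have h1 := (hφ.contMDiffAt (hU.mem_nhds hx.2)).clm_bundle_apply
    (E₁ := fun y : M ↦ TangentSpace 𝓘(ℝ, E) y) (E₂ := Bundle.Trivial M ℝ)
    (contMDiffAt_chartField he hxs (contDiffAt_const (c := a)))
  have h2 : ContMDiffAt 𝓘(ℝ, E) 𝓘(ℝ, ℝ) ∞ (fun q ↦ φ q (chartField e (fun _ ↦ a) q)) (e.symm x) :=
    (Bundle.contMDiffAt_section _).1 h1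
  have h3 := h2.comp x (contMDiffAt_symm_of_mem_maximalAtlas he hx.1)
  exact h3.contDiffAt

theorem christoffel_projectiveChange (he : e ∈ IsManifold.maximalAtlas 𝓘(ℝ, E) ∞ M)
    (cov : AffineConnection 𝓘(ℝ, E) M) (φ : Π q : M, TangentSpace 𝓘(ℝ, E) q →L[ℝ] ℝ) {x : E}
    (hx : x ∈ e.target) (c a : E) :
    christoffel (projectiveChange cov φ) e x c a = christoffel cov e x c a +
      (chartForm e φ x a • c + chartForm e φ x c • a) := by
  have hxs := e.map_target hx
  rw [christoffel_eq_chartRep he _ hx, christoffel_eq_chartRep he _ hx]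
  simp only [chartRep, projectiveChange_apply, ContinuousLinearMap.map_add,
    ContinuousLinearMap.map_smul, chartDeriv_chartField he hxs]
  rfl

/-- The one-form `φ` exists only near each point and is not unique, but the resulting form `Ric / (n
- 1)` does not depend on it. The structure equations can therefore be checked point by point, each
time with a local `φ`. -/
theorem isCentroaffine_of_projectivelyFlat [T2Space M] (hn : 2 ≤ Module.finrank ℝ E)
    (cov : AffineConnection 𝓘(ℝ, E) M)
    [hcov : CovariantDerivative.ContMDiffCovariantDerivative cov ∞] (htor : cov.torsion = 0)
    (hric : RicciSymmetric cov) (hflat : ProjectivelyFlat cov) :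
    IsCentroaffine cov fun q v w ↦ (Module.finrank ℝ E - 1 : ℝ)⁻¹ * ricci cov q v w := by
  intro e he
  have hΓ := contDiffOn_christoffel he cov
  refine ⟨fun x ↦ (Module.finrank ℝ E - 1 : ℝ)⁻¹ • ricciForm (christoffel cov e) x, hΓ,
    contDiffOn_const.fun_smul (contDiffOn_ricciForm e.open_target hΓ), fun q hq v w ↦ ?_,
    fun x hx ↦ ?_⟩
  · simp only [smul_apply, smul_eq_mul, ricci_eq_ricciForm he cov hq]
  obtain ⟨U, hU, hxU, φ, hφ, hR⟩ := hflat (e.symm x)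
  have hxs := e.map_target hx
  have ht : ∀ᶠ y in 𝓝 x, y ∈ e.target := e.open_target.mem_nhds hx
  have hopen : IsOpen (e.target ∩ e.symm ⁻¹' U) := e.symm.isOpen_inter_preimage hU
  refine isCentroaffineAt_of_projective hn e.open_target hx hΓ
    (Γ' := christoffel (projectiveChange cov φ) e)
    ((contDiffOn_chartForm he hU hφ).contDiffAt (hopen.mem_nhds ⟨hx, hxU⟩)) ?_ ?_ ?_ ?_
  · exact ht.mono fun y hy c a ↦ christoffel_projectiveChange he cov φ hy c a
  · exact ht.mono fun y hy a b ↦ christoffel_symm_of_torsion_eq_zero he htor hy a b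
  · filter_upwards [hopen.mem_nhds ⟨hx, hxU⟩] with y hy hd a b c
    have hys := e.map_target hy.1
    have h := chartDeriv_curvature he (projectiveChange cov φ) hys (by rwa [e.right_inv hy.1])
      (chartInv e _ a) (chartInv e _ b) (chartInv e _ c)
    rw [hR _ hy.2, map_zero, chartDeriv_chartInv he hys, chartDeriv_chartInv he hys,
      chartDeriv_chartInv he hys, e.right_inv hy.1] at h
    exact h.symm
  · filter_upwards [ht] with y hy b c
    have hys := e.map_target hy
    have h1 := ricci_eq_ricciForm he cov hys (chartInv e _ b) (chartInv e _ c)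
    have h2 := ricci_eq_ricciForm he cov hys (chartInv e _ c) (chartInv e _ b)
    rw [chartDeriv_chartInv he hys, chartDeriv_chartInv he hys, e.right_inv hy] at h1 h2
    rw [← h1, ← h2, hric]

end Centroaffine

/-! ### The moving frame of a centroaffine hypersurface in coordinates -/

section Frame

set_option linter.unusedSectionVars false

open Set Filter

variable {E : Type*} [NormedAddCommGroup E] [NormedSpace ℝ E] [FiniteDimensional ℝ E]
  {V : Type*} [NormedAddCommGroup V] [NormedSpace ℝ V]

/-- The matrix of the structure equations: `frameForm Γ h x a (w, s) = (Γ(a, w) + s a, -h(a, w))`. -/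
def frameForm (Γ : E → E →L[ℝ] E →L[ℝ] E) (h : E → E →L[ℝ] E →L[ℝ] ℝ) (x : E) :
    E →L[ℝ] (E × ℝ) →L[ℝ] (E × ℝ) :=
  ((ContinuousLinearMap.compL ℝ (E × ℝ) E (E × ℝ) (.inl ℝ E ℝ)).comp
      ((ContinuousLinearMap.compL ℝ (E × ℝ) E E).flip (.fst ℝ E ℝ))).comp (Γ x) +
    (ContinuousLinearMap.compL ℝ (E × ℝ) E (E × ℝ) (.inl ℝ E ℝ)).comp
      (ContinuousLinearMap.smulRightL ℝ (E × ℝ) E (.snd ℝ E ℝ)) -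
    ((ContinuousLinearMap.compL ℝ (E × ℝ) ℝ (E × ℝ) (.inr ℝ E ℝ)).comp
      ((ContinuousLinearMap.compL ℝ (E × ℝ) E ℝ).flip (.fst ℝ E ℝ))).comp (h x)

theorem frameForm_apply (Γ : E → E →L[ℝ] E →L[ℝ] E) (h : E → E →L[ℝ] E →L[ℝ] ℝ) (x a : E)
    (w : E × ℝ) : frameForm Γ h x a w = (Γ x a w.1 + w.2 • a, -h x a w.1) := by
  simp [frameForm]

theorem contDiff_frameForm {Γ : E → E →L[ℝ] E →L[ℝ] E} {h : E → E →L[ℝ] E →L[ℝ] ℝ}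
    (hΓ : ContDiff ℝ ∞ Γ) (hh : ContDiff ℝ ∞ h) : ContDiff ℝ ∞ (frameForm Γ h) :=
  ((contDiff_const.clm_comp hΓ).add contDiff_const).sub (contDiff_const.clm_comp hh)

theorem fderiv_frameForm {Γ : E → E →L[ℝ] E →L[ℝ] E} {h : E → E →L[ℝ] E →L[ℝ] ℝ}
    (hΓ : ContDiff ℝ ∞ Γ) (hh : ContDiff ℝ ∞ h) (x a b : E) (w : E × ℝ) :
    fderiv ℝ (frameForm Γ h) x a b w = (fderiv ℝ Γ x a b w.1, -fderiv ℝ h x a b w.1) := by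
  have hB := (contDiff_frameForm hΓ hh).differentiable (by simp) x
  have h1 := hasFDerivAt_apply_const (hasFDerivAt_apply_const
    (hΓ.differentiable (by simp) x).hasFDerivAt b) w.1
  have h2 := hasFDerivAt_apply_const (hasFDerivAt_apply_const
    (hh.differentiable (by simp) x).hasFDerivAt b) w.1
  rw [fderiv_clm_apply_two hB]
  simp only [frameForm_apply]
  have h3 := (h1.add_const (w.2 • b)).prodMk h2.neg
  exact congrArg (fun T ↦ T a) h3.fderiv

/-- Apply both sides to `(w, s)`. The `E`-component is the curvature identity, in which `h(b, w)a -
h(a, w)b` comes from the products of the off-diagonal blocks. The `ℝ`-component is the Codazzi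
equation. The terms in `s` agree by symmetry of `Γ` and `h`. -/
theorem frameForm_flat {Γ : E → E →L[ℝ] E →L[ℝ] E} {h : E → E →L[ℝ] E →L[ℝ] ℝ}
    (hΓ : ContDiff ℝ ∞ Γ) (hh : ContDiff ℝ ∞ h) (hc : ∀ x, IsCentroaffineAt Γ h x) (x a b : E) :
    fderiv ℝ (frameForm Γ h) x a b + frameForm Γ h x a * frameForm Γ h x b =
      fderiv ℝ (frameForm Γ h) x b a + frameForm Γ h x b * frameForm Γ h x a := by
  have hΓd := hΓ.differentiable (by simp) x
  have hsymm : ∀ a b c, fderiv ℝ Γ x a b c = fderiv ℝ Γ x a c b := fun a b c ↦ by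
    rw [fderiv_clm_apply_two hΓd, fderiv_clm_apply_two hΓd]
    simp only [fun y ↦ (hc y).christoffel_symm b c]
  refine ContinuousLinearMap.ext fun w ↦ ?_
  simp only [add_apply, mul_apply_eq_comp, fderiv_frameForm hΓ hh, frameForm_apply,
    ContinuousLinearMap.map_add, ContinuousLinearMap.map_smul]
  obtain ⟨w, s⟩ := w
  have hR := (hc x).riem_eq a b w
  rw [riem, hsymm a w, hsymm b w, (hc x).christoffel_symm w b, (hc x).christoffel_symm w a,
    (hc x).christoffel_symm _ a, (hc x).christoffel_symm _ b] at hR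
  have hC := (hc x).codazzi a b w
  rw [(hc x).christoffel_symm w b, (hc x).christoffel_symm w a] at hC
  refine Prod.ext ?_ ?_
  · simp only [Prod.mk_add_mk, (hc x).christoffel_symm b a]
    rw [← sub_eq_zero] at hR ⊢
    rw [← hR]
    module
  · simp only [Prod.mk_add_mk, (hc x).symm b a, smul_eq_mul]
    linear_combination -hC

/-- The frame `(w, s) ↦ DF w + s F` of a hypersurface `F`. -/
def frame (F : E → V) (x : E) : (E × ℝ) →L[ℝ] V :=
  (fderiv ℝ F x).comp (.fst ℝ E ℝ) + (ContinuousLinearMap.snd ℝ E ℝ).smulRight (F x)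

theorem frame_apply (F : E → V) (x : E) (w : E × ℝ) :
    frame F x w = fderiv ℝ F x w.1 + w.2 • F x := by
  simp [frame]

/-- The Gauss formula of a hypersurface `F` at `x`, with transversal `F`. -/
def HessEq (Γ : E → E →L[ℝ] E →L[ℝ] E) (h : E → E →L[ℝ] E →L[ℝ] ℝ) (F : E → V) (x : E) : Prop :=
  ∀ a b, fderiv ℝ (fderiv ℝ F) x a b = fderiv ℝ F x (Γ x b a) - h x a b • F x

/-- The Gauss formula is the system `dL = L B` for the frame `L` of `F`; the `ℝ`-column of the
system is automatic. Uniqueness for linear systems thereby applies to centroaffine maps. -/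
theorem hasFDerivAt_frame {Γ : E → E →L[ℝ] E →L[ℝ] E} {h : E → E →L[ℝ] E →L[ℝ] ℝ} {F : E → V}
    {x : E} (hsymm : ∀ a b, Γ x a b = Γ x b a) (hF : ContDiffAt ℝ 2 F x) (hH : HessEq Γ h F x) :
    HasFDerivAt (frame F) ((ContinuousLinearMap.compL ℝ (E × ℝ) (E × ℝ) V (frame F x)).comp
      (frameForm Γ h x)) x := by
  have h1 : HasFDerivAt (fderiv ℝ F) (fderiv ℝ (fderiv ℝ F) x) x :=
    ((hF.fderiv_right (m := 1) (by norm_num)).differentiableAt (by simp)).hasFDerivAt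
  have h2 : HasFDerivAt F (fderiv ℝ F x) x := (hF.differentiableAt (by simp)).hasFDerivAt
  have h3 := ((((ContinuousLinearMap.compL ℝ (E × ℝ) E V).flip
    (.fst ℝ E ℝ)).hasFDerivAt.comp x h1)).add
    (((ContinuousLinearMap.smulRightL ℝ (E × ℝ) V (.snd ℝ E ℝ)).hasFDerivAt.comp x h2))
  refine h3.congr_fderiv ?_
  refine ContinuousLinearMap.ext fun a ↦ ContinuousLinearMap.ext fun w ↦ ?_
  have := hH a w.1
  simp only [add_apply, ContinuousLinearMap.comp_apply, ContinuousLinearMap.flip_apply,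
    ContinuousLinearMap.compL_apply, ContinuousLinearMap.coe_fst', frame_apply, frameForm_apply,
    this, ContinuousLinearMap.map_add, ContinuousLinearMap.map_smul, hsymm w.1 a,
    ContinuousLinearMap.smulRightL_apply_apply]
  simp
  module

/-- Converse: as `frameForm` sends `(0, 1)` to `(a, 0)` in direction `a`, the derivative of `F =
L(0, 1)` along `a` is `L(a, 0)`. So `L` is the frame of `F`, and the remaining part of the system is
the Gauss formula. -/
theorem hessEq_of_frame {Γ : E → E →L[ℝ] E →L[ℝ] E} {h : E → E →L[ℝ] E →L[ℝ] ℝ}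
    (hsymm : ∀ x a b, Γ x a b = Γ x b a) {L : E → (E × ℝ) →L[ℝ] V}
    (hL : ∀ x, HasFDerivAt L ((ContinuousLinearMap.compL ℝ (E × ℝ) (E × ℝ) V (L x)).comp
      (frameForm Γ h x)) x) :
    frame (fun x ↦ L x (0, 1)) = L ∧ ∀ x, HessEq Γ h (fun x ↦ L x (0, 1)) x := by
  have h1 : ∀ x, HasFDerivAt (fun x ↦ L x (0, 1)) ((L x).comp (.inl ℝ E ℝ)) x := fun x ↦ by
    refine (hasFDerivAt_apply_const (hL x) (0, 1)).congr_fderiv ?_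
    refine ContinuousLinearMap.ext fun a ↦ ?_
    simp [frameForm_apply]
  have h2 : fderiv ℝ (fun x ↦ L x (0, 1)) = fun x ↦ (L x).comp (.inl ℝ E ℝ) :=
    funext fun x ↦ (h1 x).fderiv
  constructor
  · ext1 x
    refine ContinuousLinearMap.ext fun w ↦ ?_
    rw [frame_apply, h2, ContinuousLinearMap.comp_apply, ← ContinuousLinearMap.map_smul,
      ← ContinuousLinearMap.map_add]
    simp
  · intro x a b
    have h3 : HasFDerivAt (fun x ↦ (L x).comp (.inl ℝ E ℝ)) _ x :=
      ((ContinuousLinearMap.compL ℝ E (E × ℝ) V).flip (.inl ℝ E ℝ)).hasFDerivAt.comp x (hL x)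
    rw [h2, h3.fderiv]
    simp only [ContinuousLinearMap.comp_apply, ContinuousLinearMap.flip_apply,
      ContinuousLinearMap.compL_apply, frameForm_apply, ContinuousLinearMap.inl_apply]
    rw [← ContinuousLinearMap.map_smul, ← ContinuousLinearMap.map_sub, hsymm x b a]
    simp

end Frame

/-! ### Centroaffine maps -/

section CentroaffineMap

set_option linter.unusedSectionVars false

open Set Filter

variable {E : Type*} [NormedAddCommGroup E] [NormedSpace ℝ E] [FiniteDimensional ℝ E]
  {M : Type*} [TopologicalSpace M] [ChartedSpace E M] [IsManifold 𝓘(ℝ, E) ∞ M]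
  {e : OpenPartialHomeomorph M E}
  {V : Type*} [NormedAddCommGroup V] [NormedSpace ℝ V]
  {cov : AffineConnection 𝓘(ℝ, E) M}
  {H : Π q : M, TangentSpace 𝓘(ℝ, E) q → TangentSpace 𝓘(ℝ, E) q → ℝ}

/-- The map `f` satisfies near `q` the Gauss formula of a hypersurface with transversal its
position vector, the induced connection being `cov` and the second fundamental form `H`. -/
structure IsCentroaffineMapAt (cov : AffineConnection 𝓘(ℝ, E) M)
    (H : Π q : M, TangentSpace 𝓘(ℝ, E) q → TangentSpace 𝓘(ℝ, E) q → ℝ) (f : M → V) (q : M) :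
    Prop where
  contMDiffAt : ContMDiffAt 𝓘(ℝ, E) 𝓘(ℝ, V) ∞ f q
  bijective : Function.Bijective fun w : TangentSpace 𝓘(ℝ, E) q × ℝ ↦
    mvfderiv 𝓘(ℝ, E) f q w.1 + w.2 • f q
  hess (Y : Π q : M, TangentSpace 𝓘(ℝ, E) q) : CMDiffAt ∞ (T% Y) q → ∀ v,
    mvfderiv 𝓘(ℝ, E) (fun p ↦ mvfderiv 𝓘(ℝ, E) f p (Y p)) q v =
      mvfderiv 𝓘(ℝ, E) f q (cov Y q v) - H q v (Y q) • f q

theorem mvfderiv_congr {f g : M → V} {q : M} (h : f =ᶠ[𝓝 q] g) :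
    mvfderiv 𝓘(ℝ, E) f q = mvfderiv 𝓘(ℝ, E) g q := by
  exact h.mfderiv_eq

theorem contDiffAt_comp_symm (he : e ∈ IsManifold.maximalAtlas 𝓘(ℝ, E) ∞ M) {f : M → V} {q : M}
    (hq : q ∈ e.source) (hf : ContMDiffAt 𝓘(ℝ, E) 𝓘(ℝ, V) ∞ f q) :
    ContDiffAt ℝ ∞ (fun x ↦ f (e.symm x)) (e q) := by
  have h := (contMDiffAt_symm_of_mem_maximalAtlas he (e.map_source hq))
  rw [← e.left_inv hq] at hf
  exact (ContMDiffAt.comp (e q) hf h).contDiffAt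

theorem contMDiffAt_of_comp_symm (he : e ∈ IsManifold.maximalAtlas 𝓘(ℝ, E) ∞ M) {f : M → V} {q : M}
    (hq : q ∈ e.source) (hf : ContDiffAt ℝ ∞ (fun x ↦ f (e.symm x)) (e q)) :
    ContMDiffAt 𝓘(ℝ, E) 𝓘(ℝ, V) ∞ f q := by
  refine (hf.contMDiffAt.comp q (contMDiffAt_of_mem_maximalAtlas he hq)).congr_of_eventuallyEq ?_
  filter_upwards [e.open_source.mem_nhds hq] with p hp
  simp [e.left_inv hp]

theorem mvfderiv_eq_fderiv (he : e ∈ IsManifold.maximalAtlas 𝓘(ℝ, E) ∞ M) {f : M → V} {q : M}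
    (hq : q ∈ e.source) (hf : DifferentiableAt ℝ (fun x ↦ f (e.symm x)) (e q))
    (v : TangentSpace 𝓘(ℝ, E) q) :
    mvfderiv 𝓘(ℝ, E) f q v = fderiv ℝ (fun x ↦ f (e.symm x)) (e q) (chartDeriv e q v) := by
  rw [← mvfderiv_comp_chart he hq hf]
  refine congrArg (fun T : TangentSpace 𝓘(ℝ, E) q →L[ℝ] V ↦ T v) (mvfderiv_congr ?_)
  filter_upwards [e.open_source.mem_nhds hq] with p hp
  simp [e.left_inv hp]

theorem mvfderiv_apply_eventuallyEq (he : e ∈ IsManifold.maximalAtlas 𝓘(ℝ, E) ∞ M) {f : M → V}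
    {q : M} (hq : q ∈ e.source) (hf : ContMDiffAt 𝓘(ℝ, E) 𝓘(ℝ, V) ∞ f q)
    (Y : Π q : M, TangentSpace 𝓘(ℝ, E) q) :
    (fun p ↦ mvfderiv 𝓘(ℝ, E) f p (Y p)) =ᶠ[𝓝 q]
      fun p ↦ (fun x ↦ fderiv ℝ (fun x ↦ f (e.symm x)) x (chartRep e Y x)) (e p) := by
  have h1 := (e.continuousAt hq).eventually
    (((contDiffAt_comp_symm he hq hf).of_le two_le_infty).eventually (by simp))
  filter_upwards [h1, e.open_source.mem_nhds hq] with p hp hps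
  rw [chartRep_apply hps]
  exact mvfderiv_eq_fderiv he hps (hp.differentiableAt (by simp)) (Y p)

theorem hasFDerivAt_fderiv_chartRep (he : e ∈ IsManifold.maximalAtlas 𝓘(ℝ, E) ∞ M) {f : M → V}
    {q : M} (hq : q ∈ e.source) (hf : ContMDiffAt 𝓘(ℝ, E) 𝓘(ℝ, V) ∞ f q)
    {Y : Π q : M, TangentSpace 𝓘(ℝ, E) q} (hY : CMDiffAt ∞ (T% Y) q) :
    HasFDerivAt (fun x ↦ fderiv ℝ (fun x ↦ f (e.symm x)) x (chartRep e Y x))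
      ((fderiv ℝ (fun x ↦ f (e.symm x)) (e q)).comp (fderiv ℝ (chartRep e Y) (e q)) +
        (fderiv ℝ (fderiv ℝ fun x ↦ f (e.symm x)) (e q)).flip (chartRep e Y (e q))) (e q) := by
  have hF2 := (contDiffAt_comp_symm he hq hf).of_le two_le_infty
  have hYd : DifferentiableAt ℝ (chartRep e Y) (e q) :=
    (contDiffAt_chartRep he hq hY).differentiableAt (by simp)
  have hdF : DifferentiableAt ℝ (fderiv ℝ fun x ↦ f (e.symm x)) (e q) :=
    (hF2.fderiv_right (m := 1) (by norm_num)).differentiableAt (by simp)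
  exact hdF.hasFDerivAt.clm_apply hYd.hasFDerivAt

theorem mvfderiv_mvfderiv_apply (he : e ∈ IsManifold.maximalAtlas 𝓘(ℝ, E) ∞ M) {f : M → V} {q : M}
    (hq : q ∈ e.source) (hf : ContMDiffAt 𝓘(ℝ, E) 𝓘(ℝ, V) ∞ f q)
    {Y : Π q : M, TangentSpace 𝓘(ℝ, E) q} (hY : CMDiffAt ∞ (T% Y) q)
    (v : TangentSpace 𝓘(ℝ, E) q) :
    mvfderiv 𝓘(ℝ, E) (fun p ↦ mvfderiv 𝓘(ℝ, E) f p (Y p)) q v =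
      fderiv ℝ (fderiv ℝ fun x ↦ f (e.symm x)) (e q) (chartDeriv e q v) (chartDeriv e q (Y q)) +
      fderiv ℝ (fun x ↦ f (e.symm x)) (e q)
        (fderiv ℝ (chartRep e Y) (e q) (chartDeriv e q v)) := by
  have hd := hasFDerivAt_fderiv_chartRep he hq hf hY
  rw [mvfderiv_congr (mvfderiv_apply_eventuallyEq he hq hf Y),
    mvfderiv_comp_chart he hq hd.differentiableAt, hd.fderiv, ← chartRep_apply hq Y]
  simp only [add_apply, ContinuousLinearMap.comp_apply, ContinuousLinearMap.flip_apply]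
  rw [add_comm]

/-- The derivative of the components of `Y` occurs identically on both sides. What is left depends
only on `v` and the value of `Y` at `q`, so fields with constant components suffice to recover the
coordinate equation. -/
theorem hess_iff (he : e ∈ IsManifold.maximalAtlas 𝓘(ℝ, E) ∞ M) {f : M → V} {q : M}
    (hq : q ∈ e.source) (hf : ContMDiffAt 𝓘(ℝ, E) 𝓘(ℝ, V) ∞ f q)
    {h : E → E →L[ℝ] E →L[ℝ] ℝ}
    (hh : ∀ v w, h (e q) (chartDeriv e q v) (chartDeriv e q w) = H q v w) :
    (∀ Y : Π q : M, TangentSpace 𝓘(ℝ, E) q, CMDiffAt ∞ (T% Y) q → ∀ v,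
      mvfderiv 𝓘(ℝ, E) (fun p ↦ mvfderiv 𝓘(ℝ, E) f p (Y p)) q v =
        mvfderiv 𝓘(ℝ, E) f q (cov Y q v) - H q v (Y q) • f q) ↔
    HessEq (christoffel cov e) h (fun x ↦ f (e.symm x)) (e q) := by
  have hfd : DifferentiableAt ℝ (fun x ↦ f (e.symm x)) (e q) :=
    (contDiffAt_comp_symm he hq hf).differentiableAt (by simp)
  have key : ∀ {Y : Π q : M, TangentSpace 𝓘(ℝ, E) q}, CMDiffAt ∞ (T% Y) q → ∀ v,
      (mvfderiv 𝓘(ℝ, E) (fun p ↦ mvfderiv 𝓘(ℝ, E) f p (Y p)) q v =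
        mvfderiv 𝓘(ℝ, E) f q (cov Y q v) - H q v (Y q) • f q ↔
      fderiv ℝ (fderiv ℝ fun x ↦ f (e.symm x)) (e q) (chartDeriv e q v) (chartDeriv e q (Y q)) =
        fderiv ℝ (fun x ↦ f (e.symm x)) (e q)
          (christoffel cov e (e q) (chartDeriv e q (Y q)) (chartDeriv e q v)) -
        h (e q) (chartDeriv e q v) (chartDeriv e q (Y q)) • f (e.symm (e q))) := by
    intro Y hY v
    rw [mvfderiv_mvfderiv_apply he hq hf hY, mvfderiv_eq_fderiv he hq hfd,
      chartDeriv_cov he cov hq ((contDiffAt_chartRep he hq hY).differentiableAt (by simp)),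
      ContinuousLinearMap.map_add, hh, e.left_inv hq, add_comm, add_sub_assoc, add_right_inj]
  constructor
  · intro hY a b
    have h1 := contMDiffAt_chartField he hq (contDiffAt_const (c := b))
    have h2 := (key h1 (chartInv e q a)).1 (hY _ h1 _)
    rwa [chartDeriv_chartField he hq, chartDeriv_chartInv he hq] at h2
  · intro hF Y hY v
    exact (key hY v).2 (hF _ _)

theorem IsCentroaffineMapAt.congr {f g : M → V} {q : M} (hf : IsCentroaffineMapAt cov H f q)
    (h : g =ᶠ[𝓝 q] f) : IsCentroaffineMapAt cov H g q where
  contMDiffAt := hf.contMDiffAt.congr_of_eventuallyEq h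
  bijective := by
    rw [mvfderiv_congr h, h.self_of_nhds]
    exact hf.bijective
  hess Y hY v := by
    have h1 : (fun p ↦ mvfderiv 𝓘(ℝ, E) g p (Y p)) =ᶠ[𝓝 q]
        fun p ↦ mvfderiv 𝓘(ℝ, E) f p (Y p) := by
      filter_upwards [h.eventually_nhds] with p hp
      rw [mvfderiv_congr hp]
    rw [mvfderiv_congr h, h.self_of_nhds, mvfderiv_congr h1, hf.hess Y hY v]

/-- The Gauss formula is linear in `f`. This freedom is what allows local solutions to be matched.
-/
theorem IsCentroaffineMapAt.linear_comp {f : M → V} {q : M} (hf : IsCentroaffineMapAt cov H f q)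
    (T : V ≃L[ℝ] V) : IsCentroaffineMapAt cov H (fun p ↦ T (f p)) q := by
  set e := chartAt E q
  have he : e ∈ IsManifold.maximalAtlas 𝓘(ℝ, E) ∞ M := IsManifold.chart_mem_maximalAtlas q
  have hq : q ∈ e.source := mem_chart_source E q
  have hT : ContMDiffAt 𝓘(ℝ, E) 𝓘(ℝ, V) ∞ (fun p ↦ T (f p)) q :=
    T.contDiff.contMDiff.contMDiffAt.comp q hf.contMDiffAt
  have hd : ∀ {g : M → V} {q : M}, MDiffAt g q → ∀ v,
      mvfderiv 𝓘(ℝ, E) (fun p ↦ T (g p)) q v = T (mvfderiv 𝓘(ℝ, E) g q v) := by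
    intro g q hg v
    have := mfderiv_comp q (T.differentiableAt (x := g q)).mdifferentiableAt hg
    rw [mfderiv_eq_fderiv, T.fderiv] at this
    exact congrArg (fun T ↦ T v) this
  have hfd := hf.contMDiffAt.mdifferentiableAt (by simp)
  refine ⟨hT, ?_, fun Y hY v ↦ ?_⟩
  · have : (fun w : TangentSpace 𝓘(ℝ, E) q × ℝ ↦
        mvfderiv 𝓘(ℝ, E) (fun p ↦ T (f p)) q w.1 + w.2 • T (f q)) =
        T ∘ fun w : TangentSpace 𝓘(ℝ, E) q × ℝ ↦ mvfderiv 𝓘(ℝ, E) f q w.1 + w.2 • f q := by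
      ext w
      simp [hd hfd]
    rw [this]
    exact T.bijective.comp hf.bijective
  · have hev : (fun p ↦ mvfderiv 𝓘(ℝ, E) (fun p ↦ T (f p)) p (Y p)) =ᶠ[𝓝 q]
        fun p ↦ T (mvfderiv 𝓘(ℝ, E) f p (Y p)) := by
      have h1 := (contMDiffAt_iff_contMDiffAt_nhds (n := 1) (by simp)).1
        (hf.contMDiffAt.of_le (by simp))
      filter_upwards [h1] with p hp
      exact hd (hp.mdifferentiableAt (by simp)) _
    have hdd : MDiffAt (fun p ↦ mvfderiv 𝓘(ℝ, E) f p (Y p)) q := by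
      have h1 := (hasFDerivAt_fderiv_chartRep he hq hf.contMDiffAt hY).differentiableAt
      exact (h1.mdifferentiableAt.comp q ((mdifferentiable_of_mem_maximalAtlas
        he).mdifferentiableAt hq)).congr_of_eventuallyEq
          (mvfderiv_apply_eventuallyEq he hq hf.contMDiffAt Y)
    rw [mvfderiv_congr hev, hd hdd, hf.hess Y hY, hd hfd]
    simp

end CentroaffineMap

/-! ### Existence of a centroaffine map -/

section CentroaffineExistence

set_option linter.unusedSectionVars false

open Set Filter

variable {E : Type*} [NormedAddCommGroup E] [NormedSpace ℝ E] [FiniteDimensional ℝ E]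
  {M : Type*} [TopologicalSpace M] [ChartedSpace E M] [IsManifold 𝓘(ℝ, E) ∞ M]
  {e : OpenPartialHomeomorph M E}
  {cov : AffineConnection 𝓘(ℝ, E) M}
  {H : Π q : M, TangentSpace 𝓘(ℝ, E) q → TangentSpace 𝓘(ℝ, E) q → ℝ}


/-- The target is the whole model space, so the integrable system for the frame has a solution `L`
on all of it. The map is `L(0, 1)` in the chart, and its frame is bijective because every `L x` is
invertible. -/
theorem exists_isCentroaffineMapAt_on_chart (hc : IsCentroaffine cov H)
    (he : e ∈ IsManifold.maximalAtlas 𝓘(ℝ, E) ∞ M) (ht : e.target = univ) :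
    ∃ f : M → E × ℝ, ∀ q ∈ e.source, IsCentroaffineMapAt cov H f q := by
  obtain ⟨h, hΓ, hh, hH, hce⟩ := hc e he
  rw [ht, contDiffOn_univ] at hΓ hh
  have hce' : ∀ x, IsCentroaffineAt (christoffel cov e) h x := fun x ↦ hce x (by simp [ht])
  have hB := contDiff_frameForm hΓ hh
  have hflat := frameForm_flat hΓ hh hce'
  obtain ⟨L, hL0, hL⟩ := exists_hasFDerivAt_mul (hB.of_le two_le_infty) hflat 0
  have hunit := isUnit_of_hasFDerivAt_mul (hB.of_le two_le_infty) hflat hL0 hL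
  have hLs := contDiff_of_hasFDerivAt_mul hB hL
  obtain ⟨hframe, hhess⟩ := hessEq_of_frame (fun x ↦ (hce' x).christoffel_symm) hL
  set F : E → E × ℝ := fun x ↦ L x (0, 1) with hFdef
  have hF : ContDiff ℝ ∞ F := hLs.clm_apply contDiff_const
  have hFe : (fun x ↦ F (e (e.symm x))) = F := by
    ext1 x; rw [e.right_inv (by simp [ht])]
  refine ⟨fun p ↦ F (e p), fun q hq ↦ ?_⟩
  have hsm : ContMDiffAt 𝓘(ℝ, E) 𝓘(ℝ, E × ℝ) ∞ (fun p ↦ F (e p)) q :=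
    contMDiffAt_of_comp_symm he hq (by rw [hFe]; exact hF.contDiffAt)
  refine ⟨hsm, ?_, (hess_iff he hq hsm (hH q hq)).2 (by rw [hFe]; exact hhess (e q))⟩
  have h1 : (fun w : TangentSpace 𝓘(ℝ, E) q × ℝ ↦
      mvfderiv 𝓘(ℝ, E) (fun p ↦ F (e p)) q w.1 + w.2 • F (e q)) =
      (fun w ↦ L (e q) w) ∘ fun w : TangentSpace 𝓘(ℝ, E) q × ℝ ↦ (chartDeriv e q w.1, w.2) := by
    ext1 w
    have := mvfderiv_comp_chart he hq (hF.differentiable (by simp) (e q)) w.1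
    rw [this, Function.comp_apply, ← hframe, frame_apply]
  rw [h1]
  refine Function.Bijective.comp ?_ ?_
  · obtain ⟨u, hu⟩ := hunit (e q)
    rw [← hu]
    refine Function.bijective_iff_has_inverse.2 ⟨fun w ↦ (u⁻¹ : ((E × ℝ) →L[ℝ] (E × ℝ))ˣ).1 w,
      fun w ↦ ?_, fun w ↦ ?_⟩
    · exact congrArg (fun T : (E × ℝ) →L[ℝ] (E × ℝ) ↦ T w) u.inv_mul
    · exact congrArg (fun T : (E × ℝ) →L[ℝ] (E × ℝ) ↦ T w) u.mul_inv
  · exact Function.Bijective.prodMap (chartDerivEquiv he hq).bijective Function.bijective_id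

/-- Two centroaffine maps with the same first jet at a point agree. -/
theorem eqOn_of_isCentroaffineMapAt (hc : IsCentroaffine cov H)
    (he : e ∈ IsManifold.maximalAtlas 𝓘(ℝ, E) ∞ M) {f g : M → E × ℝ} {U : Set M}
    (hU : IsOpen U) (hUe : U ⊆ e.source) (hUc : IsPreconnected (e.target ∩ e.symm ⁻¹' U))
    (hf : ∀ q ∈ U, IsCentroaffineMapAt cov H f q) (hg : ∀ q ∈ U, IsCentroaffineMapAt cov H g q)
    {q₀ : M} (hq₀ : q₀ ∈ U) (h₀ : f q₀ = g q₀)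
    (h₀' : ∀ v, mvfderiv 𝓘(ℝ, E) f q₀ v = mvfderiv 𝓘(ℝ, E) g q₀ v) : EqOn f g U := by
  obtain ⟨h, hΓ, hh, hH, hce⟩ := hc e he
  set O := e.target ∩ e.symm ⁻¹' U with hO
  have hOo : IsOpen O := e.symm.isOpen_inter_preimage hU
  -- In the chart both frames solve the same linear system. With values in `E × ℝ` they are
  -- endomorphisms, hence elements of a normed algebra, and equal first jets at `q₀` mean equal
  -- frames there.
  have hfr : ∀ {f : M → E × ℝ}, (∀ q ∈ U, IsCentroaffineMapAt cov H f q) → ∀ x ∈ O,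
      HasFDerivAt (frame fun x ↦ f (e.symm x)) ((ContinuousLinearMap.mul ℝ _
        (frame (fun x ↦ f (e.symm x)) x)).comp (frameForm (christoffel cov e) h x)) x := by
    intro f hf x hx
    have hxs := e.map_target hx.1
    have hfx := hf _ hx.2
    have h1 := contDiffAt_comp_symm he hxs hfx.contMDiffAt
    have h2 := (hess_iff he hxs hfx.contMDiffAt (hH _ hxs)).1 hfx.hess
    rw [e.right_inv hx.1] at h1 h2
    exact hasFDerivAt_frame (hce x hx.1).christoffel_symm (h1.of_le two_le_infty) h2
  have hBc : ContinuousOn (frameForm (christoffel cov e) h) O := by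
    have h1 := (hΓ.continuousOn.mono (inter_subset_left (t := e.symm ⁻¹' U)))
    have h2 := (hh.continuousOn.mono (inter_subset_left (t := e.symm ⁻¹' U)))
    exact ((continuousOn_const.clm_comp h1).add continuousOn_const).sub
      (continuousOn_const.clm_comp h2)
  have hq₀s := hUe hq₀
  have hmem : ∀ q ∈ U, e q ∈ O := fun q hq ↦
    ⟨e.map_source (hUe hq), by rw [mem_preimage, e.left_inv (hUe hq)]; exact hq⟩
  have hd : ∀ {f : M → E × ℝ}, (∀ q ∈ U, IsCentroaffineMapAt cov H f q) →
      DifferentiableAt ℝ (fun x ↦ f (e.symm x)) (e q₀) := fun hf ↦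
    (contDiffAt_comp_symm he hq₀s (hf _ hq₀).contMDiffAt).differentiableAt (by simp)
  have key := eqOn_of_hasFDerivAt_mul hOo hUc hBc (hfr hf) (hfr hg) (hmem _ hq₀) (by
    refine ContinuousLinearMap.ext fun w ↦ ?_
    have h2 := h₀' (chartInv e q₀ w.1)
    rw [mvfderiv_eq_fderiv he hq₀s (hd hf), mvfderiv_eq_fderiv he hq₀s (hd hg),
      chartDeriv_chartInv he hq₀s] at h2
    simp only [frame_apply, h2, e.left_inv hq₀s, h₀])
  intro q hq
  have h3 := congrArg (fun T ↦ T ((0 : E), (1 : ℝ))) (key (hmem q hq))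
  simpa [frame_apply, e.left_inv (hUe hq)] using h3

/-- On a manifold covered by two charts onto the model space with connected overlap,
centroaffine maps exist globally. -/
theorem exists_isCentroaffineMapAt (hc : IsCentroaffine cov H) {e₁ e₂ : OpenPartialHomeomorph M E}
    (he₁ : e₁ ∈ IsManifold.maximalAtlas 𝓘(ℝ, E) ∞ M) (ht₁ : e₁.target = univ)
    (he₂ : e₂ ∈ IsManifold.maximalAtlas 𝓘(ℝ, E) ∞ M) (ht₂ : e₂.target = univ)
    (hcover : e₁.source ∪ e₂.source = univ) (hconn : IsConnected (e₁.symm ⁻¹' e₂.source)) :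
    ∃ f : M → E × ℝ, ∀ q, IsCentroaffineMapAt cov H f q := by
  classical
  obtain ⟨f, hf⟩ := exists_isCentroaffineMapAt_on_chart hc he₁ ht₁
  obtain ⟨g, hg⟩ := exists_isCentroaffineMapAt_on_chart hc he₂ ht₂
  obtain ⟨x₀, hx₀⟩ := hconn.nonempty
  set q := e₁.symm x₀
  have hq₁ : q ∈ e₁.source := e₁.map_target (by simp [ht₁])
  have hq₂ : q ∈ e₂.source := hx₀
  have : FiniteDimensional ℝ (TangentSpace 𝓘(ℝ, E) q) := inferInstanceAs (FiniteDimensional ℝ E)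
  -- `Φ f` is the frame of `f` at `q`. The isomorphism `T` carries the frame of `g` to that of `f`,
  -- so `T ∘ g` and `f` have the same first jet at `q` and agree on the connected overlap.
  let Φ : (M → E × ℝ) → TangentSpace 𝓘(ℝ, E) q × ℝ →ₗ[ℝ] E × ℝ := fun f ↦
    (mvfderiv 𝓘(ℝ, E) f q).toLinearMap.coprod (LinearMap.toSpanSingleton ℝ (E × ℝ) (f q))
  let T : (E × ℝ) ≃ₗ[ℝ] (E × ℝ) := (LinearEquiv.ofBijective (Φ g) (hg q hq₂).bijective).symm.trans
    (LinearEquiv.ofBijective (Φ f) (hf q hq₁).bijective)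
  have hT : ∀ w, T (Φ g w) = Φ f w := fun w ↦ by
    have : (LinearEquiv.ofBijective (Φ g) (hg q hq₂).bijective).symm (Φ g w) = w :=
      LinearEquiv.symm_apply_apply (LinearEquiv.ofBijective (Φ g) (hg q hq₂).bijective) w
    simp only [T, LinearEquiv.trans_apply, this]
    rfl
  set T' : (E × ℝ) ≃L[ℝ] (E × ℝ) := T.toContinuousLinearEquiv
  have hg' : ∀ p ∈ e₂.source, IsCentroaffineMapAt cov H (fun p ↦ T' (g p)) p := fun p hp ↦
    (hg p hp).linear_comp T'
  have heq : EqOn f (fun p ↦ T' (g p)) (e₁.source ∩ e₂.source) := by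
    refine eqOn_of_isCentroaffineMapAt hc he₁ (e₁.open_source.inter e₂.open_source)
      inter_subset_left ?_ (fun p hp ↦ hf p hp.1) (fun p hp ↦ hg' p hp.2) ⟨hq₁, hq₂⟩ ?_ fun v ↦ ?_
    · have : e₁.target ∩ e₁.symm ⁻¹' (e₁.source ∩ e₂.source) = e₁.symm ⁻¹' e₂.source := by
        ext x
        have : e₁.symm x ∈ e₁.source := e₁.map_target (by simp [ht₁])
        simp [ht₁, this]
      rw [this]
      exact hconn.isPreconnected
    · have h1 : f q = T (g q) := by simpa [Φ] using (hT (0, 1)).symm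
      exact h1
    · have h1 : mvfderiv 𝓘(ℝ, E) f q v = T (mvfderiv 𝓘(ℝ, E) g q v) := by
        simpa [Φ] using (hT (v, 0)).symm
      have h2 := mfderiv_comp q (T'.differentiableAt (x := g q)).mdifferentiableAt
        ((hg q hq₂).contMDiffAt.mdifferentiableAt (by simp))
      rw [mfderiv_eq_fderiv, T'.fderiv] at h2
      have h3 : mvfderiv 𝓘(ℝ, E) (fun p ↦ T' (g p)) q v = T' (mvfderiv 𝓘(ℝ, E) g q v) :=
        congrArg (fun T ↦ T v) h2
      exact h1.trans h3.symm
  refine ⟨fun p ↦ if p ∈ e₁.source then f p else T' (g p), fun p ↦ ?_⟩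
  by_cases hp : p ∈ e₁.source
  · refine (hf p hp).congr ?_
    filter_upwards [e₁.open_source.mem_nhds hp] with r hr
    simp [hr]
  · have hp₂ : p ∈ e₂.source := ((hcover ▸ mem_univ p : p ∈ e₁.source ∪ e₂.source)).resolve_left hp
    refine (hg' p hp₂).congr ?_
    filter_upwards [e₂.open_source.mem_nhds hp₂] with r hr
    by_cases hr₁ : r ∈ e₁.source
    · simpa [hr₁] using heq ⟨hr₁, hr⟩
    · simp [hr₁]

end CentroaffineExistence

/-! ### Stereographic charts -/

section Stereographic

open Set Filter

/-- A manifold diffeomorphic to the sphere of dimension at least two is covered by two charts onto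
the model space whose overlap is connected. -/
theorem exists_two_charts {n : ℕ} (hn : 2 ≤ n) {M : Type*} [TopologicalSpace M]
    [ChartedSpace (EuclideanSpace ℝ (Fin n)) M] [IsManifold (𝓡 n) ∞ M]
    (Φ : M ≃ₘ⟮𝓡 n, 𝓡 n⟯ Metric.sphere (0 : EuclideanSpace ℝ (Fin (n + 1))) 1) :
    ∃ e₁ e₂ : OpenPartialHomeomorph M (EuclideanSpace ℝ (Fin n)),
      e₁ ∈ IsManifold.maximalAtlas (𝓡 n) ∞ M ∧ e₁.target = univ ∧
      e₂ ∈ IsManifold.maximalAtlas (𝓡 n) ∞ M ∧ e₂.target = univ ∧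
      e₁.source ∪ e₂.source = univ ∧ IsConnected (e₁.symm ⁻¹' e₂.source) := by
  have : Fact (Module.finrank ℝ (EuclideanSpace ℝ (Fin (n + 1))) = n + 1) :=
    ⟨finrank_euclideanSpace_fin⟩
  set S := Metric.sphere (0 : EuclideanSpace ℝ (Fin (n + 1))) 1
  obtain ⟨v⟩ : Nonempty S := (NormedSpace.sphere_nonempty.2 zero_le_one).to_subtype
  have hv : v ≠ -v := ne_neg_of_mem_unit_sphere ℝ v
  -- Stereographic projection away from `v`, transported to `M`; the two charts belong to `v` and
  -- `-v`.
  let e : S → OpenPartialHomeomorph M (EuclideanSpace ℝ (Fin n)) := fun v ↦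
    Φ.toHomeomorph.toOpenPartialHomeomorph ≫ₕ stereographic' n v
  have hsrc : ∀ v, (e v).source = Φ ⁻¹' {v}ᶜ := fun v ↦ by
    simp [e]
  have htgt : ∀ v, (e v).target = univ := fun v ↦ by
    simp [e]
  have hst : ∀ v : S, stereographic' n v ∈ IsManifold.maximalAtlas (𝓡 n) ∞ S := fun v ↦
    IsManifold.subset_maximalAtlas ⟨v, rfl⟩
  have hmem : ∀ v, e v ∈ IsManifold.maximalAtlas (𝓡 n) ∞ M := fun v ↦ by
    refine OpenPartialHomeomorph.mem_maximalAtlas_of_contMDiffOn _ ?_ ?_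
    · refine (contMDiffOn_of_mem_maximalAtlas (hst v)).comp Φ.contMDiff.contMDiffOn ?_
      intro q hq
      simpa [hsrc] using hq
    · exact Φ.symm.contMDiff.comp_contMDiffOn
        ((contMDiffOn_symm_of_mem_maximalAtlas (hst v)).mono (by simp))
  refine ⟨e v, e (-v), hmem _, htgt _, hmem _, htgt _, ?_, ?_⟩
  · rw [hsrc, hsrc, ← preimage_union, ← compl_inter, singleton_inter_eq_empty.2 (by simpa using hv)]
    simp
  -- In the first chart the overlap is `ℝⁿ` with one point removed, which is connected because `n ≥
  -- 2`.
  · have h1 : (e v).symm ⁻¹' (e (-v)).source = {stereographic' n v (-v)}ᶜ := by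
      ext x
      have hx : x ∈ (stereographic' n v).target := by simp
      have hv' : -v ∈ (stereographic' n v).source := by simpa using hv.symm
      have h2 : Φ ((e v).symm x) = (stereographic' n v).symm x :=
        Φ.apply_symm_apply _
      rw [mem_preimage, hsrc, mem_preimage, h2, mem_compl_singleton_iff, mem_compl_singleton_iff,
        ne_eq, ne_eq, not_iff_not]
      constructor
      · intro h
        rw [← h, (stereographic' n v).right_inv hx]
      · rintro rfl
        exact (stereographic' n v).left_inv hv'
    rw [h1]
    refine isConnected_compl_singleton_of_one_lt_rank ?_ _
    rw [← Module.finrank_eq_rank, finrank_euclideanSpace_fin]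
    exact_mod_cast hn

end Stereographic

/-! ### Complete vector fields -/

section Flow

set_option linter.unusedSectionVars false

open Set Filter

variable {E : Type*} [NormedAddCommGroup E] [NormedSpace ℝ E] [FiniteDimensional ℝ E]
  {M : Type*} [TopologicalSpace M] [ChartedSpace E M] [IsManifold 𝓘(ℝ, E) ∞ M]
  {e : OpenPartialHomeomorph M E} {W : Π q : M, TangentSpace 𝓘(ℝ, E) q}

theorem hasDerivAt_chart_comp (he : e ∈ IsManifold.maximalAtlas 𝓘(ℝ, E) ∞ M) {γ : ℝ → M} {t : ℝ}
    (ht : γ t ∈ e.source) {v : TangentSpace 𝓘(ℝ, E) (γ t)}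
    (hγ : HasMFDerivAt 𝓘(ℝ, ℝ) 𝓘(ℝ, E) γ t ((1 : ℝ →L[ℝ] ℝ).smulRight v)) :
    HasDerivAt (fun s ↦ e (γ s)) (chartDeriv e (γ t) v) t := by
  have h1 := ((mdifferentiable_of_mem_maximalAtlas he).mdifferentiableAt ht).hasMFDerivAt.comp t hγ
  have h2 := hasMFDerivAt_iff_hasFDerivAt.1 h1
  have h3 : HasFDerivAt (fun s ↦ e (γ s)) ((1 : ℝ →L[ℝ] ℝ).smulRight (chartDeriv e (γ t) v)) t := by
    refine HasFDerivAt.congr_fderiv h2 ?_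
    ext
    change chartDeriv e (γ t) ((1 : ℝ) • v) = (1 : ℝ) • chartDeriv e (γ t) v
    simp
  simpa using h3.hasDerivAt

theorem hasMFDerivAt_symm_comp (he : e ∈ IsManifold.maximalAtlas 𝓘(ℝ, E) ∞ M) {y : ℝ → E} {t : ℝ}
    (ht : y t ∈ e.target) (hy : HasDerivAt y (chartRep e W (y t)) t) :
    HasMFDerivAt 𝓘(ℝ, ℝ) 𝓘(ℝ, E) (fun s ↦ e.symm (y s)) t
      ((1 : ℝ →L[ℝ] ℝ).smulRight (W (e.symm (y t)))) := by
  have hd := mdifferentiable_of_mem_maximalAtlas he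
  have h1 := (hd.mdifferentiableAt_symm ht).hasMFDerivAt.comp t hy.hasFDerivAt.hasMFDerivAt
  refine HasMFDerivAt.congr_mfderiv h1 ?_
  have h2 := hd.symm_comp_deriv (e.map_target ht)
  rw [e.right_inv ht] at h2
  have h3 := congrArg (fun T ↦ T (W (e.symm (y t)))) h2
  refine ContinuousLinearMap.ext fun (r : ℝ) ↦ ?_
  exact (ContinuousLinearMap.map_smul (mfderiv 𝓘(ℝ, E) 𝓘(ℝ, E) e.symm (y t)) r
    (chartRep (E := E) e W (y t))).trans (congrArg (fun w ↦ r • w) h3)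

/-- Local existence holds for a time uniform near each point; compactness gives a common time `δ`,
and curves with a uniform existence time extend to the whole line. Since the charts map onto `E`, a
local solution in `E` stays in the target. -/
theorem exists_isMIntegralCurve_of_compactSpace [T2Space M] [CompactSpace M]
    (hcharts : ∀ q : M, ∃ e ∈ IsManifold.maximalAtlas 𝓘(ℝ, E) ∞ M, q ∈ e.source ∧
      e.target = univ) (hW : CMDiff ∞ (T% W)) (p : M) :
    ∃ γ : ℝ → M, γ 0 = p ∧ IsMIntegralCurve γ W := by
  have : IsManifold 𝓘(ℝ, E) 1 M := IsManifold.of_le (n := ∞) (by simp)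
  have loc : ∀ q : M, ∃ ε > 0, ∀ᶠ p in 𝓝 q, ∃ γ : ℝ → M, γ 0 = p ∧
      IsMIntegralCurveOn γ W (Ioo (-ε) ε) := by
    intro q
    obtain ⟨e, he, hq, ht⟩ := hcharts q
    have h1 := ((contDiffAt_chartRep he hq (hW q)).of_le (m := 1)
      (by simp)).exists_forall_mem_closedBall_exists_eq_forall_mem_Ioo_hasDerivAt 0
    obtain ⟨r, hr, ε, hε, h⟩ := h1
    refine ⟨ε, hε, ?_⟩
    filter_upwards [e.open_source.mem_nhds hq,
      (e.continuousAt hq).preimage_mem_nhds (Metric.closedBall_mem_nhds _ hr)] with p hp hpr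
    obtain ⟨y, hy0, hy⟩ := h (e p) hpr
    refine ⟨fun s ↦ e.symm (y s), by simp [hy0, e.left_inv hp], fun t hmem ↦ ?_⟩
    refine (hasMFDerivAt_symm_comp he (by simp [ht]) (hy t ?_)).hasMFDerivWithinAt
    simpa using hmem
  choose ε hε hloc using loc
  obtain ⟨s, hs⟩ := CompactSpace.elim_nhds_subcover _ hloc
  obtain ⟨δ, hδ, hδs⟩ : ∃ δ > 0, ∀ q ∈ s, δ ≤ ε q := by
    clear hs
    classical
    induction s using Finset.induction_on with
    | empty => exact ⟨1, one_pos, by simp⟩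
    | insert a s _ ih =>
      obtain ⟨δ, hδ, h⟩ := ih
      refine ⟨min δ (ε a), lt_min hδ (hε a), fun q hq ↦ ?_⟩
      rcases Finset.mem_insert.1 hq with rfl | hq
      · exact min_le_right _ _
      · exact (min_le_left _ _).trans (h q hq)
  refine exists_isMIntegralCurve_of_isMIntegralCurveOn (I := 𝓘(ℝ, E)) (v := W)
    (hW.of_le (by simp)) hδ (fun x ↦ ?_) p
  have hx : x ∈ ⋃ q ∈ s, {p | ∃ γ : ℝ → M, γ 0 = p ∧
      IsMIntegralCurveOn γ W (Ioo (-ε q) (ε q))} := by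
    exact hs.ge (mem_univ x)
  simp only [mem_iUnion, mem_ofPred_eq] at hx
  obtain ⟨q, hq, γ, hγ0, hγ⟩ := hx
  exact ⟨γ, hγ0, hγ.mono (Ioo_subset_Ioo (neg_le_neg (hδs q hq)) (hδs q hq))⟩

/-- Bootstrapping in a chart: the derivative of the curve is a smooth function of the curve, so each
order of differentiability gives the next. -/
theorem contMDiff_of_isMIntegralCurve (hW : CMDiff ∞ (T% W)) {γ : ℝ → M}
    (hγ : IsMIntegralCurve γ W) : ContMDiff 𝓘(ℝ, ℝ) 𝓘(ℝ, E) ∞ γ := by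
  intro t₀
  set e := chartAt E (γ t₀)
  have he : e ∈ IsManifold.maximalAtlas 𝓘(ℝ, E) ∞ M := IsManifold.chart_mem_maximalAtlas _
  set O := γ ⁻¹' e.source with hO
  have hOo : IsOpen O := e.open_source.preimage hγ.continuous
  have hy : ∀ t ∈ O, HasDerivAt (fun s ↦ e (γ s)) (chartRep e W (e (γ t))) t := fun t ht ↦ by
    rw [chartRep_apply ht]
    exact hasDerivAt_chart_comp he ht (hγ t)
  have hw : ContDiffOn ℝ ∞ (chartRep e W) e.target := fun x hx ↦ by
    have := contDiffAt_chartRep he (e.map_target hx) (hW _)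
    rw [e.right_inv hx] at this
    exact this.contDiffWithinAt
  have hsm : ∀ n : ℕ, ContDiffOn ℝ n (fun s ↦ e (γ s)) O := by
    intro n
    induction n with
    | zero => exact contDiffOn_zero.2 fun t ht ↦ (hy t ht).continuousAt.continuousWithinAt
    | succ n ih =>
      push_cast
      refine (contDiffOn_succ_iff_deriv_of_isOpen hOo).2
        ⟨fun t ht ↦ (hy t ht).differentiableAt.differentiableWithinAt, by simp, ?_⟩
      refine ContDiffOn.congr (f := fun t ↦ chartRep e W (e (γ t))) ?_ fun t ht ↦ (hy t ht).deriv
      exact (hw.of_le (by exact_mod_cast le_top)).comp ih fun t ht ↦ e.map_source ht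
  have h0 : t₀ ∈ O := mem_chart_source E (γ t₀)
  have h1 : ContDiffAt ℝ ∞ (fun s ↦ e (γ s)) t₀ :=
    (contDiffOn_infty.2 hsm).contDiffAt (hOo.mem_nhds h0)
  have h2 := (contMDiffAt_symm_of_mem_maximalAtlas he (e.map_source h0)).comp t₀ h1.contMDiffAt
  refine h2.congr_of_eventuallyEq ?_
  filter_upwards [hOo.mem_nhds h0] with t ht
  exact (e.left_inv ht).symm

end Flow

/-! ### Geodesics of a centroaffine connection -/

section Geodesic

set_option linter.unusedSectionVars false

open Set Filter

variable {E : Type*} [NormedAddCommGroup E] [NormedSpace ℝ E] [FiniteDimensional ℝ E]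
  {M : Type*} [TopologicalSpace M] [ChartedSpace E M] [IsManifold 𝓘(ℝ, E) ∞ M]
  {V : Type*} [NormedAddCommGroup V] [NormedSpace ℝ V]
  {cov : AffineConnection 𝓘(ℝ, E) M}
  {H : Π q : M, TangentSpace 𝓘(ℝ, E) q → TangentSpace 𝓘(ℝ, E) q → ℝ}

/-- The preferred trivialisation of the tangent bundle is the derivative of the preferred chart.
This relates `covAlong` to Christoffel symbols. -/
theorem chartDeriv_chartAt_eq_trivializationAt {q₀ q : M} (hq : q ∈ (chartAt E q₀).source)
    (v : TangentSpace 𝓘(ℝ, E) q) :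
    (trivializationAt E (fun x : M ↦ TangentSpace 𝓘(ℝ, E) x) q₀ ⟨q, v⟩).2 =
      chartDeriv (chartAt E q₀) q v := by
  have : IsManifold 𝓘(ℝ, E) 1 M := IsManifold.of_le (n := ∞) (by simp)
  have h1 := congrArg (fun T ↦ T v) (TangentBundle.continuousLinearMapAt_trivializationAt
    (I := 𝓘(ℝ, E)) (x₀ := q₀) (x := q) hq)
  refine Eq.trans ?_ h1
  rw [Bundle.Trivialization.continuousLinearMapAt_apply, Bundle.Trivialization.linearMapAt_apply,
    if_pos (by simpa using hq)]

theorem chartDeriv_trivializationAt_symm {q₀ q : M} (hq : q ∈ (chartAt E q₀).source) (a : E) :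
    chartDeriv (chartAt E q₀) q
      ((trivializationAt E (fun x : M ↦ TangentSpace 𝓘(ℝ, E) x) q₀).symm q a) = a := by
  have hq' : q ∈ (trivializationAt E (fun x : M ↦ TangentSpace 𝓘(ℝ, E) x) q₀).baseSet := by
    simpa using hq
  rw [← chartDeriv_chartAt_eq_trivializationAt hq,
    Bundle.Trivialization.apply_mk_symm _ hq']

/-- The extension of a vector has constant components in the preferred chart, so only the
Christoffel term survives. -/
theorem chartDeriv_cov_extend (cov : AffineConnection 𝓘(ℝ, E) M) {q : M}
    (u v : TangentSpace 𝓘(ℝ, E) q) :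
    chartDeriv (chartAt E q) q (cov (FiberBundle.extend E u) q v) =
      christoffel cov (chartAt E q) (chartAt E q q) (chartDeriv (chartAt E q) q u)
        (chartDeriv (chartAt E q) q v) := by
  set e := chartAt E q
  have he : e ∈ IsManifold.maximalAtlas 𝓘(ℝ, E) ∞ M := IsManifold.chart_mem_maximalAtlas _
  have hq : q ∈ e.source := mem_chart_source E q
  have h1 : chartRep e (FiberBundle.extend E u) =ᶠ[𝓝 (e q)] fun _ ↦ chartDeriv e q u := by
    filter_upwards [e.open_target.mem_nhds (e.map_source hq)] with x hx
    refine (chartDeriv_trivializationAt_symm (e.map_target hx) _).trans ?_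
    exact chartDeriv_chartAt_eq_trivializationAt hq u
  have h2 : DifferentiableAt ℝ (chartRep e (FiberBundle.extend E u)) (e q) :=
    h1.differentiableAt_iff.2 (differentiableAt_const _)
  rw [chartDeriv_cov he cov hq h2, h1.fderiv_eq, FiberBundle.extend_apply_self]
  simp

/-- The geodesic equation in the preferred chart. -/
theorem chartDeriv_covAlong_velocity (cov : AffineConnection 𝓘(ℝ, E) M) {γ : ℝ → M}
    (hγ : ContMDiff 𝓘(ℝ, ℝ) 𝓘(ℝ, E) ∞ γ) (t : ℝ) :
    chartDeriv (chartAt E (γ t)) (γ t) (covAlong cov γ (velocity 𝓘(ℝ, E) γ) t) =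
      deriv (deriv fun s ↦ chartAt E (γ t) (γ s)) t +
      christoffel cov (chartAt E (γ t)) (chartAt E (γ t) (γ t))
        (deriv (fun s ↦ chartAt E (γ t) (γ s)) t) (deriv (fun s ↦ chartAt E (γ t) (γ s)) t) := by
  set e := chartAt E (γ t)
  have he : e ∈ IsManifold.maximalAtlas 𝓘(ℝ, E) ∞ M := IsManifold.chart_mem_maximalAtlas _
  have hq : γ t ∈ e.source := mem_chart_source E (γ t)
  have hd : ∀ s, γ s ∈ e.source →
      deriv (fun s ↦ e (γ s)) s = chartDeriv e (γ s) (velocity 𝓘(ℝ, E) γ s) := by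
    intro s hs
    refine (hasDerivAt_chart_comp he hs ?_).deriv
    refine ((hγ s).mdifferentiableAt (by simp)).hasMFDerivAt.congr_mfderiv ?_
    refine ContinuousLinearMap.ext fun (r : ℝ) ↦ ?_
    have h := ContinuousLinearMap.map_smul (mfderiv 𝓘(ℝ, ℝ) 𝓘(ℝ, E) γ s) r (1 : ℝ)
    refine Eq.trans ?_ h
    exact congrArg (mfderiv 𝓘(ℝ, ℝ) 𝓘(ℝ, E) γ s) (mul_one r).symm
  have hev : (fun s ↦ (trivializationAt E (fun x : M ↦ TangentSpace 𝓘(ℝ, E) x) (γ t)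
      ⟨γ s, velocity 𝓘(ℝ, E) γ s⟩).2) =ᶠ[𝓝 t] deriv fun s ↦ e (γ s) := by
    filter_upwards [hγ.continuous.continuousAt.preimage_mem_nhds (e.open_source.mem_nhds hq)]
      with s hs
    rw [hd s hs]
    exact chartDeriv_chartAt_eq_trivializationAt hs _
  rw [covAlong, ContinuousLinearMap.map_add, hev.deriv_eq, hd t hq]
  congr 1
  · exact chartDeriv_trivializationAt_symm hq _
  · exact chartDeriv_cov_extend cov _ _

/-- A curve whose image under a centroaffine map has acceleration proportional to its position is a
geodesic. -/
theorem isGeodesic_of_deriv_deriv_eq (hc : IsCentroaffine cov H) {f : M → V}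
    (hf : ∀ q, IsCentroaffineMapAt cov H f q) {γ : ℝ → M}
    (hγ : ContMDiff 𝓘(ℝ, ℝ) 𝓘(ℝ, E) ∞ γ)
    (h : ∀ t, ∃ μ : ℝ, deriv (deriv fun s ↦ f (γ s)) t = μ • f (γ t)) : IsGeodesic cov γ := by
  refine ⟨hγ, fun t ↦ ?_⟩
  set e := chartAt E (γ t) with he_def
  have he : e ∈ IsManifold.maximalAtlas 𝓘(ℝ, E) ∞ M := IsManifold.chart_mem_maximalAtlas _
  have hq : γ t ∈ e.source := mem_chart_source E (γ t)
  obtain ⟨k, -, -, hH, -⟩ := hc e he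
  have hess := (hess_iff he hq (hf _).contMDiffAt (hH _ hq)).1 (hf _).hess
  set F : E → V := fun x ↦ f (e.symm x) with hF
  set y : ℝ → E := fun s ↦ e (γ s) with hy
  have hF2 : ContDiffAt ℝ 2 F (y t) :=
    (contDiffAt_comp_symm he hq (hf _).contMDiffAt).of_le two_le_infty
  have hys : ContDiffAt ℝ 2 y t :=
    (((contMDiffAt_of_mem_maximalAtlas he hq).comp t (hγ t)).contDiffAt).of_le two_le_infty
  have hcont : ∀ᶠ s in 𝓝 t, γ s ∈ e.source :=
    hγ.continuous.continuousAt.preimage_mem_nhds (e.open_source.mem_nhds hq)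
  have h1 : deriv (fun s ↦ f (γ s)) =ᶠ[𝓝 t] fun s ↦ fderiv ℝ F (y s) (deriv y s) := by
    filter_upwards [hcont.eventually_nhds, hys.eventually (by simp),
      hys.continuousAt.eventually (hF2.eventually (by simp))] with s h1 h2 h3
    have h4 : (fun s ↦ f (γ s)) =ᶠ[𝓝 s] fun s ↦ F (y s) := by
      filter_upwards [h1] with r hr
      simp only [hF, hy, e.left_inv hr]
    rw [h4.deriv_eq]
    exact ((h3.differentiableAt (by simp)).hasFDerivAt.comp_hasDerivAt s
      (h2.differentiableAt (by simp)).hasDerivAt).deriv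
  have hdF : HasFDerivAt (fderiv ℝ F) (fderiv ℝ (fderiv ℝ F) (y t)) (y t) :=
    ((hF2.fderiv_right (m := 1) (by norm_num)).differentiableAt (by simp)).hasFDerivAt
  have hdy : HasDerivAt y (deriv y t) t := (hys.differentiableAt (by simp)).hasDerivAt
  have hddy : HasDerivAt (deriv y) (deriv (deriv y) t) t := by
    have h2 := (hys.fderiv_right (m := 1) (by norm_num)).differentiableAt (by simp)
    have h3 : DifferentiableAt ℝ (deriv y) t := by
      have : deriv y = fun s ↦ fderiv ℝ y s 1 := by ext s; simp
      rw [this]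
      exact h2.clm_apply (differentiableAt_const _)
    exact h3.hasDerivAt
  -- By the chain rule and the Gauss formula, `(f ∘ γ)'' = DF(y'' + Γ(y', y')) - h(y', y') F`.
  have h2 := ((hdF.comp_hasDerivAt t hdy).clm_apply hddy).deriv
  obtain ⟨μ, hμ⟩ := h t
  rw [h1.deriv_eq] at hμ
  have hμ' := h2.symm.trans hμ
  rw [show (fderiv ℝ (fderiv ℝ F) (y t)) (deriv y t) (deriv y t) = _ from hess _ _] at hμ'
  have hinj := (hf (γ t)).bijective.1
  apply chartDeriv_injective he hq
  rw [map_zero, chartDeriv_covAlong_velocity cov hγ]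
  have hFq : F (e (γ t)) = f (γ t) := by simp only [hF, e.left_inv hq]
  -- Comparison with `μ F` is a linear relation between a tangential vector and the position vector;
  -- as the frame is injective, the tangential part `y'' + Γ(y', y')` vanishes.
  have hsum : mvfderiv 𝓘(ℝ, E) f (γ t) (chartInv e (γ t) (deriv (deriv y) t +
      christoffel cov e (e (γ t)) (deriv y t) (deriv y t))) +
      (-(k (e (γ t)) (deriv y t) (deriv y t)) - μ) • f (γ t) = 0 := by
    rw [mvfderiv_eq_fderiv he hq (hF2.differentiableAt (by simp)), chartDeriv_chartInv he hq,
      ContinuousLinearMap.map_add]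
    rw [hFq] at hμ'
    rw [← sub_eq_zero] at hμ'
    rw [← hμ']
    simp only [hy, Function.comp_apply]
    module
  have h3 := @hinj (chartInv e (γ t) (deriv (deriv y) t +
      christoffel cov e (e (γ t)) (deriv y t) (deriv y t)),
      (-(k (e (γ t)) (deriv y t) (deriv y t)) - μ)) (0, 0) (hsum.trans (by simp))
  have h4 := congrArg (fun w ↦ chartDeriv e (γ t) w.1) h3
  simp only [chartDeriv_chartInv he hq, map_zero] at h4
  exact h4

end Geodesic

/-! ### Completeness of a centroaffine connection -/

section Completeness

set_option linter.unusedSectionVars false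

open Set Filter

variable {E : Type*} [NormedAddCommGroup E] [NormedSpace ℝ E] [FiniteDimensional ℝ E]
  {M : Type*} [TopologicalSpace M] [ChartedSpace E M] [IsManifold 𝓘(ℝ, E) ∞ M]
  {V : Type*} [NormedAddCommGroup V] [NormedSpace ℝ V] [FiniteDimensional ℝ V]
  {cov : AffineConnection 𝓘(ℝ, E) M}
  {H : Π q : M, TangentSpace 𝓘(ℝ, E) q → TangentSpace 𝓘(ℝ, E) q → ℝ}

theorem contDiffAt_frame {F : E → V} {x : E} (hF : ContDiffAt ℝ ∞ F x) :
    ContDiffAt ℝ ∞ (frame F) x := by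
  have h1 : ContDiffAt ℝ ∞ (fderiv ℝ F) x := hF.fderiv_right (by simp)
  exact (((ContinuousLinearMap.compL ℝ (E × ℝ) E V).flip (.fst ℝ E ℝ)).contDiff.contDiffAt.comp x
    h1).add ((ContinuousLinearMap.smulRightL ℝ (E × ℝ) V (.snd ℝ E ℝ)).contDiff.contDiffAt.comp x hF)

/-- A smooth field `X` along a centroaffine map decomposes into a smooth vector field and a
continuous multiple of the position vector. -/
theorem exists_tangential_part {f : M → V} (hf : ∀ q, IsCentroaffineMapAt cov H f q) {X : V → V}
    (hX : ∀ q, ContDiffAt ℝ ∞ X (f q)) :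
    ∃ (W : Π q : M, TangentSpace 𝓘(ℝ, E) q) (s : M → ℝ), CMDiff ∞ (T% W) ∧ Continuous s ∧
      ∀ q, mvfderiv 𝓘(ℝ, E) f q (W q) + s q • f q = X (f q) := by
  choose w hw using fun q ↦ (hf q).bijective.2 (X (f q))
  suffices key : ∀ q, CMDiffAt ∞ (T% (fun q ↦ (w q).1)) q ∧ ContinuousAt (fun q ↦ (w q).2) q from
    ⟨fun q ↦ (w q).1, fun q ↦ (w q).2, fun q ↦ (key q).1,
      continuous_iff_continuousAt.2 fun q ↦ (key q).2, hw⟩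
  intro q
  set e := chartAt E q
  have he : e ∈ IsManifold.maximalAtlas 𝓘(ℝ, E) ∞ M := IsManifold.chart_mem_maximalAtlas _
  have hq : q ∈ e.source := mem_chart_source E q
  set F : E → V := fun x ↦ f (e.symm x) with hF
  have hLa : ∀ p ∈ e.source, ∀ u : TangentSpace 𝓘(ℝ, E) p × ℝ,
      frame F (e p) (chartDeriv e p u.1, u.2) = mvfderiv 𝓘(ℝ, E) f p u.1 + u.2 • f p := by
    intro p hp u
    rw [frame_apply, mvfderiv_eq_fderiv he hp
      ((contDiffAt_comp_symm he hp (hf p).contMDiffAt).differentiableAt (by simp))]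
    simp only [hF, e.left_inv hp]
  have hbij : ∀ p ∈ e.source, Function.Bijective (frame F (e p)) := by
    intro p hp
    have h1 : Function.Bijective fun u : TangentSpace 𝓘(ℝ, E) p × ℝ ↦ (chartDeriv e p u.1, u.2) :=
      Function.Bijective.prodMap (chartDerivEquiv he hp).bijective Function.bijective_id
    refine (Function.Bijective.of_comp_iff _ h1).1 ?_
    refine (congrArg Function.Bijective (funext fun u ↦ hLa p hp u)).mpr (hf p).bijective
  have hinv : ∀ p ∈ e.source, (frame F (e p)).IsInvertible := fun p hp ↦
    ⟨(LinearEquiv.ofBijective (frame F (e p)).toLinearMap (hbij p hp)).toContinuousLinearEquiv, rfl⟩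
  -- In a chart the decomposition is obtained by applying the inverse frame to `X`; inversion of
  -- linear maps is smooth, so both parts are.
  set g : E → E × ℝ := fun x ↦ (frame F x).inverse (X (F x)) with hg_def
  have hFq := contDiffAt_comp_symm he hq (hf q).contMDiffAt
  have hg : ContDiffAt ℝ ∞ g (e q) := by
    refine ContDiffAt.clm_apply ?_ ?_
    · exact ContDiffAt.comp (e q) (hinv q hq).contDiffAt_map_inverse (contDiffAt_frame hFq)
    · refine ContDiffAt.comp (e q) ?_ hFq
      have h1 : F (e q) = f q := by simp only [hF, e.left_inv hq]
      rw [h1]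
      exact hX q
  have hgw : ∀ p ∈ e.source, g (e p) = (chartDeriv e p (w p).1, (w p).2) := by
    intro p hp
    have h1 : X (F (e p)) = frame F (e p) (chartDeriv e p (w p).1, (w p).2) := by
      have h2 : F (e p) = f p := by simp only [hF, e.left_inv hp]
      rw [hLa p hp, h2]
      exact (hw p).symm
    rw [hg_def]
    simp only [h1]
    exact (hinv p hp).inverse_apply_self _
  have hsrc := e.open_source.mem_nhds hq
  constructor
  · refine (contMDiffAt_chartField he hq hg.fst).congr_of_eventuallyEq ?_
    filter_upwards [hsrc] with p hp
    have h1 : chartField e (fun x ↦ (g x).1) p = (w p).1 := by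
      simp only [chartField, hgw p hp]
      exact chartInv_chartDeriv he hp _
    simp only [h1]
  · have h1 : ContinuousAt (fun p ↦ (g (e p)).2) q :=
      (hg.continuousAt.comp (e.continuousAt hq)).snd
    refine h1.congr ?_
    filter_upwards [hsrc] with p hp
    rw [hgw p hp]

/-- A plane curve `c` with `det(c, c') = 1` has acceleration proportional to its position. -/
theorem deriv_deriv_eq_smul {c : ℝ → V} (hc : ContDiff ℝ ∞ c) {ξ η : V →L[ℝ] ℝ} {e₁ e₂ : V}
    (hplane : ∀ t, c t = ξ (c t) • e₁ + η (c t) • e₂)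
    (hdet : ∀ t, ξ (c t) * η (deriv c t) - η (c t) * ξ (deriv c t) = 1) (t : ℝ) :
    ∃ μ : ℝ, deriv (deriv c) t = μ • c t := by
  have hc2 : ContDiff ℝ 2 c := hc.of_le two_le_infty
  have h1 : ∀ t, HasDerivAt c (deriv c t) t := fun t ↦
    (hc2.differentiable (by simp) t).hasDerivAt
  have hdc : ContDiff ℝ 1 (deriv c) :=
    (contDiff_succ_iff_deriv (n := 1).1 hc2).2.2
  have h2 : ∀ t, HasDerivAt (deriv c) (deriv (deriv c) t) t := fun t ↦
    (hdc.differentiable (by simp) t).hasDerivAt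
  have hl : ∀ (ζ : V →L[ℝ] ℝ) (t : ℝ), HasDerivAt (fun t ↦ ζ (c t)) (ζ (deriv c t)) t :=
    fun ζ t ↦ ζ.hasFDerivAt.comp_hasDerivAt t (h1 t)
  have hl' : ∀ (ζ : V →L[ℝ] ℝ) (t : ℝ),
      HasDerivAt (fun t ↦ ζ (deriv c t)) (ζ (deriv (deriv c) t)) t :=
    fun ζ t ↦ ζ.hasFDerivAt.comp_hasDerivAt t (h2 t)
  -- The linear map `r` kills the curve, hence also its derivatives, so the acceleration remains in
  -- the plane.
  have hp2 : deriv (deriv c) t = ξ (deriv (deriv c) t) • e₁ + η (deriv (deriv c) t) • e₂ := by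
    let r : V →L[ℝ] V := .id ℝ V - (ξ.smulRight e₁ + η.smulRight e₂)
    have hr : ∀ u, r u = u - (ξ u • e₁ + η u • e₂) := fun u ↦ rfl
    have hr0 : ∀ t, r (c t) = 0 := fun t ↦ sub_eq_zero.2 (hplane t)
    have hr1 : ∀ t, r (deriv c t) = 0 := fun t ↦ by
      have h3 := r.hasFDerivAt.comp_hasDerivAt t (h1 t)
      rw [show r ∘ c = fun _ ↦ 0 from funext hr0] at h3
      exact h3.unique (hasDerivAt_const t 0)
    have h3 := r.hasFDerivAt.comp_hasDerivAt t (h2 t)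
    rw [show r ∘ deriv c = fun _ ↦ 0 from funext hr1] at h3
    exact sub_eq_zero.1 (h3.unique (hasDerivAt_const t 0))
  -- The derivative of `det(c, c') = 1`.
  have hd : ξ (c t) * η (deriv (deriv c) t) - η (c t) * ξ (deriv (deriv c) t) = 0 := by
    have h3 := ((hl ξ t).mul (hl' η t)).sub ((hl η t).mul (hl' ξ t))
    have h4 : (fun t ↦ ξ (c t) * η (deriv c t) - η (c t) * ξ (deriv c t)) = fun _ ↦ (1 : ℝ) :=
      funext hdet
    have h5 : HasDerivAt (fun t ↦ ξ (c t) * η (deriv c t) - η (c t) * ξ (deriv c t)) _ t := h3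
    rw [h4] at h5
    have := h5.unique (hasDerivAt_const t (1 : ℝ))
    linear_combination this
  have hρ : ξ (c t) ^ 2 + η (c t) ^ 2 ≠ 0 := by
    intro h
    have hx : ξ (c t) = 0 := by nlinarith [sq_nonneg (ξ (c t)), sq_nonneg (η (c t))]
    have hy : η (c t) = 0 := by nlinarith [sq_nonneg (ξ (c t)), sq_nonneg (η (c t))]
    simpa [hx, hy] using hdet t
  -- A vector of the plane parallel to a nonzero one is a multiple of it; the factor is the
  -- coefficient of the orthogonal projection in the coordinates `(ξ, η)`.
  have key : ∀ a b a' b' : ℝ, a * b' - b * a' = 0 → a ^ 2 + b ^ 2 ≠ 0 →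
      a' • e₁ + b' • e₂ = ((a * a' + b * b') / (a ^ 2 + b ^ 2)) • (a • e₁ + b • e₂) := by
    intro a b a' b' h h'
    rw [smul_add, smul_smul, smul_smul]
    congr 2
    · field_simp
      linear_combination -b * h
    · field_simp
      linear_combination a * h
  exact ⟨_, hp2.trans ((key _ _ _ _ hd hρ).trans (congrArg _ (hplane t).symm))⟩

/-- A centroaffine connection on a compact manifold that admits a global centroaffine map is
complete. -/
theorem geodesicallyComplete_of_isCentroaffineMapAt [T2Space M] [CompactSpace M]
    (hcharts : ∀ q : M, ∃ e ∈ IsManifold.maximalAtlas 𝓘(ℝ, E) ∞ M, q ∈ e.source ∧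
      e.target = univ) (hc : IsCentroaffine cov H) {f : M → V}
    (hf : ∀ q, IsCentroaffineMapAt cov H f q) : GeodesicallyComplete cov := by
  rintro ⟨p, v⟩
  -- For `v = 0` there is no plane to work in; the geodesic is constant.
  by_cases hv : v = 0
  · refine ⟨fun _ ↦ p, isGeodesic_of_deriv_deriv_eq hc hf contMDiff_const fun t ↦ ⟨0, by simp⟩, ?_⟩
    rw [hv]
    congr 1
    rw [velocity, mfderiv_const]
    rfl
  have : FiniteDimensional ℝ (TangentSpace 𝓘(ℝ, E) p) := inferInstanceAs (FiniteDimensional ℝ E)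
  have hfinj : ∀ {q : M} {u u' : TangentSpace 𝓘(ℝ, E) q} {r r' : ℝ},
      mvfderiv 𝓘(ℝ, E) f q u + r • f q = mvfderiv 𝓘(ℝ, E) f q u' + r' • f q → u = u' ∧ r = r' := by
    intro q u u' r r' h
    have := @(hf q).bijective.1 (u, r) (u', r') h
    exact Prod.ext_iff.1 this
  have hf0 : ∀ q, f q ≠ 0 := fun q h0 ↦ by
    have := (hfinj (q := q) (u := 0) (u' := 0) (r := 0) (r' := 1) (by simp [h0])).2
    simp at this
  -- Linear forms that restrict to coordinates on the plane spanned by `f(p)` and `df(v)`. They come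
  -- from inverting the frame at `p`, with a linear form `ζ` satisfying `ζ(v) = 1`.
  obtain ⟨ξ, η, hξ₁, hξ₂, hη₁, hη₂⟩ : ∃ ξ η : V →L[ℝ] ℝ, ξ (f p) = 1 ∧
      ξ (mvfderiv 𝓘(ℝ, E) f p v) = 0 ∧ η (f p) = 0 ∧ η (mvfderiv 𝓘(ℝ, E) f p v) = 1 := by
    let Φ : TangentSpace 𝓘(ℝ, E) p × ℝ →ₗ[ℝ] V :=
      (mvfderiv 𝓘(ℝ, E) f p).toLinearMap.coprod (LinearMap.toSpanSingleton ℝ V (f p))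
    let Ψ := (LinearEquiv.ofBijective Φ (hf p).bijective).symm
    have hΨ : ∀ w, Ψ (Φ w) = w := fun w ↦
      LinearEquiv.symm_apply_apply (LinearEquiv.ofBijective Φ (hf p).bijective) w
    have h1 : Ψ (f p) = (0, 1) := by
      rw [← hΨ (0, 1)]; congr 1; simp [Φ]
    have h2 : Ψ (mvfderiv 𝓘(ℝ, E) f p v) = (v, 0) := by
      rw [← hΨ (v, 0)]; congr 1; simp [Φ]
    obtain ⟨ζ, hζ⟩ := Module.Projective.exists_dual_eq_one ℝ hv
    refine ⟨LinearMap.toContinuousLinearMap (LinearMap.snd ℝ _ ℝ ∘ₗ Ψ.toLinearMap),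
      LinearMap.toContinuousLinearMap (ζ ∘ₗ LinearMap.fst ℝ _ ℝ ∘ₗ Ψ.toLinearMap), ?_, ?_, ?_, ?_⟩
    · simp [h1]
    · simp [h2]
    · simp [h1]
    · simp [h2, hζ]
  generalize he₁ : f p = e₁ at *
  generalize he₂ : mvfderiv 𝓘(ℝ, E) f p v = e₂ at *
  -- `J` rotates the plane by a right angle, sending `e₁` to `e₂` and `e₂` to `-e₁`; `r` is the
  -- projection along the plane onto the common kernel of `ξ` and `η`.
  let J : V →L[ℝ] V := ξ.smulRight e₂ - η.smulRight e₁
  let r : V →L[ℝ] V := .id ℝ V - (ξ.smulRight e₁ + η.smulRight e₂)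
  have hJ : ∀ u, J u = ξ u • e₂ - η u • e₁ := fun u ↦ rfl
  have hr : ∀ u, r u = u - (ξ u • e₁ + η u • e₂) := fun u ↦ rfl
  -- On the plane this is `ξ² + η²`. The last term keeps it nonzero at all other values of `f`, and
  -- a Euclidean norm is used because the norm of `V` need not be smooth.
  let N : V → ℝ := fun u ↦ ξ u ^ 2 + η u ^ 2 + ‖toEuclidean (r u)‖ ^ 2
  have hN : ContDiff ℝ ∞ N :=
    ((ξ.contDiff.pow 2).add (η.contDiff.pow 2)).add
      (((toEuclidean (E := V)).contDiff.comp r.contDiff).norm_sq ℝ)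
  have hN0 : ∀ u, u ≠ 0 → N u ≠ 0 := by
    intro u hu h
    have h1 : ξ u = 0 := by
      nlinarith [sq_nonneg (ξ u), sq_nonneg (η u), sq_nonneg ‖toEuclidean (r u)‖]
    have h2 : η u = 0 := by
      nlinarith [sq_nonneg (ξ u), sq_nonneg (η u), sq_nonneg ‖toEuclidean (r u)‖]
    have h3 : ‖toEuclidean (r u)‖ = 0 := by
      nlinarith [sq_nonneg (ξ u), sq_nonneg (η u), sq_nonneg ‖toEuclidean (r u)‖]
    rw [norm_eq_zero, map_eq_zero_iff _ (toEuclidean (E := V)).injective, hr, h1, h2] at h3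
    exact hu (by simpa using h3)
  -- The image `c` of an integral curve of `W` satisfies `c' = J c / N(c) - s c`. The multiple of
  -- `c` does not contribute to `det(c, c')`, and `N` is chosen so that the other term contributes
  -- `1`.
  obtain ⟨W, s, hW, hs, hWs⟩ := exists_tangential_part hf (X := fun u ↦ (N u)⁻¹ • J u) fun q ↦
    (hN.contDiffAt.inv (hN0 _ (hf0 q))).smul J.contDiff.contDiffAt
  obtain ⟨γ, hγ0, hγ⟩ := exists_isMIntegralCurve_of_compactSpace hcharts hW p
  have hγs := contMDiff_of_isMIntegralCurve hW hγ
  have hcs : ContDiff ℝ ∞ fun t ↦ f (γ t) := by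
    refine ContMDiff.contDiff fun t ↦ ?_
    exact ContMDiffAt.comp t (hf (γ t)).contMDiffAt (hγs t)
  have hcd : ∀ t, HasDerivAt (fun t ↦ f (γ t))
      ((N (f (γ t)))⁻¹ • J (f (γ t)) - s (γ t) • f (γ t)) t := by
    intro t
    have h1 := ((hf (γ t)).contMDiffAt.mdifferentiableAt (by simp)).hasMFDerivAt.comp t (hγ t)
    have h2 := hasMFDerivAt_iff_hasFDerivAt.1 h1
    have h3 : HasFDerivAt (fun t ↦ f (γ t))
        ((1 : ℝ →L[ℝ] ℝ).smulRight (mvfderiv 𝓘(ℝ, E) f (γ t) (W (γ t)))) t := by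
      refine HasFDerivAt.congr_fderiv h2 ?_
      ext
      change mvfderiv 𝓘(ℝ, E) f (γ t) ((1 : ℝ) • W (γ t)) =
        (1 : ℝ) • mvfderiv 𝓘(ℝ, E) f (γ t) (W (γ t))
      simp
    have h4 := h3.hasDerivAt
    rw [eq_sub_of_add_eq (hWs (γ t))] at h4
    simpa using h4
  have hrJ : ∀ u, r (J u) = 0 := fun u ↦ by
    simp only [hr, hJ, map_sub, map_smul, hξ₁, hξ₂, hη₁, hη₂, smul_eq_mul]
    module
  -- The image stays in the plane: as `r J = 0`, the component `r c` solves the homogeneous equation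
  -- `y' = -s y` with initial value zero.
  have hr0 : ∀ t, r (f (γ t)) = 0 := by
    have h1 : ∀ t, HasDerivAt (fun t ↦ r (f (γ t))) (-s (γ t) • r (f (γ t))) t := fun t ↦ by
      have h2 := r.hasFDerivAt.comp_hasDerivAt t (hcd t)
      rw [map_sub, map_smul, map_smul, hrJ, smul_zero, zero_sub, ← neg_smul] at h2
      exact h2
    refine fun t ↦ eqOn_zero_of_norm_fderiv_le (k := fun t ↦ ‖s (γ t)‖) isOpen_univ
      isPreconnected_univ (fun t _ ↦ (h1 t).hasFDerivAt) ?_ (fun t _ ↦ ?_) (mem_univ 0) ?_ t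
      (mem_univ t)
    · exact (hs.comp hγ.continuous).norm.continuousOn
    · rw [ContinuousLinearMap.norm_toSpanSingleton, norm_smul, norm_neg]
    · rw [hγ0, he₁, hr, hξ₁, hη₁]
      simp
  have hplane : ∀ t, f (γ t) = ξ (f (γ t)) • e₁ + η (f (γ t)) • e₂ := fun t ↦
    sub_eq_zero.1 (hr0 t)
  have hdet : ∀ t, ξ (f (γ t)) * η (deriv (fun t ↦ f (γ t)) t) -
      η (f (γ t)) * ξ (deriv (fun t ↦ f (γ t)) t) = 1 := by
    intro t
    have h1 : N (f (γ t)) = ξ (f (γ t)) ^ 2 + η (f (γ t)) ^ 2 := by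
      simp only [N, hr0 t, map_zero, norm_zero]
      ring
    have h2 := hN0 _ (hf0 (γ t))
    rw [(hcd t).deriv]
    simp only [hJ, map_sub, map_smul, hξ₁, hξ₂, hη₁, hη₂, smul_eq_mul]
    rw [h1] at h2 ⊢
    field_simp
    ring
  refine ⟨γ, isGeodesic_of_deriv_deriv_eq hc hf hγs (deriv_deriv_eq_smul hcs hplane hdet), ?_⟩
  -- At `p` one has `N = 1` and `J e₁ = e₂ = df(v)`, which is already tangential.
  have hWp : W p = v := by
    have h1 := hWs p
    have h2 : N (f p) = 1 := by
      rw [← hγ0]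
      simp only [N, hr0 0, map_zero, norm_zero]
      rw [hγ0, he₁, hξ₁, hη₁]
      norm_num
    rw [h2, hJ, he₁, hξ₁, hη₁] at h1
    refine (hfinj (r := s p) (r' := 0) ?_).1
    rw [he₁, h1, he₂]
    simp
  have hvel : ∀ t, velocity 𝓘(ℝ, E) γ t = W (γ t) := fun t ↦ by
    rw [velocity, (hγ t).mfderiv]
    exact one_smul ℝ (W (γ t))
  rw [hvel]
  exact (congrArg (fun q ↦ (⟨q, W q⟩ : TangentBundle 𝓘(ℝ, E) M)) hγ0).trans (by rw [hWp])

end Completeness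

/-! ### Dual connections in coordinates -/

section DualAlgebra

set_option linter.unusedSectionVars false

open Set Filter

variable {E : Type*} [NormedAddCommGroup E] [NormedSpace ℝ E] [FiniteDimensional ℝ E]

theorem fderiv_bilin_apply {B : E → E →L[ℝ] E →L[ℝ] ℝ} {u w : E → E} {x : E}
    (hB : DifferentiableAt ℝ B x) (hu : DifferentiableAt ℝ u x) (hw : DifferentiableAt ℝ w x)
    (a : E) : fderiv ℝ (fun y ↦ B y (u y) (w y)) x a =
      fderiv ℝ B x a (u x) (w x) + B x (fderiv ℝ u x a) (w x) + B x (u x) (fderiv ℝ w x a) := by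
  have h := (hB.hasFDerivAt.clm_apply hu.hasFDerivAt).clm_apply hw.hasFDerivAt
  rw [h.fderiv]
  simp only [add_apply, ContinuousLinearMap.comp_apply, ContinuousLinearMap.flip_apply]
  ring

/-- The curvature tensors of two dual connections. -/
theorem metric_riem_add {G : E → E →L[ℝ] E →L[ℝ] ℝ} {Γ Γ' : E → E →L[ℝ] E →L[ℝ] E} {x : E}
    (hG : ContDiffAt ℝ 2 G x) (hΓ : DifferentiableAt ℝ Γ x) (hΓ' : DifferentiableAt ℝ Γ' x)
    (hmet : ∀ᶠ y in 𝓝 x, ∀ c a b, fderiv ℝ G y c a b = G y (Γ y a c) b + G y a (Γ' y b c))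
    (a b c d : E) : G x (riem Γ x a b c) d + G x c (riem Γ' x a b d) = 0 := by
  have hGd : DifferentiableAt ℝ G x := hG.differentiableAt (by simp)
  have hφ : ContDiffAt ℝ 2 (fun y ↦ G y c d) x :=
    (hG.clm_apply contDiffAt_const).clm_apply contDiffAt_const
  have hdd : DifferentiableAt ℝ (fderiv ℝ fun y ↦ G y c d) x :=
    (hφ.fderiv_right (m := 1) (by norm_num)).differentiableAt (by simp)
  have hap : ∀ {T : E → E →L[ℝ] E →L[ℝ] E}, DifferentiableAt ℝ T x → ∀ u v,
      DifferentiableAt ℝ (fun y ↦ T y u v) x := fun hT u v ↦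
    (hasFDerivAt_apply_const (hasFDerivAt_apply_const hT.hasFDerivAt u) v).differentiableAt
  have hm := hmet.self_of_nhds
  -- Second derivatives of `G(c, d)` computed by applying the duality relation twice; their symmetry
  -- in `a` and `b` is the asserted identity.
  have h2 : ∀ a b, fderiv ℝ (fderiv ℝ fun y ↦ G y c d) x a b =
      (G x (Γ x (Γ x c b) a) d + G x (Γ x c b) (Γ' x d a) + G x (fderiv ℝ Γ x a c b) d) +
      (G x (Γ x c a) (Γ' x d b) + G x c (Γ' x (Γ' x d b) a) + G x c (fderiv ℝ Γ' x a d b)) := by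
    intro a b
    have h3 : fderiv ℝ (fderiv ℝ fun y ↦ G y c d) x a b =
        fderiv ℝ (fun y ↦ fderiv ℝ (fun y ↦ G y c d) y b) x a := by
      rw [(hasFDerivAt_apply_const hdd.hasFDerivAt b).fderiv]; rfl
    have h4 : (fun y ↦ fderiv ℝ (fun y ↦ G y c d) y b) =ᶠ[𝓝 x]
        fun y ↦ G y (Γ y c b) d + G y c (Γ' y d b) := by
      filter_upwards [hmet, hG.eventually (by simp)] with y hy hGy
      rw [← fderiv_clm_apply_two (hGy.differentiableAt (by simp)), hy]
    have hu := hap hΓ c b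
    have hw := hap hΓ' d b
    have h5 := ((hGd.clm_apply hu).clm_apply (differentiableAt_const d)).hasFDerivAt
    have h6 := ((hGd.clm_apply (differentiableAt_const c)).clm_apply hw).hasFDerivAt
    rw [h3, h4.fderiv_eq, (h5.fun_add h6).fderiv, add_apply,
      fderiv_bilin_apply hGd hu (differentiableAt_const d),
      fderiv_bilin_apply hGd (differentiableAt_const c) hw, hm, hm,
      fderiv_clm_apply_two hΓ, fderiv_clm_apply_two hΓ']
    simp
  have hs : fderiv ℝ (fderiv ℝ fun y ↦ G y c d) x a b =
      fderiv ℝ (fderiv ℝ fun y ↦ G y c d) x b a := (hφ.isSymmSndFDerivAt (by simp)).eq a b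
  rw [h2, h2] at hs
  simp only [riem, ContinuousLinearMap.map_add, ContinuousLinearMap.map_sub, add_apply, sub_apply]
  linear_combination hs

theorem riem_swap (Γ : E → E →L[ℝ] E →L[ℝ] E) (x a b c : E) :
    riem Γ x a b c = -riem Γ x b a c := by
  simp only [riem]; abel

/-- The first Bianchi identity: symmetry of `Γ` near `x` also gives symmetry of its derivative, and
all terms cancel in pairs. -/
theorem riem_bianchi {Γ : E → E →L[ℝ] E →L[ℝ] E} {x : E} (hΓ : DifferentiableAt ℝ Γ x)
    (hsymm : ∀ᶠ y in 𝓝 x, ∀ a b, Γ y a b = Γ y b a) (a b c : E) :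
    riem Γ x a b c + riem Γ x b c a + riem Γ x c a b = 0 := by
  have h1 : ∀ a b c, fderiv ℝ Γ x a b c = fderiv ℝ Γ x a c b := fun a b c ↦ by
    rw [fderiv_clm_apply_two hΓ, fderiv_clm_apply_two hΓ]
    have : (fun y ↦ Γ y b c) =ᶠ[𝓝 x] fun y ↦ Γ y c b := hsymm.mono fun y hy ↦ hy b c
    rw [this.fderiv_eq]
  have h2 := hsymm.self_of_nhds
  simp only [riem]
  rw [h1 a c b, h1 b a c, h1 c b a, h2 c b, h2 a c, h2 b a]
  abel

/-- The form `G` identifies `E` with its dual and turns `T` into minus its transpose, so the trace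
of `T` equals its own negative. -/
theorem trace_eq_zero_of_skew {G : E →L[ℝ] E →L[ℝ] ℝ} (hG : ∀ v, (∀ w, G v w = 0) → v = 0)
    {T : E →ₗ[ℝ] E} (hT : ∀ c d, G (T c) d = -G c (T d)) : LinearMap.trace ℝ E T = 0 := by
  let B : E →ₗ[ℝ] Module.Dual ℝ E :=
    { toFun := fun v ↦ (G v).toLinearMap
      map_add' := fun v w ↦ by ext; simp
      map_smul' := fun t v ↦ by ext; simp }
  have hB : Function.Injective B := by
    rw [injective_iff_map_eq_zero]
    exact fun v hv ↦ hG v fun w ↦ congrArg (fun φ : Module.Dual ℝ E ↦ φ w) hv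
  let e : E ≃ₗ[ℝ] Module.Dual ℝ E :=
    LinearEquiv.ofInjectiveOfFinrankEq B hB Subspace.dual_finrank_eq.symm
  have he : ∀ v w, e v w = G v w := fun v w ↦ rfl
  have h1 : e.conj T = -Module.Dual.transpose (R := ℝ) T := by
    refine LinearMap.ext fun φ ↦ LinearMap.ext fun w ↦ ?_
    obtain ⟨v, rfl⟩ := e.surjective φ
    rw [LinearEquiv.conj_apply_apply, e.symm_apply_apply, he, hT]
    rfl
  have h2 := LinearMap.trace_conj' T e
  have h3 := LinearMap.map_neg (LinearMap.trace ℝ (Module.Dual ℝ E))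
    (Module.Dual.transpose (R := ℝ) T)
  have h4 := LinearMap.trace_transpose' (R := ℝ) T
  rw [h1] at h2
  linarith

/-- By the Bianchi identity `Ric(b, c) - Ric(c, b) = -tr R(b, c)`, and `R(b, c)` is skew. -/
theorem ricciForm_symm_of_skew {G : E →L[ℝ] E →L[ℝ] ℝ} (hG : ∀ v, (∀ w, G v w = 0) → v = 0)
    {Γ : E → E →L[ℝ] E →L[ℝ] E} {x : E} (hΓ : DifferentiableAt ℝ Γ x)
    (hsymm : ∀ᶠ y in 𝓝 x, ∀ a b, Γ y a b = Γ y b a)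
    (hskew : ∀ a b c d, G (riem Γ x a b c) d = -G c (riem Γ x a b d)) (b c : E) :
    ricciForm Γ x b c = ricciForm Γ x c b := by
  let T : E →ₗ[ℝ] E :=
    { toFun := fun a ↦ riem Γ x b c a
      map_add' := fun a a' ↦ riem_add_right Γ x b c a a'
      map_smul' := fun t a ↦ riem_smul_right Γ x t b c a }
  have h1 : riemEnd Γ x b c - riemEnd Γ x c b = -T := by
    ext a
    have h2 := riem_bianchi hΓ hsymm a b c
    rw [riem_swap Γ x c a b] at h2
    change riem Γ x a b c - riem Γ x a c b = -riem Γ x b c a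
    rw [← sub_eq_zero, ← h2]
    abel
  have h3 := congrArg (LinearMap.trace ℝ E) h1
  rw [map_sub, map_neg, trace_eq_zero_of_skew hG (T := T) fun a d ↦ hskew b c a d, neg_zero,
    sub_eq_zero] at h3
  exact h3

/-- A form `h` for which `h(b, ·) a - h(a, ·) b` is skew is a multiple of the metric. -/
theorem exists_eq_mul_of_skew {G h : E →L[ℝ] E →L[ℝ] ℝ} (hG : ∀ a b, G a b = G b a)
    (hpos : ∀ a, a ≠ 0 → 0 < G a a) (hh : ∀ a b, h a b = h b a)
    (hskew : ∀ a b c, h b c * G a c = h a c * G b c) : ∃ μ : ℝ, ∀ a b, h a b = μ * G a b := by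
  by_cases hE : ∃ c₀ : E, c₀ ≠ 0
  swap
  · push Not at hE
    exact ⟨0, fun a b ↦ by simp [hE a]⟩
  obtain ⟨c₀, hc₀⟩ := hE
  -- Setting `a = c` makes `h(·, c)` a multiple of `G(·, c)`; it remains to show that the factor
  -- does not depend on `c`.
  have h1 : ∀ c, c ≠ 0 → ∀ b, h b c = h c c / G c c * G b c := fun c hc b ↦ by
    have := hskew c b c
    have h2 := (hpos c hc).ne'
    field_simp
    linarith
  have h2 : ∀ c d, c ≠ 0 → d ≠ 0 → G c d ≠ 0 → h c c / G c c = h d d / G d d := by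
    intro c d hc hd hcd
    have h3 := h1 c hc d
    rw [hh d c, h1 d hd c, hG d c] at h3
    exact (mul_right_cancel₀ hcd h3).symm
  refine ⟨h c₀ c₀ / G c₀ c₀, fun a c ↦ ?_⟩
  by_cases hc : c = 0
  · simp [hc]
  rw [h1 c hc a]
  congr 1
  -- The factors of two vectors that are not orthogonal agree by symmetry. Orthogonal vectors are
  -- compared through their sum, which is orthogonal to neither.
  by_cases hcc : G c c₀ = 0
  · have hd1 : G (c + c₀) c ≠ 0 := by
      rw [map_add, add_apply, hG c₀ c, hcc, add_zero]; exact (hpos c hc).ne'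
    have hd2 : G (c + c₀) c₀ ≠ 0 := by
      rw [map_add, add_apply, hcc, zero_add]; exact (hpos c₀ hc₀).ne'
    have hd : c + c₀ ≠ 0 := fun h0 ↦ hd1 (by rw [h0]; simp)
    exact (h2 _ _ hd hc hd1).symm.trans (h2 _ _ hd hc₀ hd2)
  · exact h2 c c₀ hc hc₀ hcc

/-- The dual of a centroaffine connection, if it has the same curvature, is centroaffine with the
same second fundamental form. -/
theorem IsCentroaffineAt.dual {Γ Γ' : E → E →L[ℝ] E →L[ℝ] E} {h : E → E →L[ℝ] E →L[ℝ] ℝ} {x : E}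
    (hc : IsCentroaffineAt Γ h x) {G : E →L[ℝ] E →L[ℝ] ℝ} (hG : ∀ a b, G a b = G b a)
    (hpos : ∀ a, a ≠ 0 → 0 < G a a) (hR : ∀ a b c, riem Γ x a b c = riem Γ' x a b c)
    (hskew : ∀ a b c d, G (riem Γ x a b c) d = -G c (riem Γ x a b d))
    {D : E → E → E} (hD : ∀ c a, Γ' x c a = Γ x c a + D c a) (hD₁ : ∀ a b, D a b = D b a)
    (hD₂ : ∀ a b c, G (D a b) c = G (D a c) b) : IsCentroaffineAt Γ' h x where
  christoffel_symm a b := by rw [hD, hD, hc.christoffel_symm, hD₁]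
  symm := hc.symm
  riem_eq a b c := by rw [← hR, hc.riem_eq]
  codazzi a b c := by
    -- Skewness gives `G(R(a, b)c, c) = 0`, which, with the centroaffine form of `R`, is the
    -- hypothesis on `h`.
    obtain ⟨μ, hμ⟩ := exists_eq_mul_of_skew hG hpos hc.symm fun a b c ↦ by
      have h1 := hskew a b c c
      rw [hG c] at h1
      have h2 : G (riem Γ x a b c) c = 0 := by linarith
      rw [hc.riem_eq] at h2
      simp only [map_sub, map_smul, sub_apply, smul_apply, smul_eq_mul] at h2
      linarith
    have h1 := hc.codazzi a b c
    -- The two Codazzi equations differ by these terms. They are equal since `h = μ G` at `x` and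
    -- `G(D ·, ·)` is totally symmetric; `μ` is needed at this point only and is not differentiated.
    have h2 : h x b (D c a) = h x a (D c b) := by
      rw [hμ, hμ, hG b, hG a, hD₂ c a b]
    rw [hD, hD, ContinuousLinearMap.map_add, ContinuousLinearMap.map_add, h2]
    linarith

end DualAlgebra

/-! ### The dual connection in a chart -/

section DualConnection

set_option linter.unusedSectionVars false

open Set Filter

variable {E : Type*} [NormedAddCommGroup E] [NormedSpace ℝ E] [FiniteDimensional ℝ E]
  {M : Type*} [TopologicalSpace M] [ChartedSpace E M] [IsManifold 𝓘(ℝ, E) ∞ M]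
  [Bundle.RiemannianBundle (fun x : M ↦ TangentSpace 𝓘(ℝ, E) x)]
  {e : OpenPartialHomeomorph M E}

/-- The Riemannian metric in a chart. -/
def chartMetric (e : OpenPartialHomeomorph M E) (x : E) : E →L[ℝ] E →L[ℝ] ℝ :=
  have h : IsBilinearMap ℝ (fun a b : E ↦
      inner ℝ (chartInv e (e.symm x) a) (chartInv e (e.symm x) b)) :=
    { add_left := fun a a' b ↦ by rw [map_add, inner_add_left]
      smul_left := fun t a b ↦ by rw [map_smul, real_inner_smul_left, smul_eq_mul]
      add_right := fun a b b' ↦ by rw [map_add, inner_add_right]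
      smul_right := fun t a b ↦ by rw [map_smul, real_inner_smul_right, smul_eq_mul] }
  h.toContinuousBilinearMap

theorem chartMetric_apply (e : OpenPartialHomeomorph M E) (x a b : E) :
    chartMetric e x a b = inner ℝ (chartInv e (e.symm x) a) (chartInv e (e.symm x) b) := rfl

theorem chartMetric_comm (e : OpenPartialHomeomorph M E) (x a b : E) :
    chartMetric e x a b = chartMetric e x b a := by
  rw [chartMetric_apply, chartMetric_apply, real_inner_comm]

theorem chartMetric_pos (he : e ∈ IsManifold.maximalAtlas 𝓘(ℝ, E) ∞ M) {x : E}
    (hx : x ∈ e.target) {a : E} (ha : a ≠ 0) : 0 < chartMetric e x a a := by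
  rw [chartMetric_apply]
  refine real_inner_self_pos.2 fun h0 ↦ ha ?_
  rw [← chartDeriv_chartInv he (e.map_target hx) a, h0, map_zero]

theorem eq_zero_of_chartMetric_eq_zero (he : e ∈ IsManifold.maximalAtlas 𝓘(ℝ, E) ∞ M) {x : E}
    (hx : x ∈ e.target) {a : E} (h : ∀ b, chartMetric e x a b = 0) : a = 0 := by
  by_contra ha
  exact (chartMetric_pos he hx ha).ne' (h a)

/-- The metric at a point of the domain of a chart. -/
theorem chartMetric_chart {q : M} (hq : q ∈ e.source) (a b : E) :
    chartMetric e (e q) a b =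
      inner ℝ (chartField e (fun _ ↦ a) q) (chartField e (fun _ ↦ b) q) := by
  have : ∀ q', q' = q → inner ℝ (chartInv e q' a) (chartInv e q' b) =
      inner ℝ (chartField e (fun _ ↦ a) q) (chartField e (fun _ ↦ b) q) := by
    rintro _ rfl
    rfl
  exact this _ (e.left_inv hq)

theorem inner_eq_chartMetric (he : e ∈ IsManifold.maximalAtlas 𝓘(ℝ, E) ∞ M) {x : E}
    (hx : x ∈ e.target) (v w : TangentSpace 𝓘(ℝ, E) (e.symm x)) :
    inner ℝ v w = chartMetric e x (chartDeriv e (e.symm x) v) (chartDeriv e (e.symm x) w) := by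
  rw [chartMetric_apply, chartInv_chartDeriv he (e.map_target hx),
    chartInv_chartDeriv he (e.map_target hx)]

variable [IsContMDiffRiemannianBundle 𝓘(ℝ, E) ∞ E (fun x : M ↦ TangentSpace 𝓘(ℝ, E) x)]

theorem contDiffOn_chartMetric (he : e ∈ IsManifold.maximalAtlas 𝓘(ℝ, E) ∞ M) :
    ContDiffOn ℝ ∞ (chartMetric e) e.target := by
  refine contDiffOn_clm_apply.2 fun a ↦ contDiffOn_clm_apply.2 fun b ↦ fun x hx ↦ ?_
  have hxs := e.map_target hx
  have h1 : ContMDiffAt 𝓘(ℝ, E) 𝓘(ℝ, ℝ) ∞ (fun q : M ↦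
      inner ℝ (chartField e (fun _ ↦ a) q) (chartField e (fun _ ↦ b) q)) (e.symm x) :=
    ContMDiffAt.inner_bundle (contMDiffAt_chartField he hxs contDiffAt_const)
      (contMDiffAt_chartField he hxs contDiffAt_const)
  have h2 := h1.comp x (contMDiffAt_symm_of_mem_maximalAtlas he hx)
  refine (contMDiffAt_iff_contDiffAt.1 h2).contDiffWithinAt.congr_of_mem (fun y hy ↦ ?_) hx
  have := chartMetric_chart (e.map_target hy) a b
  rw [e.right_inv hy] at this
  exact this

theorem contDiffAt_chartMetric (he : e ∈ IsManifold.maximalAtlas 𝓘(ℝ, E) ∞ M) {x : E}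
    (hx : x ∈ e.target) : ContDiffAt ℝ ∞ (chartMetric e) x :=
  (contDiffOn_chartMetric he).contDiffAt (e.open_target.mem_nhds hx)

/-- The dual connection in terms of Christoffel symbols. -/
theorem fderiv_chartMetric (he : e ∈ IsManifold.maximalAtlas 𝓘(ℝ, E) ∞ M)
    (cov : AffineConnection 𝓘(ℝ, E) M) {x : E} (hx : x ∈ e.target) (c a b : E) :
    fderiv ℝ (chartMetric e) x c a b = chartMetric e x (christoffel cov e x a c) b +
      chartMetric e x a (christoffel (dual cov) e x b c) := by
  have hxs := e.map_target hx
  have hd : DifferentiableAt ℝ (chartMetric e) x :=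
    (contDiffAt_chartMetric he hx).differentiableAt (by simp)
  have hd' : DifferentiableAt ℝ (fun y ↦ chartMetric e y a b) x :=
    (hasFDerivAt_apply_const (hasFDerivAt_apply_const hd.hasFDerivAt a) b).differentiableAt
  have h1 := dual_spec cov (chartInv e (e.symm x) c)
    (mdifferentiableAt_chartField he hxs (differentiableAt_const a))
    (mdifferentiableAt_chartField he hxs (differentiableAt_const b))
  have h2 : (fun q : M ↦ inner ℝ (chartField e (fun _ ↦ a) q) (chartField e (fun _ ↦ b) q))
      =ᶠ[𝓝 (e.symm x)] fun q ↦ chartMetric e (e q) a b := by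
    filter_upwards [e.open_source.mem_nhds hxs] with q hq
    exact (chartMetric_chart hq a b).symm
  have h3 := mvfderiv_comp_chart he hxs (F := fun y ↦ chartMetric e y a b)
    (by rwa [e.right_inv hx]) (chartInv e (e.symm x) c)
  rw [e.right_inv hx, chartDeriv_chartInv he hxs] at h3
  rw [fderiv_clm_apply_two hd, ← h3]
  have h4 : mvfderiv 𝓘(ℝ, E) (fun q ↦ chartMetric e (e q) a b) (e.symm x) =
      mvfderiv 𝓘(ℝ, E) (fun q : M ↦ inner ℝ (chartField e (fun _ ↦ a) q)
        (chartField e (fun _ ↦ b) q)) (e.symm x) := h2.symm.mfderiv_eq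
  refine ((congrArg (fun T ↦ T (chartInv e (e.symm x) c)) h4).trans h1).trans ?_
  rw [inner_eq_chartMetric he hx, inner_eq_chartMetric he hx, chartDeriv_chartField he hxs,
    chartDeriv_chartField he hxs, christoffel_eq_chartRep he cov hx,
    christoffel_eq_chartRep he (dual cov) hx]
  rfl

/-- The difference of the Christoffel symbols of a connection and its dual. -/
theorem christoffel_dual (he : e ∈ IsManifold.maximalAtlas 𝓘(ℝ, E) ∞ M)
    (cov : AffineConnection 𝓘(ℝ, E) M) {x : E} (hx : x ∈ e.target) (c a : E) :
    christoffel (dual cov) e x c a = christoffel cov e x c a +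
      chartDeriv e (e.symm x) (dualTerm cov (e.symm x) (chartInv e (e.symm x) c)
        (chartInv e (e.symm x) a)) := by
  rw [christoffel_eq_chartRep he cov hx, christoffel_eq_chartRep he (dual cov) hx]
  exact (chartDeriv e (e.symm x)).map_add _ _

/-- The cubic form is the difference of the two connections with an index lowered. The symmetry of
the statistical structure thus becomes total symmetry of the difference tensor. -/
theorem chartMetric_dualTerm (he : e ∈ IsManifold.maximalAtlas 𝓘(ℝ, E) ∞ M)
    (cov : AffineConnection 𝓘(ℝ, E) M) {x : E} (hx : x ∈ e.target) (c a b : E) :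
    chartMetric e x (chartDeriv e (e.symm x) (dualTerm cov (e.symm x) (chartInv e (e.symm x) c)
        (chartInv e (e.symm x) a))) b =
      cubicForm cov (e.symm x) (chartInv e (e.symm x) a) (chartInv e (e.symm x) c)
        (chartInv e (e.symm x) b) := by
  rw [chartMetric_apply, chartInv_chartDeriv he (e.map_target hx), inner_dualTerm]
  rfl

theorem chartMetric_isInvertible (he : e ∈ IsManifold.maximalAtlas 𝓘(ℝ, E) ∞ M) {x : E}
    (hx : x ∈ e.target) : (chartMetric e x).IsInvertible := by
  have hB : Function.Injective (chartMetric e x).toLinearMap := by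
    rw [injective_iff_map_eq_zero]
    exact fun v hv ↦ eq_zero_of_chartMetric_eq_zero he hx fun w ↦
      congrArg (fun φ : E →L[ℝ] ℝ ↦ φ w) hv
  have hfin : Module.finrank ℝ E = Module.finrank ℝ (E →L[ℝ] ℝ) := by
    rw [← (LinearMap.toContinuousLinearMap (𝕜 := ℝ) (E := E) (F' := ℝ)).finrank_eq]
    exact Subspace.dual_finrank_eq.symm
  exact ⟨(LinearEquiv.ofInjectiveOfFinrankEq _ hB hfin).toContinuousLinearEquiv, rfl⟩

/-- The duality relation expresses the Christoffel symbols of the dual, after lowering an index,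
through `g`, its derivative and those of `∇`; inverting the metric preserves smoothness. -/
theorem contDiffOn_christoffel_dual [T2Space M] (he : e ∈ IsManifold.maximalAtlas 𝓘(ℝ, E) ∞ M)
    (cov : AffineConnection 𝓘(ℝ, E) M)
    [CovariantDerivative.ContMDiffCovariantDerivative cov ∞] :
    ContDiffOn ℝ ∞ (christoffel (dual cov) e) e.target := by
  have hG := contDiffOn_chartMetric he
  have hΓ := contDiffOn_christoffel he cov
  have hdG : ContDiffOn ℝ ∞ (fderiv ℝ (chartMetric e)) e.target :=
    hG.fderiv_of_isOpen e.open_target (by simp)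
  have hinv : ContDiffOn ℝ ∞ (fun x ↦ (chartMetric e x).inverse) e.target := fun x hx ↦
    ((chartMetric_isInvertible he hx).contDiffAt_map_inverse.comp x
      (contDiffAt_chartMetric he hx)).contDiffWithinAt
  refine contDiffOn_clm_apply.2 fun c ↦ contDiffOn_clm_apply.2 fun a ↦ ?_
  have hψ : ContDiffOn ℝ ∞ (fun x ↦ chartMetric e x (christoffel (dual cov) e x c a))
      e.target := by
    refine contDiffOn_clm_apply.2 fun b ↦ ContDiffOn.congr
      (f := fun x ↦ fderiv ℝ (chartMetric e) x a b c -
        chartMetric e x (christoffel cov e x b a) c) ?_ fun x hx ↦ ?_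
    · exact ((hdG.clm_apply contDiffOn_const).clm_apply contDiffOn_const |>.clm_apply
        contDiffOn_const).sub ((hG.clm_apply ((hΓ.clm_apply contDiffOn_const).clm_apply
          contDiffOn_const)).clm_apply contDiffOn_const)
    · rw [fderiv_chartMetric he cov hx, add_sub_cancel_left, chartMetric_comm]
  refine (hinv.clm_apply hψ).congr fun x hx ↦ ?_
  exact ((chartMetric_isInvertible he hx).inverse_apply_self _).symm

/-! ### Conjugate symmetric statistical structures -/

section ConjugateSymmetric

variable [T2Space M] {cov : AffineConnection 𝓘(ℝ, E) M}
  [CovariantDerivative.ContMDiffCovariantDerivative cov ∞]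

theorem riem_christoffel_dual (he : e ∈ IsManifold.maximalAtlas 𝓘(ℝ, E) ∞ M)
    (hconj : ConjugateSymmetric cov) {x : E} (hx : x ∈ e.target) (a b c : E) :
    riem (christoffel cov e) x a b c = riem (christoffel (dual cov) e) x a b c := by
  have hxs := e.map_target hx
  have hd : ∀ {Γ : E → E →L[ℝ] E →L[ℝ] E}, ContDiffOn ℝ ∞ Γ e.target →
      DifferentiableAt ℝ Γ (e (e.symm x)) := fun h ↦ by
    rw [e.right_inv hx]
    exact (h.contDiffAt (e.open_target.mem_nhds hx)).differentiableAt (by simp)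
  have h1 := chartDeriv_curvature he cov hxs (hd (contDiffOn_christoffel he cov))
    (chartInv e _ a) (chartInv e _ b) (chartInv e _ c)
  have h2 := chartDeriv_curvature he (dual cov) hxs (hd (contDiffOn_christoffel_dual he cov))
    (chartInv e _ a) (chartInv e _ b) (chartInv e _ c)
  rw [hconj, h2] at h1
  simpa only [chartDeriv_chartInv he hxs, e.right_inv hx] using h1.symm

/-- Duality gives `g(R(a, b)c, d) = -g(c, R̄(a, b)d)`, and here `R̄ = R`. -/
theorem chartMetric_riem_skew (he : e ∈ IsManifold.maximalAtlas 𝓘(ℝ, E) ∞ M)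
    (hconj : ConjugateSymmetric cov) {x : E} (hx : x ∈ e.target) (a b c d : E) :
    chartMetric e x (riem (christoffel cov e) x a b c) d =
      -chartMetric e x c (riem (christoffel cov e) x a b d) := by
  have hxn := e.open_target.mem_nhds hx
  have h := metric_riem_add ((contDiffAt_chartMetric he hx).of_le two_le_infty)
    (((contDiffOn_christoffel he cov).contDiffAt hxn).differentiableAt (by simp))
    (((contDiffOn_christoffel_dual he cov).contDiffAt hxn).differentiableAt (by simp))
    (by filter_upwards [hxn] with y hy using fderiv_chartMetric he cov hy) a b c d
  rw [riem_christoffel_dual he hconj hx a b d]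
  exact eq_neg_of_add_eq_zero_left h

theorem ConjugateSymmetric.ricciSymmetric (hconj : ConjugateSymmetric cov)
    (htor : cov.torsion = 0) : RicciSymmetric cov := by
  intro q v w
  have he := IsManifold.chart_mem_maximalAtlas (I := 𝓘(ℝ, E)) (n := ∞) q
  have hq := mem_chart_source E q
  have hx := (chartAt E q).map_source hq
  have hxn := (chartAt E q).open_target.mem_nhds hx
  rw [ricci_eq_ricciForm he cov hq, ricci_eq_ricciForm he cov hq]
  refine ricciForm_symm_of_skew (G := chartMetric (chartAt E q) (chartAt E q q))
    (fun v hv ↦ eq_zero_of_chartMetric_eq_zero he hx hv)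
    (((contDiffOn_christoffel he cov).contDiffAt hxn).differentiableAt (by simp)) ?_
    (chartMetric_riem_skew he hconj hx) _ _
  filter_upwards [hxn] with y hy using christoffel_symm_of_torsion_eq_zero he htor hy

/-- Total symmetry of the cubic form supplies both symmetries of the difference tensor; conjugate
symmetry supplies equality and skewness of the curvatures. The dual then inherits the same second
fundamental form. -/
theorem IsCentroaffine.dual {H : Π q : M, TangentSpace 𝓘(ℝ, E) q → TangentSpace 𝓘(ℝ, E) q → ℝ}
    (hc : IsCentroaffine cov H) (hstat : IsStatistical cov) (hconj : ConjugateSymmetric cov) :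
    IsCentroaffine (dual cov) H := by
  intro e he
  obtain ⟨h, -, h2, h3, h4⟩ := hc e he
  refine ⟨h, contDiffOn_christoffel_dual he cov, h2, h3, fun x hx ↦ ?_⟩
  refine (h4 x hx).dual (chartMetric_comm e x) (fun a ↦ chartMetric_pos he hx)
    (riem_christoffel_dual he hconj hx) (chartMetric_riem_skew he hconj hx)
    (christoffel_dual he cov hx) (fun a b ↦ ?_) fun a b c ↦ ?_
  · refine sub_eq_zero.1 (eq_zero_of_chartMetric_eq_zero he hx fun c ↦ ?_)
    rw [ContinuousLinearMap.map_sub, sub_apply, chartMetric_dualTerm he cov hx,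
      chartMetric_dualTerm he cov hx, hstat.symm_left, sub_self]
  · rw [chartMetric_dualTerm he cov hx, chartMetric_dualTerm he cov hx, hstat.symm_left,
      hstat.symm_right, hstat.symm_left]

end ConjugateSymmetric

end DualConnection

/-! ### Spheres and the main theorem -/

/-- Centroaffine connections on spheres are complete. -/
theorem IsCentroaffine.geodesicallyComplete {n : ℕ} (hn : 2 ≤ n) {M : Type*} [TopologicalSpace M]
    [T2Space M] [ChartedSpace (EuclideanSpace ℝ (Fin n)) M] [IsManifold (𝓡 n) ∞ M]
    (Φ : M ≃ₘ⟮𝓡 n, 𝓡 n⟯ Metric.sphere (0 : EuclideanSpace ℝ (Fin (n + 1))) 1)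
    {cov : AffineConnection (𝓡 n) M}
    {H : Π q : M, TangentSpace (𝓡 n) q → TangentSpace (𝓡 n) q → ℝ}
    (hc : IsCentroaffine cov H) : GeodesicallyComplete cov := by
  have : CompactSpace M := Φ.toHomeomorph.symm.compactSpace
  obtain ⟨e₁, e₂, he₁, ht₁, he₂, ht₂, hcover, hconn⟩ := exists_two_charts hn Φ
  obtain ⟨f, hf⟩ := exists_isCentroaffineMapAt hc he₁ ht₁ he₂ ht₂ hcover hconn
  refine geodesicallyComplete_of_isCentroaffineMapAt (fun q ↦ ?_) hc hf
  rcases (hcover.symm ▸ Set.mem_univ q : q ∈ e₁.source ∪ e₂.source) with hq | hq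
  · exact ⟨e₁, he₁, hq, ht₁⟩
  · exact ⟨e₂, he₂, hq, ht₂⟩

end StatGeom

end

theorem theorem5p7 (n : ℕ) (hn : 2 ≤ n)
    {M : Type*} [TopologicalSpace M] [T2Space M] [ChartedSpace (EuclideanSpace ℝ (Fin n)) M]
    [IsManifold (𝓡 n) ∞ M]
    (hM : Nonempty (M ≃ₘ⟮𝓡 n, 𝓡 n⟯ Metric.sphere (0 : EuclideanSpace ℝ (Fin (n + 1))) 1))
    [Bundle.RiemannianBundle (fun x : M ↦ TangentSpace (𝓡 n) x)]
    [IsContMDiffRiemannianBundle (𝓡 n) ∞ (EuclideanSpace ℝ (Fin n))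
      (fun x : M ↦ TangentSpace (𝓡 n) x)]
    (cov : StatGeom.AffineConnection (𝓡 n) M)
    [CovariantDerivative.ContMDiffCovariantDerivative cov ∞]
    (hstat : StatGeom.IsStatistical cov) :
    (StatGeom.RicciSymmetric cov → StatGeom.RicciNondegenerate cov →
        StatGeom.ProjectivelyFlat cov → StatGeom.GeodesicallyComplete cov) ∧
      (StatGeom.ConjugateSymmetric cov → StatGeom.ProjectivelyFlat cov →
        StatGeom.GeodesicallyComplete cov ∧
          StatGeom.GeodesicallyComplete (StatGeom.dual cov)) := by
  obtain ⟨Φ⟩ := hM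
  have hn' : 2 ≤ Module.finrank ℝ (EuclideanSpace ℝ (Fin n)) := by
    rwa [finrank_euclideanSpace_fin]
  refine ⟨fun hric _ hflat ↦ ?_, fun hconj hflat ↦ ?_⟩
  · exact (StatGeom.isCentroaffine_of_projectivelyFlat hn' cov hstat.torsion_eq_zero hric
      hflat).geodesicallyComplete hn Φ
  -- Symmetry of the Ricci tensor is a consequence of conjugate symmetry here. Projective flatness
  -- is used for `∇` only; the dual is reached through the structure equations.
  · have hc := StatGeom.isCentroaffine_of_projectivelyFlat hn' cov hstat.torsion_eq_zero
      (hconj.ricciSymmetric hstat.torsion_eq_zero) hflat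
    exact ⟨hc.geodesicallyComplete hn Φ, (hc.dual hstat hconj).geodesicallyComplete hn Φ⟩
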